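/- **Setting.** Let $n\ge 2$ and $k\ge 1$ be integers. For $d,r\ge 0$ let $\mathcal I(d,r)$ be the set of strictly increasing $r$-tuples in $\{1,\dots,d\}$, and let $\mathcal S(n,k)$ be the set of multi-indices $\alpha\in\mathbb Z_{\ge 0}^n$ with $|\alpha|=k$; put $m=\binom{n-1+k}{k}=|\mathcal S(n,k)|$. An integer $\ell\in\{1,\dots,k\}$ is an *admissible degree increment* for $(n,k)$ if there is an integer $N>0$ with $$\binom N\ell=\binom{n-1+k}{k},\qquad N\ge n-1+\ell. \qquad (\ast)$$ Given such $\ell$ and $N$, let $i:\mathbb R^n\to\mathbb R^N$, $i(x)=(x_1,\dots,x_n,0,\dots,0)$, and $\pi:\mathbb R^N\to\mathbb R^n$, $\pi(z)=(z_1,\dots,z_n)$; for $\alpha\in\mathcal S(n,k)$ let $i\alpha=(\alpha_1,\dots,\alpha_n,0,\dots,0)$, and let $\aleph$ be any bijection from $i\mathcal S(n,k)=\{i\alpha:\alpha\in\mathcal S(n,k)\}$ onto $\mathcal I(N,\ell)$. Write $\epsilon^{A}_{C}$ for the sign of the permutation that carries the finite sequence $A$ to the label $C$ if these have identical content, and $\epsilon^A_C=0$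 otherwise. A function $F:\mathbb R^N\to\mathbb R$ is *hybrid* if $F\circ i\circ\pi=F$. Then $\widetilde L^p$ is the space of hybrid $F$ with $F\circ i\in L^p(\mathbb R^n)$; $\widetilde C^{\infty,c}$ is the space of hybrid $\varphi$ with $\varphi\circ i\in C_c^\infty(\mathbb R^n)$; derivatives of hybrid functions in the sense of distributions are taken against $\widetilde C^{\infty,c}$ with respect to the pairing $\int_{\mathbb R^n}(F\circ i)(\varphi\circ i)\,dx$; and $\widetilde W^{1,p}$ is the space of $F\in\widetilde L^p$ whose first order derivatives belong to $\widetilde L^p$. For $q$-forms $F=\sum_{I\in\mathcal I(N,q)}F_I\,dz^I$ on $\mathbb R^N$, the spaces $\widetilde L^p_q$, $\widetilde W^{1,p}_q$ are defined coefficientwise, and $$\langle F,H\rangle_{\widetilde L}=\int_{\mathbb R^n}\sum_I (F_I\circ i)(H_I\circ i)\,dx,\qquad \|F\|_{\widetilde L^p_q}=\Big\|\Big(\sum_I|F_I\circ i|^2\Big)^{1/2}\Big\|_{L^p(\mathbb R^n)},$$ $$\|\nabla H\|_{\widetilde L^p_q}=\Big\|\Big(\sum_{I}\sum_{t=1}^N\Big|\frac{\partial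 H_I}{\partial z_t}\circ i\Big|^2\Big)^{1/2}\Big\|_{L^p(\mathbb R^n)}.$$ With $*_N$ the Hodge star of $\mathbb R^N$, define $$\widetilde T_{\ell,\aleph}F=\sum_{L\in\mathcal I(N,q+\ell)}\Big(\sum_{I\in\mathcal I(N,q),\ \alpha\in\mathcal S(n,k)}\epsilon_L^{\aleph(i\alpha)I}\,\frac{\partial^kF_I}{\partial z^{i\alpha}}\Big)dz^L\quad(q\text{-forms}\to(q+\ell)\text{-forms}),$$ $$\widetilde T^*_{\ell,\aleph}=(-1)^{k+q(N-\ell-q)}*_N\widetilde T_{\ell,\aleph}\,*_N\quad((q+\ell)\text{-forms}\to q\text{-forms}).$$ **Theorem.** Let $n\ge2$ and $k\ge1$. There is a constant $\widetilde C$, depending only on $n$ and $k$, such that for every admissible degree increment $\ell$ for $(n,k)$, every $N$ satisfying $(\ast)$ and every bijection $\aleph$ as above: 1. for all $0\le q\le N-\ell$ and all $F\in\widetilde L^1_q(\mathbb R^N)$, if $\widetilde T_{\ell,\aleph}F=0$ in the sense of distributions, then $$|\langle F,H\rangle_{\widetilde L}|\le\widetilde C\,\|F\|_{\widetilde L^1_q}\,\|\nabla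 H\|_{\widetilde L^n_q}\qquad\text{for all } H\in(\widetilde L^\infty_q\cap\widetilde W^{1,n}_q)(\mathbb R^N);$$ 2. for all $\ell\le p\le N$ and all $G\in\widetilde L^1_p(\mathbb R^N)$, if $\widetilde T^*_{\ell,\aleph}G=0$ in the sense of distributions, then $$|\langle G,K\rangle_{\widetilde L}|\le\widetilde C\,\|G\|_{\widetilde L^1_p}\,\|\nabla K\|_{\widetilde L^n_p}\qquad\text{for all } K\in(\widetilde L^\infty_p\cap\widetilde W^{1,n}_p)(\mathbb R^N).$$ Moreover, for all such $\ell$, $N$ and $\aleph$, statements 1 and 2 hold with some constant if and only if Van Schaftingen's $k$-th order divergence $L^1$-duality theorem holds for $(n,k)$, that is: there is a constant $C$ such that, for every $g=(g_\alpha)\in L^1(\mathbb R^n;\mathbb R^m)$ with $\sum_{\alpha\in\mathcal S(n,k)}\frac{\partial^kg_\alpha}{\partial x^\alpha}=0$ in the sense of distributions, every $h=(h_\alpha)\in(W^{1,n}\cap L^\infty)(\mathbb R^n;\mathbb R^m)$ and every $\alpha\in\mathcal S(n,k)$, $$\Big|\int_{\mathbb R^n}g_\alpha h_\alpha\,dx\Big|\le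 C\,\|g\|_{L^1}\,\|\nabla h\|_{L^n}.$$ -/

import Mathlib

open MeasureTheory
open scoped ENNReal ContDiff

noncomputable section

namespace HybridForms

/-! ### Labels, multi-indices and signs -/

/-- The label set `I(N, q)`: strictly increasing `q`-tuples in `{1, …, N}`. -/
abbrev Label (N q : ℕ) : Type := Fin q ↪o Fin N

/-- The set `S(n, k)` of multi-indices `α ∈ {0, …, k}ⁿ` with `α₁ + ⋯ + αₙ = k`. -/
abbrev MultiIndex (n k : ℕ) : Type :=
  {α : Fin n → Fin (k + 1) // ∑ t, (α t : ℕ) = k}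

/-- `α` as a tuple of natural numbers. -/
def MultiIndex.toFun {n k : ℕ} (α : MultiIndex n k) : Fin n → ℕ := fun t => (α.1 t : ℕ)

/-- `i α = (α₁, …, αₙ, 0, …, 0)`, a multi-index of length `N`. -/
def padIndex (N : ℕ) {n : ℕ} (α : Fin n → ℕ) : Fin N → ℕ :=
  fun t => if h : (t : ℕ) < n then α ⟨t, h⟩ else 0

/-- The set `i S(n, k)`. -/
def iS (n k N : ℕ) : Set (Fin N → ℕ) :=
  Set.range fun α : MultiIndex n k => padIndex N α.toFun

/-- `i α` as an element of `i S(n, k)`. -/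
def emb (N : ℕ) {n k : ℕ} (α : MultiIndex n k) : iS n k N :=
  ⟨padIndex N α.toFun, α, rfl⟩

/-- The sign `ε^A_C` of the permutation that carries the finite sequence `A` to the finite
sequence `C`, if these have identical content, and `0` otherwise. It is used for `C` without
repetitions, and then at most one term of the sum is different from `0`. -/
def eps {N a c : ℕ} (A : Fin a → Fin N) (C : Fin c → Fin N) : ℤ :=
  if h : c = a then
    ∑ σ : Equiv.Perm (Fin c),
      if (fun j => A (Fin.cast h (σ j))) = C then ((Equiv.Perm.sign σ : ℤˣ) : ℤ) else 0
  else 0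

/-! ### Admissible degree increments -/

/-- `N` is a positive solution of `binom N ℓ = binom (n-1+k) k` with `N ≥ n - 1 + ℓ`. -/
def IsInflatedDim (n k ℓ N : ℕ) : Prop :=
  0 < N ∧ N.choose ℓ = (n - 1 + k).choose k ∧ n - 1 + ℓ ≤ N

/-- `ℓ` is an admissible degree increment for the pair `(n, k)`. -/
def IsAdmissible (n k ℓ : ℕ) : Prop :=
  1 ≤ ℓ ∧ ℓ ≤ k ∧ ∃ N, IsInflatedDim n k ℓ N

/-! ### Partial derivatives -/

/-- `ℝⁿ` with its Euclidean norm and Lebesgue measure. -/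
abbrev E (n : ℕ) : Type := EuclideanSpace ℝ (Fin n)

/-- The (classical) partial derivative `∂f/∂z_t`. -/
def partialD {N : ℕ} (t : Fin N) (f : E N → ℝ) : E N → ℝ :=
  fun z => fderiv ℝ f z (EuclideanSpace.single t 1)

/-- The (classical) iterated partial derivative `∂^β f = ∂₁^{β₁} ⋯ ∂_N^{β_N} f`. -/
def multiD {N : ℕ} (β : Fin N → ℕ) (f : E N → ℝ) : E N → ℝ :=
  (List.finRange N).foldr (fun t g => (partialD t)^[β t] g) f

/-! ### Lebesgue and Sobolev spaces on `ℝⁿ` -/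

/-- `φ ∈ C_c^∞(ℝⁿ)`. -/
def IsTest {n : ℕ} (φ : E n → ℝ) : Prop := ContDiff ℝ ∞ φ ∧ HasCompactSupport φ

/-- `g = ∂^β f` in the weak sense on `ℝⁿ`. -/
def IsWeakDeriv {n : ℕ} (β : Fin n → ℕ) (f g : E n → ℝ) : Prop :=
  LocallyIntegrable f volume ∧ LocallyIntegrable g volume ∧
    ∀ φ : E n → ℝ, IsTest φ →
      ∫ x, g x * φ x = (-1) ^ (∑ t, β t) * ∫ x, f x * multiD β φ x

open Classical in
/-- The weak derivative `∂^β f` on `ℝⁿ` (unique up to null sets; `0` if there is none). -/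
def weakDeriv {n : ℕ} (β : Fin n → ℕ) (f : E n → ℝ) : E n → ℝ :=
  if h : ∃ g, IsWeakDeriv β f g then h.choose else 0

/-- `f ∈ W^{a,p}(ℝⁿ)`. -/
def MemW {n : ℕ} (a : ℕ) (p : ℝ≥0∞) (f : E n → ℝ) : Prop :=
  MemLp f p volume ∧
    ∀ β : Fin n → ℕ, ∑ t, β t ≤ a → ∃ g, MemLp g p volume ∧ IsWeakDeriv β f g

/-- `‖g‖_{L^p(ℝⁿ; ℝ^ι)}`, with the Euclidean norm on `ℝ^ι`. -/
def vecNorm {n : ℕ} {ι : Type*} [Fintype ι] (p : ℝ≥0∞) (g : ι → E n → ℝ) : ℝ :=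
  (eLpNorm (fun x => √(∑ j, g j x ^ 2)) p volume).toReal

/-- `‖∇h‖_{L^p(ℝⁿ)}` for `h : ℝⁿ → ℝ^ι`. -/
def vecGradNorm {n : ℕ} {ι : Type*} [Fintype ι] (p : ℝ≥0∞) (h : ι → E n → ℝ) : ℝ :=
  vecNorm p fun (jt : ι × Fin n) => weakDeriv (Pi.single jt.2 1) (h jt.1)

/-- The `k`-th order divergence `L¹`-duality estimate with constant `C`: if
`g ∈ L¹(ℝⁿ; ℝ^m)` satisfies `∑_{|α| = k} ∂^α g_α = 0` in the sense of distributions then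
`|∫ g_α h_α| ≤ C ‖g‖_{L¹} ‖∇h‖_{Lⁿ}` for all `α` and all `h ∈ (W^{1,n} ∩ L^∞)(ℝⁿ; ℝ^m)`. -/
def DivergenceDuality (n k : ℕ) (C : ℝ) : Prop :=
  ∀ g : MultiIndex n k → E n → ℝ, (∀ α, MemLp (g α) 1 volume) →
    (∀ φ : E n → ℝ, IsTest φ →
      ∑ α : MultiIndex n k, (-1 : ℝ) ^ k * ∫ x, g α x * multiD α.toFun φ x = 0) →
    ∀ h : MultiIndex n k → E n → ℝ, (∀ α, MemLp (h α) ∞ volume) → (∀ α, MemW 1 n (h α)) →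
      ∀ α, |∫ x, g α x * h α x| ≤ C * vecNorm 1 g * vecGradNorm n h

/-! ### The embedding, the projection, and hybrid function spaces -/

/-- The embedding `i : ℝⁿ → ℝᴺ`, `i x = (x₁, …, xₙ, 0, …, 0)` (used for `n ≤ N`). -/
def incl (n N : ℕ) (x : E n) : E N :=
  WithLp.toLp 2 fun t : Fin N => if h : (t : ℕ) < n then x ⟨t, h⟩ else 0

/-- The projection `π : ℝᴺ → ℝⁿ`, `π z = (z₁, …, zₙ)` (used for `n ≤ N`). -/
def proj (n N : ℕ) (z : E N) : E n :=
  WithLp.toLp 2 fun t : Fin n => if h : (t : ℕ) < N then z ⟨t, h⟩ else 0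

/-- `F` is the trivial extension to `ℝᴺ` of a function on `ℝⁿ`: `F ∘ i ∘ π = F`. -/
def IsHybrid (n : ℕ) {N : ℕ} (F : E N → ℝ) : Prop := F ∘ incl n N ∘ proj n N = F

/-- `F ∈ L̃^p(ℝᴺ)`. -/
def MemLtilde (n : ℕ) {N : ℕ} (p : ℝ≥0∞) (F : E N → ℝ) : Prop :=
  IsHybrid n F ∧ MemLp (F ∘ incl n N) p volume

/-- `φ ∈ C̃^{∞,c}(ℝᴺ)`: a hybrid function with `φ ∘ i ∈ C_c^∞(ℝⁿ)`. -/
def IsTestTilde (n : ℕ) {N : ℕ} (φ : E N → ℝ) : Prop :=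
  IsHybrid n φ ∧ IsTest (φ ∘ incl n N)

/-- `⟨F, G⟩ = ∫_{ℝⁿ} (F ∘ i) (G ∘ i) dV` for functions on `ℝᴺ`. -/
def pair₀ (n : ℕ) {N : ℕ} (F G : E N → ℝ) : ℝ :=
  ∫ x : E n, F (incl n N x) * G (incl n N x)

/-- `G = ∂^β F` in the sense of distributions, for hybrid `F`, `G` and a multi-index `β` of
length `N`: the test functions are those in `C̃^{∞,c}(ℝᴺ)`, with respect to the pairing of
hybrid functions. -/
def IsWeakDerivTilde (n : ℕ) {N : ℕ} (β : Fin N → ℕ) (F G : E N → ℝ) : Prop :=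
  IsHybrid n F ∧ IsHybrid n G ∧
    LocallyIntegrable (F ∘ incl n N) volume ∧ LocallyIntegrable (G ∘ incl n N) volume ∧
    ∀ φ : E N → ℝ, IsTestTilde n φ →
      pair₀ n G φ = (-1) ^ (∑ t, β t) * pair₀ n F (multiD β φ)

open Classical in
/-- The weak derivative `∂^β F` of a hybrid function (unique up to null sets of `ℝⁿ`; `0` if
there is none). -/
def weakDerivTilde (n : ℕ) {N : ℕ} (β : Fin N → ℕ) (F : E N → ℝ) : E N → ℝ :=
  if h : ∃ G, IsWeakDerivTilde n β F G then h.choose else 0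

/-- `F ∈ W̃^{a,p}(ℝᴺ)`. -/
def MemWtilde (n : ℕ) {N : ℕ} (a : ℕ) (p : ℝ≥0∞) (F : E N → ℝ) : Prop :=
  MemLtilde n p F ∧
    ∀ β : Fin N → ℕ, ∑ t, β t ≤ a → ∃ G, MemLtilde n p G ∧ IsWeakDerivTilde n β F G

/-! ### Forms

A `q`-form on `ℝᴺ` with coefficients in an additive group `V` is the family of its coefficients
with respect to the basis `dz^I`, `I ∈ I(N, q)`. -/

/-- `q`-forms on `ℝᴺ` with coefficients in `V`. -/
abbrev Form (N q : ℕ) (V : Type*) : Type _ := Label N q → V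

/-- `⟨F, H⟩_{L̃} = ∫_{ℝⁿ} ∑_I (F_I ∘ i) (H_I ∘ i) dV`. -/
def pairing (n : ℕ) {N q : ℕ} (F H : Form N q (E N → ℝ)) : ℝ :=
  ∫ x : E n, ∑ I, F I (incl n N x) * H I (incl n N x)

/-- `‖F‖_{L̃^p_q} = ‖ (∑_I |F_I ∘ i|²)^{1/2} ‖_{L^p(ℝⁿ)}`. -/
def normTilde (n : ℕ) {N q : ℕ} (p : ℝ≥0∞) (F : Form N q (E N → ℝ)) : ℝ :=
  vecNorm p fun I => F I ∘ incl n N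

/-- `‖∇H‖_{L̃^p_q}`, where `∇H` is the family of all `∂H_I/∂z_t`, `1 ≤ t ≤ N`. -/
def gradNormTilde (n : ℕ) {N q : ℕ} (p : ℝ≥0∞) (H : Form N q (E N → ℝ)) : ℝ :=
  vecNorm p fun (It : Label N q × Fin N) =>
    weakDerivTilde n (Pi.single It.2 1) (H It.1) ∘ incl n N

/-- The Hodge star `*_N`: `*_N dz^I = ε^{I J}_{(1, …, N)} dz^J`, with `J` the complement
of `I`. -/
def star {N q : ℕ} {V : Type*} [AddCommGroup V] (F : Form N q V) : Form N (N - q) V :=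
  fun J => ∑ I : Label N q, eps (Fin.append I J) (id : Fin N → Fin N) • F I

/-- The action `∑_I F_I dz^I ↦ ∑_L (∑_{I, α} ε_L^{ℵ(iα) I} ∂^{iα} F_I) dz^L`, for coefficients
`F_I` in any space `V` on which derivatives `∂^β = D β` are given. -/
def opT {n k ℓ N q : ℕ} {V : Type*} [AddCommGroup V] (D : (Fin N → ℕ) → V → V)
    (al : iS n k N ≃ Label N ℓ) (F : Form N q V) : Form N (ℓ + q) V :=
  fun L => ∑ I : Label N q, ∑ α : MultiIndex n k,
    eps (Fin.append (al (emb N α)) I) L • D (emb N α) (F I)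

/-- The adjoint action on `p`-forms, `(-1)^{k + q (N - ℓ - q)} *_N T *_N` with `q = p - ℓ`;
the result is a form of degree `N - (ℓ + (N - p)) = p - ℓ`. -/
def opTstar {n k ℓ N p : ℕ} {V : Type*} [AddCommGroup V] (D : (Fin N → ℕ) → V → V)
    (al : iS n k N ≃ Label N ℓ) (G : Form N p V) : Form N (N - (ℓ + (N - p))) V :=
  fun J => (-1 : ℤ) ^ (k + (p - ℓ) * (N - ℓ - (p - ℓ))) • star (opT D al (star G)) J

/-! ### Operators in the sense of distributions -/

/-- Functionals acting on functions on `ℝᴺ`; only their values on `C̃^{∞,c}(ℝᴺ)` matter. -/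
abbrev Functional (N : ℕ) : Type := (E N → ℝ) → ℝ

/-- The functional `φ ↦ ⟨F, φ⟩` defined by a hybrid function `F`. -/
def toFunctional (n : ℕ) {N : ℕ} (F : E N → ℝ) : Functional N := fun φ => pair₀ n F φ

/-- The distributional derivative, `(∂^β u)(φ) = (-1)^{|β|} u(∂^β φ)`. -/
def distD {N : ℕ} (β : Fin N → ℕ) (u : Functional N) : Functional N :=
  fun φ => (-1) ^ (∑ t, β t) * u (multiD β φ)

/-- A form with distributional coefficients vanishes: each coefficient vanishes on
`C̃^{∞,c}(ℝᴺ)`. -/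
def VanishesDist (n : ℕ) {N q : ℕ} (U : Form N q (Functional N)) : Prop :=
  ∀ L, ∀ φ : E N → ℝ, IsTestTilde n φ → U L φ = 0

/-- The `L¹`-duality estimates, with constant `C`, for `T̃_{ℓ,ℵ}` on forms of degree
`0 ≤ q ≤ N - ℓ` and for its adjoint on forms of degree `ℓ ≤ p ≤ N`. -/
def HybridDuality (n k ℓ N : ℕ) (al : iS n k N ≃ Label N ℓ) (C : ℝ) : Prop :=
  (∀ q : ℕ, q + ℓ ≤ N →
    ∀ F : Form N q (E N → ℝ), (∀ I, MemLtilde n 1 (F I)) →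
      VanishesDist n (opT distD al fun I => toFunctional n (F I)) →
      ∀ H : Form N q (E N → ℝ), (∀ I, MemLtilde n ∞ (H I)) → (∀ I, MemWtilde n 1 n (H I)) →
        |pairing n F H| ≤ C * normTilde n 1 F * gradNormTilde n n H) ∧
  (∀ p : ℕ, ℓ ≤ p → p ≤ N →
    ∀ G : Form N p (E N → ℝ), (∀ I, MemLtilde n 1 (G I)) →
      VanishesDist n (opTstar distD al fun I => toFunctional n (G I)) →
      ∀ K : Form N p (E N → ℝ), (∀ I, MemLtilde n ∞ (K I)) → (∀ I, MemWtilde n 1 n (K I)) →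
        |pairing n G K| ≤ C * normTilde n 1 G * gradNormTilde n n K)

end HybridForms

end

/-!
The duality estimates for forms are consequences of Van Schaftingen's `L¹`-duality theorem for the
`k`-th order divergence, which is proved here as well (`exists_divergenceDuality`).

**The divergence theorem.** Fix `w ∈ ℝⁿ` with `w₀ = 1` and slice `ℝⁿ` by the hyperplanes
`w · x = t`; write `d = n - 1`. A change of variables makes the hyperplanes horizontal, and the
component of `g` normal to them is `G = ∑_α w^α g_α`. To estimate `∫ G φ` over one slice, extend
`φ` off the slice by averaging it at scale `ε + τ` at distance `τ`, and multiply the extension by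
a truncated `k`-fold primitive `U(τ)` of a mollifier (`sliceExt`, `exists_truncated_primitive`).
Tested with this function, the divergence condition isolates the slice integral: the terms in
which all `k` derivatives fall on `U` give `G` times the mollifier, and in all other terms
(`IsRemainder`) a derivative falls on the average, which leaves an average with a kernel of mean
zero. Morrey's inequality in the `d` variables of the slice (`exists_abs_avg_sub_le`), for the
exponent `d + 1 = n`, bounds such averages. The bound is `‖Dφ‖_{Lⁿ} ε^{1/n - 1} ‖g‖_{L¹}`, against
an error `‖Dφ‖_{Lⁿ} ε^{1/n} M` with `M = ∫ |G|` on the slice for replacing `φ` by its average at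
scale `ε`. The choice `ε = ‖g‖_{L¹} / M` balances the two (`exists_abs_integral_slice_le`), and
Hölder's inequality in `t` yields `|∫ G h| ≤ C ‖g‖_{L¹} ‖∇h‖_{Lⁿ}`
(`exists_abs_integral_normalPart_le`). Since the vectors `(w^α)_α` span (`span_monomials_eq_top`),
each component `g_α` is controlled. Bounded Sobolev functions `h` are reached by mollification
and cutoff (`exists_isTestFn_approx`).

**From fields to forms.** Hybrid functions on `ℝᴺ` are functions on `ℝⁿ`, and only the derivatives
in the first `n` directions enter. For a fixed label `L`, the coefficient of `dz^L` in `T̃ F` is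
the `k`-th order divergence of the field `α ↦ ∑_I ε_L^{ℵ(iα) I} F_I`. Because `L` and `ℵ(iα)`
determine `I`, and every `I` occurs for suitable `L` and `α`, each coefficient of `F` is, up to
sign, a component of a divergence-free field (`abs_integral_coeff_le`). The star operator is a
signed permutation of the coefficients (`exists_star_eq`), so the adjoint operator reduces to `T̃`
applied to `*G`. The constants involve only the number of labels, and `N ≤ binom N ℓ =
binom (n-1+k) k` bounds it in terms of `n` and `k`. The equivalence of the two kinds of estimates
holds because both are true.
-/

open MeasureTheory
open scoped ENNReal ContDiff

noncomputable section

namespace HybridForms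

/-! ### Test functions and iterated directional derivatives -/

section DirectionalDerivatives

variable {X X' : Type*} [NormedAddCommGroup X] [NormedSpace ℝ X]
  [NormedAddCommGroup X'] [NormedSpace ℝ X']

/-- Smooth compactly supported real functions on a normed space; on `E n` this is `IsTest`. -/
def IsTestFn (f : X → ℝ) : Prop := ContDiff ℝ ∞ f ∧ HasCompactSupport f

/-- The derivative of `f` in the direction `v`. -/
def dirD (v : X) (f : X → ℝ) : X → ℝ := fun x => fderiv ℝ f x v

/-- The iterated derivative of `f` along a list of directions. -/
def dirDs (V : List X) (f : X → ℝ) : X → ℝ := V.foldr dirD f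

@[simp] lemma dirDs_nil (f : X → ℝ) : dirDs [] f = f := rfl

@[simp] lemma dirDs_cons (v : X) (V : List X) (f : X → ℝ) :
    dirDs (v :: V) f = dirD v (dirDs V f) := rfl

lemma dirDs_append (V W : List X) (f : X → ℝ) : dirDs (V ++ W) f = dirDs V (dirDs W f) := by
  simp [dirDs, List.foldr_append]

lemma contDiff_dirD {f : X → ℝ} (hf : ContDiff ℝ ∞ f) (v : X) : ContDiff ℝ ∞ (dirD v f) :=
  (hf.fderiv_right (m := ∞) (by simp)).clm_apply contDiff_const

lemma contDiff_dirDs {f : X → ℝ} (hf : ContDiff ℝ ∞ f) (V : List X) :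
    ContDiff ℝ ∞ (dirDs V f) := by
  induction V with
  | nil => exact hf
  | cons v V ih => exact contDiff_dirD ih v

lemma tsupport_dirD_subset (v : X) (f : X → ℝ) : tsupport (dirD v f) ⊆ tsupport f := by
  refine (closure_mono ?_).trans (tsupport_fderiv_subset ℝ (f := f))
  intro x hx h
  exact hx (by simp [dirD, h])

lemma tsupport_dirDs_subset (V : List X) (f : X → ℝ) : tsupport (dirDs V f) ⊆ tsupport f := by
  induction V with
  | nil => exact subset_rfl
  | cons v V ih => exact (tsupport_dirD_subset v _).trans ih

namespace IsTestFn

lemma differentiable {f : X → ℝ} (hf : IsTestFn f) : Differentiable ℝ f :=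
  hf.1.differentiable (by simp)

lemma dirD {f : X → ℝ} (hf : IsTestFn f) (v : X) : IsTestFn (dirD v f) :=
  ⟨contDiff_dirD hf.1 v, hf.2.of_isClosed_subset (isClosed_tsupport _) (tsupport_dirD_subset v f)⟩

lemma dirDs {f : X → ℝ} (hf : IsTestFn f) (V : List X) : IsTestFn (dirDs V f) :=
  ⟨contDiff_dirDs hf.1 V,
    hf.2.of_isClosed_subset (isClosed_tsupport _) (tsupport_dirDs_subset V f)⟩

lemma mul_left {f g : X → ℝ} (hf : IsTestFn f) (hg : ContDiff ℝ ∞ g) :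
    IsTestFn (fun x => g x * f x) :=
  ⟨hg.mul hf.1, hf.2.mul_left⟩

lemma mul_right {f g : X → ℝ} (hf : IsTestFn f) (hg : ContDiff ℝ ∞ g) :
    IsTestFn (fun x => f x * g x) :=
  ⟨hf.1.mul hg, hf.2.mul_right⟩

lemma add {f g : X → ℝ} (hf : IsTestFn f) (hg : IsTestFn g) : IsTestFn (fun x => f x + g x) :=
  ⟨hf.1.add hg.1, hf.2.add hg.2⟩

lemma const_mul {f : X → ℝ} (hf : IsTestFn f) (c : ℝ) : IsTestFn (fun x => c * f x) :=
  hf.mul_left contDiff_const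

lemma sum {ι : Type*} (s : Finset ι) {f : ι → X → ℝ} (hf : ∀ i ∈ s, IsTestFn (f i)) :
    IsTestFn (fun x => ∑ i ∈ s, f i x) := by
  classical
  induction s using Finset.induction_on with
  | empty => simp only [Finset.sum_empty]; exact ⟨contDiff_const, HasCompactSupport.zero⟩
  | insert a s ha ih =>
    simp_rw [Finset.sum_insert ha]
    exact (hf a (by simp)).add (ih fun i hi => hf i (by simp [hi]))

lemma bounded {f : X → ℝ} (hf : IsTestFn f) : ∃ C, 0 ≤ C ∧ ∀ x, |f x| ≤ C := by
  obtain ⟨C, hC⟩ := hf.1.continuous.bounded_above_of_compact_support hf.2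
  exact ⟨C, (norm_nonneg _).trans (hC 0), hC⟩

lemma bounded_fderiv {f : X → ℝ} (hf : IsTestFn f) : ∃ C, 0 ≤ C ∧ ∀ x, ‖fderiv ℝ f x‖ ≤ C := by
  obtain ⟨C, hC⟩ := (hf.1.continuous_fderiv (by simp)).bounded_above_of_compact_support
    (hf.2.fderiv ℝ)
  exact ⟨C, (norm_nonneg _).trans (hC 0), hC⟩

lemma integrable [MeasurableSpace X] [BorelSpace X] {f : X → ℝ} (hf : IsTestFn f)
    (μ : Measure X) [IsFiniteMeasureOnCompacts μ] : Integrable f μ :=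
  hf.1.continuous.integrable_of_hasCompactSupport hf.2

end IsTestFn

lemma dirD_comp (e : X →L[ℝ] X') (v : X) {f : X' → ℝ} (hf : Differentiable ℝ f) :
    dirD v (fun x => f (e x)) = fun x => dirD (e v) f (e x) := by
  funext x
  have : HasFDerivAt (fun x => f (e x)) ((fderiv ℝ f (e x)).comp e) x :=
    (hf (e x)).hasFDerivAt.comp x e.hasFDerivAt
  simp [dirD, this.fderiv]

lemma dirDs_comp (e : X →L[ℝ] X') (V : List X) {f : X' → ℝ} (hf : ContDiff ℝ ∞ f) :
    dirDs V (fun x => f (e x)) = fun x => dirDs (V.map e) f (e x) := by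
  induction V with
  | nil => rfl
  | cons v V ih =>
    rw [dirDs_cons, ih, dirD_comp e v ((contDiff_dirDs hf _).differentiable (by simp))]
    rfl

lemma dirDs_comp_add (a : X) (V : List X) (f : X → ℝ) (x : X) :
    dirDs V (fun x => f (x + a)) x = dirDs V f (x + a) := by
  induction V generalizing x with
  | nil => rfl
  | cons v V ih =>
    have : dirDs V (fun x => f (x + a)) = fun x => dirDs V f (x + a) := funext ih
    rw [dirDs_cons, this]
    simp [dirD, fderiv_comp_add_right]

lemma IsTestFn.comp_add {ψ : X → ℝ} (hψ : IsTestFn ψ) (a : X) : IsTestFn fun x => ψ (x + a) :=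
  ⟨hψ.1.comp (contDiff_id.add contDiff_const), hψ.2.comp_homeomorph (Homeomorph.addRight a)⟩

end DirectionalDerivatives

/-! ### Averages at scale `lam` -/

section Averages

variable {d : ℕ}

/-- The average `∫ φ(y - lam z) η(z) dz` of `φ` around `y` at scale `lam` with weight `η`, as a
function of `p = (lam, y)`. For `lam > 0` it is the convolution of `φ` with the rescaled kernel. -/
def avg (φ η : (Fin d → ℝ) → ℝ) (p : ℝ × (Fin d → ℝ)) : ℝ :=
  ∫ z, φ (p.2 - p.1 • z) * η z

lemma avg_zero (φ η : (Fin d → ℝ) → ℝ) (y : Fin d → ℝ) : avg φ η (0, y) = φ y * ∫ z, η z := by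
  simp [avg, integral_const_mul]

variable {φ η : (Fin d → ℝ) → ℝ}

lemma continuous_avg_integrand (hφ : Continuous φ) (hη : Continuous η) (p : ℝ × (Fin d → ℝ)) :
    Continuous fun z => φ (p.2 - p.1 • z) * η z := by
  fun_prop

lemma integrable_avg_integrand (hφ : Continuous φ) (hη : IsTestFn η) (p : ℝ × (Fin d → ℝ)) :
    Integrable fun z => φ (p.2 - p.1 • z) * η z :=
  (continuous_avg_integrand hφ hη.1.continuous p).integrable_of_hasCompactSupport hη.2.mul_left

lemma isTestFn_coord_mul (hη : IsTestFn η) (j : Fin d) : IsTestFn fun z => z j * η z :=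
  hη.mul_left (contDiff_apply ℝ ℝ j)

/-- The derivative of `avg` in the direction `(μ, v)`, computed under the integral sign. -/
lemma hasFDerivAt_avg (hφ : IsTestFn φ) (hη : IsTestFn η) (p : ℝ × (Fin d → ℝ)) :
    HasFDerivAt (avg φ η)
      (∫ z, η z • (fderiv ℝ φ (p.2 - p.1 • z)).comp
        (ContinuousLinearMap.snd ℝ ℝ (Fin d → ℝ) -
          (ContinuousLinearMap.fst ℝ ℝ (Fin d → ℝ)).smulRight z)) p := by
  obtain ⟨C, hC0, hC⟩ := hφ.bounded_fderiv
  have hc : Continuous (fderiv ℝ φ) := hφ.1.continuous_fderiv (by simp)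
  have hηc := hη.1.continuous
  set T : (Fin d → ℝ) → (ℝ × (Fin d → ℝ)) →L[ℝ] (Fin d → ℝ) := fun z =>
    ContinuousLinearMap.snd ℝ ℝ (Fin d → ℝ) -
          (ContinuousLinearMap.fst ℝ ℝ (Fin d → ℝ)).smulRight z with hT
  have hTc : Continuous T := by
    refine continuous_const.sub ?_
    exact ((ContinuousLinearMap.smulRightL ℝ (ℝ × (Fin d → ℝ)) (Fin d → ℝ))
      (ContinuousLinearMap.fst ℝ ℝ (Fin d → ℝ))).continuous
  refine hasFDerivAt_integral_of_dominated_of_fderiv_le (s := Set.univ)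
    (F := fun p z => φ (p.2 - p.1 • z) * η z)
    (F' := fun p z => η z • (fderiv ℝ φ (p.2 - p.1 • z)).comp (T z))
    (bound := fun z => |η z| * (C * ‖T z‖)) Filter.univ_mem ?_ ?_ ?_ ?_ ?_ ?_
  · exact Filter.Eventually.of_forall fun q =>
      (continuous_avg_integrand hφ.1.continuous hηc q).aestronglyMeasurable
  · exact integrable_avg_integrand hφ.1.continuous hη p
  · refine Continuous.aestronglyMeasurable ?_
    exact hηc.smul ((hc.comp (by fun_prop)).clm_comp hTc)
  · refine Filter.Eventually.of_forall fun z q _ => ?_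
    rw [norm_smul, Real.norm_eq_abs]
    gcongr
    exact (ContinuousLinearMap.opNorm_comp_le _ _).trans
      (mul_le_mul_of_nonneg_right (hC _) (norm_nonneg _))
  · refine Continuous.integrable_of_hasCompactSupport (by fun_prop) ?_
    exact (hη.2.comp_left (g := fun x : ℝ => |x|) abs_zero).mul_right
  · refine Filter.Eventually.of_forall fun z q _ => ?_
    have h1 : HasFDerivAt (fun q : ℝ × (Fin d → ℝ) => q.2 - q.1 • z) (T z) q :=
      (hasFDerivAt_snd).sub (hasFDerivAt_fst.smul_const z)
    have h2 := ((hφ.differentiable (q.2 - q.1 • z)).hasFDerivAt.comp q h1).mul_const (η z)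
    exact h2

lemma fderiv_avg_apply (hφ : IsTestFn φ) (hη : IsTestFn η) (p v : ℝ × (Fin d → ℝ)) :
    fderiv ℝ (avg φ η) p v = ∫ z, fderiv ℝ φ (p.2 - p.1 • z) (v.2 - v.1 • z) * η z := by
  have hc : Continuous (fderiv ℝ φ) := hφ.1.continuous_fderiv (by simp)
  have hTc : Continuous fun z => ContinuousLinearMap.snd ℝ ℝ (Fin d → ℝ) -
          (ContinuousLinearMap.fst ℝ ℝ (Fin d → ℝ)).smulRight z := by
    refine continuous_const.sub ?_
    exact ((ContinuousLinearMap.smulRightL ℝ (ℝ × (Fin d → ℝ)) (Fin d → ℝ))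
      (ContinuousLinearMap.fst ℝ ℝ (Fin d → ℝ))).continuous
  rw [(hasFDerivAt_avg hφ hη p).fderiv, ContinuousLinearMap.integral_apply]
  · simp [mul_comm]
  · refine Continuous.integrable_of_hasCompactSupport ?_ hη.2.smul_right
    exact hη.1.continuous.smul ((hc.comp (by fun_prop)).clm_comp hTc)

/-- The derivatives of an average are averages of the derivatives of `φ`. -/
lemma fderiv_avg_eq_sum (hφ : IsTestFn φ) (hη : IsTestFn η) (p v : ℝ × (Fin d → ℝ)) :
    fderiv ℝ (avg φ η) p v = avg (dirD v.2 φ) η p -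
      v.1 * ∑ j, avg (dirD (Pi.single j 1) φ) (fun z => z j * η z) p := by
  rw [fderiv_avg_apply hφ hη]
  have h1 : ∀ z : Fin d → ℝ, fderiv ℝ φ (p.2 - p.1 • z) (v.2 - v.1 • z) * η z =
      dirD v.2 φ (p.2 - p.1 • z) * η z - v.1 * ∑ j,
        dirD (Pi.single j 1) φ (p.2 - p.1 • z) * (z j * η z) := by
    intro z
    have hz : z = ∑ j, z j • (Pi.single j 1 : Fin d → ℝ) := by
      simpa using (pi_eq_sum_univ' z)
    have : fderiv ℝ φ (p.2 - p.1 • z) z =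
        ∑ j, z j * fderiv ℝ φ (p.2 - p.1 • z) (Pi.single j 1) := by
      conv_lhs => rw [hz, map_sum]
      refine Finset.sum_congr rfl fun j _ => ?_
      rw [map_smul, smul_eq_mul, ← hz]
    rw [map_sub, map_smul, this, sub_mul, smul_eq_mul, mul_assoc, Finset.sum_mul]
    simp only [dirD]
    congr 2
    exact Finset.sum_congr rfl fun j _ => by ring
  simp_rw [h1]
  rw [integral_sub, integral_const_mul, integral_finsetSum]
  · rfl
  · exact fun j _ => integrable_avg_integrand (hφ.dirD _).1.continuous (isTestFn_coord_mul hη j) p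
  · exact integrable_avg_integrand (hφ.dirD _).1.continuous hη p
  · exact (integrable_finsetSum _ fun j _ =>
      integrable_avg_integrand (hφ.dirD _).1.continuous (isTestFn_coord_mul hη j) p).const_mul _

lemma contDiff_avg (hφ : IsTestFn φ) (hη : IsTestFn η) : ContDiff ℝ ∞ (avg φ η) := by
  rw [contDiff_infty]
  intro m
  induction m generalizing φ η with
  | zero =>
    exact contDiff_zero.2 (continuous_iff_continuousAt.2 fun p =>
      (hasFDerivAt_avg hφ hη p).continuousAt)
  | succ m ih =>
    push_cast
    rw [contDiff_succ_iff_fderiv_apply]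
    refine ⟨fun p => (hasFDerivAt_avg hφ hη p).differentiableAt, by simp, fun v => ?_⟩
    simp_rw [fderiv_avg_eq_sum hφ hη]
    exact (ih (hφ.dirD _) hη).sub (contDiff_const.mul
      (ContDiff.sum fun j _ => ih (hφ.dirD _) (isTestFn_coord_mul hη j)))

/-- Integration by parts moves a derivative from `φ` to the weight, at the cost of one power of
the scale. -/
lemma avg_dirD (hφ : IsTestFn φ) (hη : IsTestFn η) (v : Fin d → ℝ) {p : ℝ × (Fin d → ℝ)}
    (hp : p.1 ≠ 0) : avg (dirD v φ) η p = p.1⁻¹ * avg φ (dirD v η) p := by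
  have hd : ∀ z, fderiv ℝ (fun z => φ (p.2 - p.1 • z)) z v = - p.1 * dirD v φ (p.2 - p.1 • z) := by
    intro z
    have h1 : HasFDerivAt (fun z : Fin d → ℝ => p.2 - p.1 • z)
        (-(p.1 • ContinuousLinearMap.id ℝ (Fin d → ℝ))) z :=
      ((hasFDerivAt_id z).const_smul p.1).const_sub p.2
    have h2 := (hφ.differentiable (p.2 - p.1 • z)).hasFDerivAt.comp z h1
    have h3 : fderiv ℝ (fun z => φ (p.2 - p.1 • z)) z = _ := h2.fderiv
    rw [h3]; simp [dirD]
  have hdiff : Differentiable ℝ fun z => φ (p.2 - p.1 • z) :=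
    hφ.differentiable.comp (by fun_prop)
  have key := integral_mul_fderiv_eq_neg_fderiv_mul_of_integrable (μ := volume)
    (f := fun z => φ (p.2 - p.1 • z)) (g := η) (v := v)
    (by
      simp_rw [hd, mul_assoc]
      exact (integrable_avg_integrand (hφ.dirD v).1.continuous hη p).const_mul _)
    (integrable_avg_integrand hφ.1.continuous (hη.dirD v) p)
    (integrable_avg_integrand hφ.1.continuous hη p)
    (fun x _ => hdiff x) (fun x _ => hη.differentiable x)
  have e1 : avg φ (dirD v η) p = p.1 * avg (dirD v φ) η p := by
    change ∫ z, φ (p.2 - p.1 • z) * fderiv ℝ η z v = _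
    rw [key]
    simp_rw [hd, mul_assoc, neg_mul]
    rw [integral_neg, neg_neg, integral_const_mul]
    rfl
  rw [e1, ← mul_assoc, inv_mul_cancel₀ hp, one_mul]

lemma integral_dirD (hη : IsTestFn η) (v : Fin d → ℝ) : ∫ z, dirD v η z = 0 := by
  have key := integral_mul_fderiv_eq_neg_fderiv_mul_of_integrable (μ := volume)
    (f := fun _ : Fin d → ℝ => (1 : ℝ)) (g := η) (v := v) (by simp)
    (by simp only [one_mul]; exact (hη.dirD v).integrable volume) (by simpa using hη.integrable volume)
    (fun x _ => by fun_prop) (fun x _ => hη.differentiable x)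
  simpa [dirD] using key

/-- The weight of the derivative in the direction `v` of the average with weight `η`,
multiplied by the scale. -/
def weightD (v : ℝ × (Fin d → ℝ)) (η : (Fin d → ℝ) → ℝ) : (Fin d → ℝ) → ℝ :=
  fun z => dirD v.2 η z + ∑ j, (-v.1) * dirD (Pi.single j 1) (fun z => z j * η z) z

lemma isTestFn_weightD (hη : IsTestFn η) (v : ℝ × (Fin d → ℝ)) : IsTestFn (weightD v η) :=
  (hη.dirD _).add (IsTestFn.sum _ fun j _ => ((isTestFn_coord_mul hη j).dirD _).const_mul _)

lemma integral_weightD (hη : IsTestFn η) (v : ℝ × (Fin d → ℝ)) : ∫ z, weightD v η z = 0 := by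
  have h : ∀ j, Integrable fun z =>
      (-v.1) * dirD (Pi.single j 1) (fun z : Fin d → ℝ => z j * η z) z := fun j =>
    (((isTestFn_coord_mul hη j).dirD _).integrable volume).const_mul _
  unfold weightD
  rw [integral_add ((hη.dirD _).integrable volume) (integrable_finsetSum _ fun j _ => h j),
    integral_dirD hη, integral_finsetSum _ fun j _ => h j]
  simp_rw [integral_const_mul, integral_dirD (isTestFn_coord_mul hη _)]
  simp

/-- Away from scale zero, averages are closed under differentiation. -/
lemma fderiv_avg (hφ : IsTestFn φ) (hη : IsTestFn η) (v : ℝ × (Fin d → ℝ))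
    {p : ℝ × (Fin d → ℝ)} (hp : p.1 ≠ 0) :
    fderiv ℝ (avg φ η) p v = p.1⁻¹ * avg φ (weightD v η) p := by
  have e : avg φ (weightD v η) p = avg φ (dirD v.2 η) p +
      ∑ j, (-v.1) * avg φ (dirD (Pi.single j 1) (fun z => z j * η z)) p := by
    have h : ∀ j, Integrable fun z => φ (p.2 - p.1 • z) *
        ((-v.1) * dirD (Pi.single j 1) (fun z : Fin d → ℝ => z j * η z) z) := fun j =>
      integrable_avg_integrand hφ.1.continuous
        (((isTestFn_coord_mul hη j).dirD _).const_mul _) p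
    simp only [avg, weightD, mul_add, Finset.mul_sum]
    rw [integral_add (integrable_avg_integrand hφ.1.continuous (hη.dirD _) p)
      (integrable_finsetSum _ fun j _ => h j), integral_finsetSum _ fun j _ => h j]
    congr 1
    refine Finset.sum_congr rfl fun j _ => ?_
    rw [← integral_const_mul]
    congr 1; funext z; ring
  rw [fderiv_avg_eq_sum hφ hη, e, mul_add, avg_dirD hφ hη _ hp, Finset.mul_sum, Finset.mul_sum,
    sub_eq_add_neg, ← Finset.sum_neg_distrib]
  congr 1
  refine Finset.sum_congr rfl fun j _ => ?_
  rw [avg_dirD hφ (isTestFn_coord_mul hη j) _ hp]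
  ring

end Averages

/-! ### A Morrey estimate for averages -/

section Morrey

variable {d : ℕ} {φ η : (Fin d → ℝ) → ℝ}

/-- The energy `∫ ‖Dφ‖ ^ (d + 1)` of a function of `d` variables. -/
def energy (φ : (Fin d → ℝ) → ℝ) : ℝ := ∫ y, ‖fderiv ℝ φ y‖ ^ ((d : ℝ) + 1)

lemma energy_nonneg (φ : (Fin d → ℝ) → ℝ) : 0 ≤ energy φ :=
  integral_nonneg fun _ => by positivity

/-- The energy of `z ↦ φ (y - t z)`, before normalisation. -/
lemma integral_fderiv_rescale (φ : (Fin d → ℝ) → ℝ) (y : Fin d → ℝ) {t : ℝ} (ht : 0 < t) :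
    ∫ z, ‖fderiv ℝ φ (y - t • z)‖ ^ ((d : ℝ) + 1) = t ^ (-(d : ℝ)) * energy φ := by
  have h1 := Measure.integral_comp_smul (volume : Measure (Fin d → ℝ))
    (fun z => ‖fderiv ℝ φ (y - z)‖ ^ ((d : ℝ) + 1)) t
  rw [h1, integral_sub_left_eq_self (fun z => ‖fderiv ℝ φ z‖ ^ ((d : ℝ) + 1)) volume y]
  simp only [Module.finrank_fintype_fun_eq_card, Fintype.card_fin, smul_eq_mul]
  rw [abs_of_nonneg (by positivity), Real.rpow_neg ht.le, Real.rpow_natCast]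
  rfl

/-- The derivative of an average in the scale, by Hölder's inequality with exponent `d + 1`. -/
lemma abs_fderiv_avg_fst_le (hd : 1 ≤ d) (hφ : IsTestFn φ) (hη : IsTestFn η) (y : Fin d → ℝ)
    {t : ℝ} (ht : 0 < t) :
    |fderiv ℝ (avg φ η) (t, y) (1, 0)| ≤
      (∫ z, (‖z‖ * |η z|) ^ (((d : ℝ) + 1) / d)) ^ (1 / (((d : ℝ) + 1) / d)) *
        (energy φ ^ (1 / ((d : ℝ) + 1)) * t ^ (-(d : ℝ) / ((d : ℝ) + 1))) := by
  have hd' : (0 : ℝ) < d := by exact_mod_cast hd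
  have hpq : ((d : ℝ) + 1).HolderConjugate (((d : ℝ) + 1) / d) := by
    rw [Real.holderConjugate_iff]
    exact ⟨by linarith, by field_simp; ring⟩
  have hc : Continuous (fderiv ℝ φ) := hφ.1.continuous_fderiv (by simp)
  have hηc := hη.1.continuous
  have hcs : HasCompactSupport fun z : Fin d → ℝ => fderiv ℝ φ (y - t • z) := by
    have := (hφ.2.fderiv ℝ).comp_homeomorph
      ((Homeomorph.smulOfNeZero t ht.ne').trans (Homeomorph.subLeft y))
    exact this
  have hf : MemLp (fun z : Fin d → ℝ => ‖fderiv ℝ φ (y - t • z)‖)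
      (ENNReal.ofReal ((d : ℝ) + 1)) volume :=
    Continuous.memLp_of_hasCompactSupport (by fun_prop) hcs.norm
  have hg : MemLp (fun z : Fin d → ℝ => ‖z‖ * |η z|)
      (ENNReal.ofReal (((d : ℝ) + 1) / d)) volume :=
    Continuous.memLp_of_hasCompactSupport (by fun_prop)
      (HasCompactSupport.mul_left (f' := fun z => |η z|)
        (hη.2.comp_left (g := fun x : ℝ => |x|) abs_zero))
  rw [fderiv_avg_apply hφ hη]
  calc |∫ z, fderiv ℝ φ (y - t • z) ((0 : Fin d → ℝ) - (1 : ℝ) • z) * η z|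
      ≤ ∫ z, ‖fderiv ℝ φ (y - t • z)‖ * (‖z‖ * |η z|) := by
        refine norm_integral_le_of_norm_le (f := fun z =>
          fderiv ℝ φ (y - t • z) ((0 : Fin d → ℝ) - (1 : ℝ) • z) * η z) ?_
          (Filter.Eventually.of_forall fun z => ?_)
        · refine Continuous.integrable_of_hasCompactSupport (by fun_prop) ?_
          exact HasCompactSupport.mul_right hcs.norm
        · rw [norm_mul, ← mul_assoc, Real.norm_eq_abs (η z)]
          gcongr
          refine (ContinuousLinearMap.le_opNorm _ _).trans_eq ?_
          simp
    _ ≤ _ := integral_mul_le_Lp_mul_Lq_of_nonneg hpq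
        (Filter.Eventually.of_forall fun z => by positivity)
        (Filter.Eventually.of_forall fun z => by positivity) hf hg
    _ = _ := by
        rw [integral_fderiv_rescale φ y ht, Real.mul_rpow (by positivity) (energy_nonneg φ),
          ← Real.rpow_mul ht.le]
        rw [mul_comm, mul_comm (energy φ ^ _)]
        congr 3
        ring

/-- **Morrey's inequality** in scale form: in `d` variables, averages at scale `lam` differ from
the function by at most `lam ^ (1 / (d + 1))` times the `L^(d+1)` norm of the gradient. -/
theorem exists_abs_avg_sub_le (hd : 1 ≤ d) (hη : IsTestFn η) : ∃ K : ℝ, 0 ≤ K ∧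
    ∀ φ : (Fin d → ℝ) → ℝ, IsTestFn φ → ∀ (lam : ℝ), 0 < lam → ∀ y : Fin d → ℝ,
      |avg φ η (lam, y) - φ y * ∫ z, η z| ≤
        K * energy φ ^ (1 / ((d : ℝ) + 1)) * lam ^ (1 / ((d : ℝ) + 1)) := by
  set K₀ := (∫ z, (‖z‖ * |η z|) ^ (((d : ℝ) + 1) / d)) ^ (1 / (((d : ℝ) + 1) / d)) with hK₀
  have hK₀0 : 0 ≤ K₀ := Real.rpow_nonneg (integral_nonneg fun z => by positivity) _
  refine ⟨K₀ * ((d : ℝ) + 1), by positivity, fun φ hφ lam hlam y => ?_⟩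
  have hcd := contDiff_avg hφ hη
  have hder : ∀ t : ℝ, HasDerivAt (fun t => avg φ η (t, y)) (fderiv ℝ (avg φ η) (t, y) (1, 0)) t := by
    intro t
    have h1 := (hcd.differentiable (by simp) (t, y)).hasFDerivAt
    exact h1.comp_hasDerivAt t ((hasDerivAt_id t).prodMk (hasDerivAt_const t y))
  have hcont : Continuous fun t : ℝ => fderiv ℝ (avg φ η) (t, y) (1, 0) := by
    have h : Continuous (fderiv ℝ (avg φ η)) := hcd.continuous_fderiv (by simp)
    fun_prop
  have hftc := intervalIntegral.integral_eq_sub_of_hasDerivAt (a := 0) (b := lam)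
    (fun t _ => hder t) (hcont.intervalIntegrable _ _)
  have hd1 : (0 : ℝ) < (d : ℝ) + 1 := by positivity
  have hexp : (-1 : ℝ) < -(d : ℝ) / ((d : ℝ) + 1) := by
    rw [lt_div_iff₀ hd1]; linarith
  -- Integrate the derivative in the scale, which is `O(t ^ (-d / (d + 1)))`, from `0` to `lam`.
  rw [← avg_zero φ η y, ← hftc]
  calc |∫ t in (0 : ℝ)..lam, fderiv ℝ (avg φ η) (t, y) (1, 0)|
      ≤ ∫ t in (0 : ℝ)..lam, K₀ * (energy φ ^ (1 / ((d : ℝ) + 1)) *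
          t ^ (-(d : ℝ) / ((d : ℝ) + 1))) := by
        refine intervalIntegral.norm_integral_le_of_norm_le (E := ℝ) hlam.le
          (Filter.Eventually.of_forall fun t ht => ?_) ?_
        · exact abs_fderiv_avg_fst_le hd hφ hη y ht.1
        · exact ((intervalIntegral.intervalIntegrable_rpow' hexp).const_mul _).const_mul _
    _ = _ := by
        rw [intervalIntegral.integral_const_mul, intervalIntegral.integral_const_mul,
          integral_rpow (Or.inl hexp)]
        have e : -(d : ℝ) / ((d : ℝ) + 1) + 1 = 1 / ((d : ℝ) + 1) := by field_simp; ring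
        rw [e, Real.zero_rpow (by positivity)]
        field_simp
        ring

end Morrey

/-! ### Derivatives of extensions of slices -/

section Extension

variable {d : ℕ}

/-- The extension to `ℝ × ℝᵈ` of a function `φ` on the slice `{t} × ℝᵈ`: at distance `τ` from the
slice, `φ` is averaged at scale `ε + τ` and multiplied by `U τ`. -/
def sliceExt (ρ : (Fin d → ℝ) → ℝ) (U : ℝ → ℝ) (φ : (Fin d → ℝ) → ℝ) (t ε : ℝ)
    (x : ℝ × (Fin d → ℝ)) : ℝ :=
  U (x.1 - t) * avg φ ρ (ε + (x.1 - t), x.2)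

/-- Expressions in `U`, `φ`, `t`, `ε` that occur in a `k`-th order derivative of `sliceExt`
when at least one derivative falls on the average: `a < k` derivatives fall on `U`, and the rest
leaves an average with a weight of mean zero and the power `a - k` of the scale. -/
inductive IsRemainder (k : ℕ) :
    ((ℝ → ℝ) → ((Fin d → ℝ) → ℝ) → ℝ → ℝ → ℝ × (Fin d → ℝ) → ℝ) → Prop
  | term (a : ℕ) (ha : a < k) (η : (Fin d → ℝ) → ℝ) (hη : IsTestFn η) (h0 : ∫ z, η z = 0) :
      IsRemainder k fun U φ t ε x => iteratedDeriv a U (x.1 - t) *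
        ((ε + (x.1 - t)) ^ ((a : ℤ) - k) * avg φ η (ε + (x.1 - t), x.2))
  | add {R R'} (h : IsRemainder k R) (h' : IsRemainder k R') :
      IsRemainder k fun U φ t ε x => R U φ t ε x + R' U φ t ε x

variable {U : ℝ → ℝ} {φ η ρ : (Fin d → ℝ) → ℝ}

lemma hasFDerivAt_fst_sub (t : ℝ) (x : ℝ × (Fin d → ℝ)) :
    HasFDerivAt (fun x : ℝ × (Fin d → ℝ) => x.1 - t)
      (ContinuousLinearMap.fst ℝ ℝ (Fin d → ℝ)) x :=
  (ContinuousLinearMap.fst ℝ ℝ (Fin d → ℝ)).hasFDerivAt.sub_const t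

lemma hasFDerivAt_iteratedDeriv_fst (hU : ContDiff ℝ ∞ U) (a : ℕ) (t : ℝ)
    (x : ℝ × (Fin d → ℝ)) :
    HasFDerivAt (fun x : ℝ × (Fin d → ℝ) => iteratedDeriv a U (x.1 - t))
      (iteratedDeriv (a + 1) U (x.1 - t) • ContinuousLinearMap.fst ℝ ℝ (Fin d → ℝ)) x := by
  have h1 : HasDerivAt (iteratedDeriv a U) (iteratedDeriv (a + 1) U (x.1 - t)) (x.1 - t) := by
    rw [iteratedDeriv_succ]
    refine DifferentiableAt.hasDerivAt ?_
    exact (hU.differentiable_iteratedDeriv a (by exact_mod_cast WithTop.coe_lt_top _)) _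
  exact h1.comp_hasFDerivAt x (hasFDerivAt_fst_sub t x)

lemma hasFDerivAt_avg_comp (hφ : IsTestFn φ) (hη : IsTestFn η) (t ε : ℝ)
    (x : ℝ × (Fin d → ℝ)) :
    HasFDerivAt (fun x : ℝ × (Fin d → ℝ) => avg φ η (ε + (x.1 - t), x.2))
      (fderiv ℝ (avg φ η) (ε + (x.1 - t), x.2)) x := by
  have h1 : HasFDerivAt (fun x : ℝ × (Fin d → ℝ) => (ε + (x.1 - t), x.2))
      (ContinuousLinearMap.id ℝ (ℝ × (Fin d → ℝ))) x :=
    ((hasFDerivAt_fst_sub t x).const_add ε).prodMk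
      (ContinuousLinearMap.snd ℝ ℝ (Fin d → ℝ)).hasFDerivAt
  exact ((contDiff_avg hφ hη).differentiable (by simp) _).hasFDerivAt.comp x h1

/-- Differentiating a remainder gives a remainder of the next order: a derivative of `U` raises
`a`, and a derivative of the power or of the average lowers the exponent `a - k` and keeps the
mean of the weight equal to zero. -/
lemma IsRemainder.exists_fderiv {k : ℕ}
    {R : (ℝ → ℝ) → ((Fin d → ℝ) → ℝ) → ℝ → ℝ → ℝ × (Fin d → ℝ) → ℝ} (hR : IsRemainder k R)
    (v : ℝ × (Fin d → ℝ)) :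
    ∃ R', IsRemainder (k + 1) R' ∧ ∀ U φ, ContDiff ℝ ∞ U → IsTestFn φ → ∀ t ε x,
      0 < ε + (x.1 - t) → DifferentiableAt ℝ (R U φ t ε) x ∧
        fderiv ℝ (R U φ t ε) x v = R' U φ t ε x := by
  induction hR with
  | term a ha η hη h0 =>
    set η' : (Fin d → ℝ) → ℝ := fun z => weightD v η z + ((a : ℝ) - k) * v.1 * η z with hη'
    have t1 : IsTestFn fun z => v.1 * η z := hη.const_mul _
    have t2 : IsTestFn η' := (isTestFn_weightD hη v).add (hη.const_mul _)
    refine ⟨_, (IsRemainder.term (a + 1) (by omega) _ t1 ?_).add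
      (IsRemainder.term a (by omega) η' t2 ?_), ?_⟩
    · rw [integral_const_mul, h0, mul_zero]
    · rw [hη', integral_add ((isTestFn_weightD hη v).integrable _) ((hη.const_mul _).integrable _),
        integral_weightD hη, integral_const_mul, h0, mul_zero, add_zero]
    intro U φ hU hφ t ε x hx
    have f1 := hasFDerivAt_iteratedDeriv_fst hU a t x
    have f2 : HasFDerivAt (fun x : ℝ × (Fin d → ℝ) => (ε + (x.1 - t)) ^ ((a : ℤ) - k))
        (((((a : ℤ) - k : ℤ) : ℝ) * (ε + (x.1 - t)) ^ ((a : ℤ) - k - 1)) •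
          ContinuousLinearMap.fst ℝ ℝ (Fin d → ℝ)) x := by
      have h1 := hasDerivAt_zpow ((a : ℤ) - k) (ε + (x.1 - t)) (Or.inl hx.ne')
      exact h1.comp_hasFDerivAt x ((hasFDerivAt_fst_sub t x).const_add ε)
    have f3 := hasFDerivAt_avg_comp hφ hη t ε x
    have f := f1.mul (f2.mul f3)
    refine ⟨f.differentiableAt, ?_⟩
    have e1 : avg φ (fun z => v.1 * η z) (ε + (x.1 - t), x.2) =
        v.1 * avg φ η (ε + (x.1 - t), x.2) := by
      simp only [avg]; rw [← integral_const_mul]; congr 1; funext z; ring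
    have e2 : avg φ η' (ε + (x.1 - t), x.2) = avg φ (weightD v η) (ε + (x.1 - t), x.2) +
        ((a : ℝ) - k) * v.1 * avg φ η (ε + (x.1 - t), x.2) := by
      simp only [avg, hη', mul_add]
      rw [integral_add, ← integral_const_mul]
      · congr 2; funext z; ring
      · exact integrable_avg_integrand hφ.1.continuous (isTestFn_weightD hη v)
          (ε + (x.1 - t), x.2)
      · exact integrable_avg_integrand hφ.1.continuous (hη.const_mul _) (ε + (x.1 - t), x.2)
    have e3 : (ε + (x.1 - t)) ^ ((a : ℤ) - k - 1) =
        (ε + (x.1 - t)) ^ ((a : ℤ) - k) * (ε + (x.1 - t))⁻¹ := zpow_sub_one₀ hx.ne' _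
    have e4 : (((a + 1 : ℕ) : ℤ) - ((k + 1 : ℕ) : ℤ)) = (a : ℤ) - k := by push_cast; ring
    have e5 : ((a : ℤ) - ((k + 1 : ℕ) : ℤ)) = (a : ℤ) - k - 1 := by push_cast; ring
    have hf := f.fderiv
    change fderiv ℝ (fun x : ℝ × (Fin d → ℝ) => iteratedDeriv a U (x.1 - t) *
      ((ε + (x.1 - t)) ^ ((a : ℤ) - k) * avg φ η (ε + (x.1 - t), x.2))) x = _ at hf
    rw [hf]
    simp only [e1, e2, e4, e5, e3, add_apply, smul_apply,
      ContinuousLinearMap.coe_fst', smul_eq_mul, Pi.mul_apply,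
      fderiv_avg hφ hη v (p := (ε + (x.1 - t), x.2)) hx.ne']
    push_cast
    ring
  | add h h' ih ih' =>
    obtain ⟨R₁, hR₁, H₁⟩ := ih
    obtain ⟨R₂, hR₂, H₂⟩ := ih'
    refine ⟨_, hR₁.add hR₂, fun U φ hU hφ t ε x hx => ?_⟩
    obtain ⟨d1, e1⟩ := H₁ U φ hU hφ t ε x hx
    obtain ⟨d2, e2⟩ := H₂ U φ hU hφ t ε x hx
    refine ⟨d1.add d2, ?_⟩
    rw [fderiv_fun_add d1 d2, add_apply, e1, e2]

lemma contDiff_sliceExt (hU : ContDiff ℝ ∞ U) (hφ : IsTestFn φ) (hρ : IsTestFn ρ) (t ε : ℝ) :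
    ContDiff ℝ ∞ (sliceExt ρ U φ t ε) := by
  have := contDiff_avg hφ hρ
  exact (hU.comp (contDiff_fst.sub contDiff_const)).mul (this.comp (by fun_prop))

/-- The leading term of an iterated derivative of a slice extension has all derivatives on `U`. -/
theorem exists_dirDs_sliceExt (hρ : IsTestFn ρ) (V : List (ℝ × (Fin d → ℝ))) (hV : V ≠ []) :
    ∃ R, IsRemainder V.length R ∧ ∀ U φ, ContDiff ℝ ∞ U → IsTestFn φ → ∀ t ε x,
      0 < ε + (x.1 - t) → dirDs V (sliceExt ρ U φ t ε) x =
        (V.map Prod.fst).prod * iteratedDeriv V.length U (x.1 - t) *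
          avg φ ρ (ε + (x.1 - t), x.2) + R U φ t ε x := by
  -- The derivative of the leading term along `v`.
  have lead : ∀ (c : ℝ) (m : ℕ) (v : ℝ × (Fin d → ℝ)) U φ, ContDiff ℝ ∞ U → IsTestFn φ →
      ∀ t ε x, 0 < ε + (x.1 - t) →
      DifferentiableAt ℝ (fun x : ℝ × (Fin d → ℝ) => c * iteratedDeriv m U (x.1 - t) *
        avg φ ρ (ε + (x.1 - t), x.2)) x ∧
      fderiv ℝ (fun x : ℝ × (Fin d → ℝ) => c * iteratedDeriv m U (x.1 - t) *
        avg φ ρ (ε + (x.1 - t), x.2)) x v =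
        (v.1 * c) * iteratedDeriv (m + 1) U (x.1 - t) * avg φ ρ (ε + (x.1 - t), x.2) +
        iteratedDeriv m U (x.1 - t) * ((ε + (x.1 - t)) ^ ((m : ℤ) - (m + 1 : ℕ)) *
          avg φ (fun z => c * weightD v ρ z) (ε + (x.1 - t), x.2)) := by
    intro c m v U φ hU hφ t ε x hx
    have f := ((hasFDerivAt_iteratedDeriv_fst hU m t x).const_mul c).mul
      (hasFDerivAt_avg_comp hφ hρ t ε x)
    refine ⟨f.differentiableAt, ?_⟩
    have e1 : avg φ (fun z => c * weightD v ρ z) (ε + (x.1 - t), x.2) =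
        c * avg φ (weightD v ρ) (ε + (x.1 - t), x.2) := by
      simp only [avg]; rw [← integral_const_mul]; congr 1; funext z; ring
    have e2 : (m : ℤ) - (m + 1 : ℕ) = -1 := by push_cast; ring
    have hf := f.fderiv
    change fderiv ℝ (fun x : ℝ × (Fin d → ℝ) => c * iteratedDeriv m U (x.1 - t) *
        avg φ ρ (ε + (x.1 - t), x.2)) x = _ at hf
    rw [hf, e1, e2, zpow_neg_one]
    simp only [add_apply, smul_apply,
      ContinuousLinearMap.coe_fst', smul_eq_mul,
      fderiv_avg hφ hρ v (p := (ε + (x.1 - t), x.2)) hx.ne']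
    ring
  have hopen : ∀ t ε : ℝ, IsOpen {x : ℝ × (Fin d → ℝ) | 0 < ε + (x.1 - t)} := fun t ε =>
    isOpen_lt continuous_const (by fun_prop)
  have hlead0 : ∀ (c : ℝ) (v : ℝ × (Fin d → ℝ)), ∫ z, c * weightD v ρ z = 0 := fun c v => by
    rw [integral_const_mul, integral_weightD hρ, mul_zero]
  induction V with
  | nil => exact absurd rfl hV
  | cons v V ih =>
    -- A single derivative leaves no remainder to differentiate, so it is treated separately.
    by_cases hV' : V = []
    · subst hV'
      refine ⟨_, IsRemainder.term 0 (by simp) _ ((isTestFn_weightD hρ v).const_mul 1)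
        (hlead0 1 v), fun U φ hU hφ t ε x hx => ?_⟩
      have h := (lead 1 0 v U φ hU hφ t ε x hx).2
      simp only [iteratedDeriv_zero, one_mul] at h
      have hs : sliceExt ρ U φ t ε =
          fun x => U (x.1 - t) * avg φ ρ (ε + (x.1 - t), x.2) := rfl
      simpa [dirD, hs] using h
    · obtain ⟨R, hR, H⟩ := ih hV'
      obtain ⟨R', hR', H'⟩ := hR.exists_fderiv v
      set c := (V.map Prod.fst).prod with hc
      refine ⟨_, (IsRemainder.term V.length (by simp) _
        ((isTestFn_weightD hρ v).const_mul c) (hlead0 c v)).add hR',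
        fun U φ hU hφ t ε x hx => ?_⟩
      obtain ⟨d1, e1⟩ := lead c V.length v U φ hU hφ t ε x hx
      obtain ⟨d2, e2⟩ := H' U φ hU hφ t ε x hx
      have heq : dirDs V (sliceExt ρ U φ t ε) =ᶠ[nhds x] fun x =>
          c * iteratedDeriv V.length U (x.1 - t) * avg φ ρ (ε + (x.1 - t), x.2) + R U φ t ε x := by
        filter_upwards [(hopen t ε).mem_nhds hx] with x' hx'
        exact H U φ hU hφ t ε x' hx'
      rw [dirDs_cons, dirD, heq.fderiv_eq, fderiv_fun_add d1 d2, add_apply,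
        e1, e2, List.map_cons, List.prod_cons, List.length_cons, ← hc]
      ring

/-- Remainders obey the scale-invariant bound expected from Morrey's inequality. -/
lemma IsRemainder.exists_abs_le (hd : 1 ≤ d) {k : ℕ}
    {R : (ℝ → ℝ) → ((Fin d → ℝ) → ℝ) → ℝ → ℝ → ℝ × (Fin d → ℝ) → ℝ} (hR : IsRemainder k R) :
    ∃ C, 0 ≤ C ∧ ∀ U φ, IsTestFn φ → ∀ (t ε B : ℝ) x, 0 < ε → 0 ≤ x.1 - t + ε / 2 → 0 ≤ B →
      (∀ a < k, |iteratedDeriv a U (x.1 - t)| ≤ B * (ε + (x.1 - t)) ^ (k - 1 - a)) →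
      |R U φ t ε x| ≤
        C * B * energy φ ^ (1 / ((d : ℝ) + 1)) * ε ^ (1 / ((d : ℝ) + 1) - 1) := by
  induction hR with
  | term a ha η hη h0 =>
    obtain ⟨K, hK, H⟩ := exists_abs_avg_sub_le hd hη
    refine ⟨K * 2, by positivity, fun U φ hφ t ε B x hε hx hB hUa => ?_⟩
    set lam := ε + (x.1 - t) with hlam
    have hlam2 : ε / 2 ≤ lam := by rw [hlam]; linarith
    have hlam0 : 0 < lam := by linarith
    have h1 := H φ hφ lam hlam0 x.2
    -- The weight has mean zero, so Morrey's inequality bounds the average itself.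
    rw [h0, mul_zero, sub_zero] at h1
    have hE := energy_nonneg φ
    have hd1 : (0 : ℝ) < (d : ℝ) + 1 := by positivity
    have e1 : lam ^ (k - 1 - a) * lam ^ ((a : ℤ) - k) = lam⁻¹ := by
      rw [← zpow_natCast, ← zpow_add₀ hlam0.ne', ← zpow_neg_one]
      congr 1
      omega
    have e2 : lam⁻¹ * lam ^ (1 / ((d : ℝ) + 1)) = lam ^ (1 / ((d : ℝ) + 1) - 1) := by
      rw [Real.rpow_sub hlam0, Real.rpow_one]; field_simp
    -- The exponent is negative, and the scale is at least `ε / 2`.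
    have hexp : 1 / ((d : ℝ) + 1) - 1 ≤ 0 := by
      rw [sub_nonpos, div_le_one hd1]; linarith [(Nat.cast_nonneg d : (0 : ℝ) ≤ d)]
    have e3 : lam ^ (1 / ((d : ℝ) + 1) - 1) ≤ 2 * ε ^ (1 / ((d : ℝ) + 1) - 1) := by
      refine (Real.rpow_le_rpow_of_nonpos (by positivity) hlam2 hexp).trans ?_
      rw [Real.div_rpow hε.le (by norm_num), div_eq_mul_inv, mul_comm]
      gcongr
      rw [← Real.rpow_neg (by norm_num)]
      calc (2 : ℝ) ^ (-(1 / ((d : ℝ) + 1) - 1)) ≤ 2 ^ (1 : ℝ) := by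
            refine Real.rpow_le_rpow_of_exponent_le (by norm_num) ?_
            have : 0 ≤ 1 / ((d : ℝ) + 1) := by positivity
            linarith
        _ = 2 := by norm_num
    calc |iteratedDeriv a U (x.1 - t) * (lam ^ ((a : ℤ) - k) * avg φ η (lam, x.2))|
        = |iteratedDeriv a U (x.1 - t)| * (lam ^ ((a : ℤ) - k) * |avg φ η (lam, x.2)|) := by
          rw [abs_mul, abs_mul, abs_of_pos (zpow_pos hlam0 _)]
      _ ≤ (B * lam ^ (k - 1 - a)) * (lam ^ ((a : ℤ) - k) *
          (K * energy φ ^ (1 / ((d : ℝ) + 1)) * lam ^ (1 / ((d : ℝ) + 1)))) := by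
          gcongr
          exact hUa a ha
      _ = K * B * energy φ ^ (1 / ((d : ℝ) + 1)) * lam ^ (1 / ((d : ℝ) + 1) - 1) := by
          rw [← e2, ← e1]; ring
      _ ≤ K * B * energy φ ^ (1 / ((d : ℝ) + 1)) * (2 * ε ^ (1 / ((d : ℝ) + 1) - 1)) := by
          gcongr
      _ = _ := by ring
  | add h h' ih ih' =>
    obtain ⟨C₁, hC₁, H₁⟩ := ih
    obtain ⟨C₂, hC₂, H₂⟩ := ih'
    refine ⟨C₁ + C₂, by positivity, fun U φ hφ t ε B x hε hx hB hUa => ?_⟩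
    refine (abs_add_le _ _).trans ((add_le_add (H₁ U φ hφ t ε B x hε hx hB hUa)
      (H₂ U φ hφ t ε B x hε hx hB hUa)).trans_eq ?_)
    ring

end Extension

/-! ### Truncated iterated primitives of a mollifier -/

section Primitive

/-- The `j`-fold primitive of `f` starting at `-δ`. -/
def iterPrim (f : ℝ → ℝ) (δ : ℝ) : ℕ → ℝ → ℝ
  | 0 => f
  | j + 1 => fun x => ∫ s in (-δ)..x, iterPrim f δ j s

variable {f : ℝ → ℝ} {δ : ℝ}

lemma hasDerivAt_iterPrim_succ {j : ℕ} (h : Continuous (iterPrim f δ j)) (x : ℝ) :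
    HasDerivAt (iterPrim f δ (j + 1)) (iterPrim f δ j x) x :=
  (h.integral_hasStrictDerivAt (-δ) x).hasDerivAt

lemma contDiff_iterPrim (hf : ContDiff ℝ ∞ f) (j : ℕ) : ContDiff ℝ ∞ (iterPrim f δ j) := by
  induction j with
  | zero => exact hf
  | succ j ih =>
    have h := hasDerivAt_iterPrim_succ (δ := δ) ih.continuous
    rw [contDiff_infty_iff_deriv]
    refine ⟨fun x => (h x).differentiableAt, ?_⟩
    rwa [show deriv (iterPrim f δ (j + 1)) = iterPrim f δ j from funext fun x => (h x).deriv]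

lemma iteratedDeriv_iterPrim (hf : ContDiff ℝ ∞ f) (a j : ℕ) :
    iteratedDeriv a (iterPrim f δ (a + j)) = iterPrim f δ j := by
  induction a with
  | zero => simp
  | succ a ih =>
    have h := hasDerivAt_iterPrim_succ (δ := δ) (contDiff_iterPrim (δ := δ) hf (a + j)).continuous
    rw [iteratedDeriv_succ', show a + 1 + j = a + j + 1 by ring,
      show deriv (iterPrim f δ (a + j + 1)) = iterPrim f δ (a + j) from funext fun x => (h x).deriv,
      ih]

lemma iterPrim_eq_zero (h0 : ∀ x ≤ -δ, f x = 0) (j : ℕ) : ∀ x ≤ -δ, iterPrim f δ j x = 0 := by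
  induction j with
  | zero => exact h0
  | succ j ih =>
    intro x hx
    refine (intervalIntegral.integral_congr (g := fun _ => 0) fun s hs => ?_).trans (by simp)
    rw [Set.uIcc_of_ge hx] at hs
    exact ih s hs.2

lemma abs_iterPrim_succ_le (h0 : ∀ x ≤ -δ, f x = 0) (hpos : ∀ x, 0 ≤ f x)
    (hint : Integrable f) (h1 : ∫ x, f x = 1) (j : ℕ) (x : ℝ) :
    |iterPrim f δ (j + 1) x| ≤ (max (x + δ) 0) ^ j := by
  rcases le_total x (-δ) with hx | hx
  · rw [iterPrim_eq_zero h0 _ x hx, abs_zero]; positivity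
  have hmax : max (x + δ) 0 = x + δ := max_eq_left (by linarith)
  induction j generalizing x with
  | zero =>
    rw [pow_zero]
    change |∫ s in (-δ)..x, f s| ≤ 1
    rw [intervalIntegral.integral_of_le hx, abs_of_nonneg (integral_nonneg hpos), ← h1]
    exact setIntegral_le_integral hint (Filter.Eventually.of_forall hpos)
  | succ j ih =>
    rw [hmax]
    change |∫ s in (-δ)..x, iterPrim f δ (j + 1) s| ≤ _
    have hb : ∀ s ∈ Set.uIoc (-δ) x, ‖iterPrim f δ (j + 1) s‖ ≤ (x + δ) ^ j := by
      intro s hs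
      rw [Set.uIoc_of_le hx] at hs
      have hm : max (s + δ) 0 = s + δ := max_eq_left (by linarith [hs.1])
      refine (ih s hs.1.le hm).trans ?_
      rw [hm]
      exact pow_le_pow_left₀ (by linarith [hs.1]) (by linarith [hs.2]) j
    refine (intervalIntegral.norm_integral_le_of_norm_le_const hb).trans_eq ?_
    rw [abs_of_nonneg (by linarith), pow_succ]
    ring

/-- For a mollifier `b` at scale `δ` there is a compactly supported `U` that behaves like the
`k`-th primitive of `b`: the lower derivatives grow at most polynomially, uniformly in the
truncation radius `R`, and the `k`-th derivative is `b` up to an error of size `1 / R`. -/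
theorem exists_truncated_primitive (k : ℕ) : ∃ B : ℝ, 0 ≤ B ∧
    ∀ (b : ContDiffBump (0 : ℝ)) (R : ℝ), b.rOut ≤ 1 → 1 ≤ R →
      ∃ U : ℝ → ℝ, IsTestFn U ∧ (∀ x ≤ -b.rOut, U x = 0) ∧
        (∀ a < k, ∀ x, |iteratedDeriv a U x| ≤ B * (max (x + b.rOut) 0) ^ (k - 1 - a)) ∧
        ∀ x, |iteratedDeriv k U x - b.normed volume x| ≤ B / R := by
  let c : ContDiffBump (0 : ℝ) := ⟨1, 2, one_pos, one_lt_two⟩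
  have hc : ContDiff ℝ ∞ c := c.contDiff
  have hD : ∃ D : ℝ, 0 ≤ D ∧ ∀ i ≤ k, ∀ x, |iteratedDeriv i c x| ≤ D := by
    have : ∀ i, ∃ D, ∀ x, ‖iteratedDeriv i c x‖ ≤ D := fun i => by
      refine Continuous.bounded_above_of_compact_support
        (hc.continuous_iteratedDeriv i (by exact_mod_cast le_top)) ?_
      refine c.hasCompactSupport.of_isClosed_subset (isClosed_tsupport _)
        ((closure_mono ?_).trans (tsupport_iteratedFDeriv_subset (𝕜 := ℝ) (f := c) i))
      intro x hx h
      exact hx (by rw [iteratedDeriv_eq_iteratedFDeriv, h]; simp)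
    choose D hD using this
    refine ⟨∑ i ∈ Finset.range (k + 1), D i, Finset.sum_nonneg fun i _ =>
      (norm_nonneg _).trans (hD i 0), fun i hi x => (hD i x).trans ?_⟩
    exact Finset.single_le_sum (f := D) (fun i _ => (norm_nonneg _).trans (hD i 0))
      (Finset.mem_range.2 (by omega))
  obtain ⟨D, hD0, hD⟩ := hD
  have hczero : ∀ i x, 2 < |x| → iteratedDeriv i c x = 0 := by
    intro i x hx
    have h1 : x ∉ tsupport (iteratedFDeriv ℝ i c) := fun h => by
      have h2 := tsupport_iteratedFDeriv_subset (𝕜 := ℝ) (f := c) i h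
      rw [c.tsupport_eq] at h2
      simp only [Metric.mem_closedBall, dist_zero_right, Real.norm_eq_abs] at h2
      exact absurd h2 (not_le.2 hx)
    rw [iteratedDeriv_eq_iteratedFDeriv, image_eq_zero_of_notMem_tsupport h1]
    simp
  refine ⟨∑ a ∈ Finset.range (k + 1), ∑ i ∈ Finset.range (a + 1), (a.choose i : ℝ) * (D * 3 ^ i),
    by positivity, fun b R hδ hR => ?_⟩
  set B := ∑ a ∈ Finset.range (k + 1), ∑ i ∈ Finset.range (a + 1), (a.choose i : ℝ) * (D * 3 ^ i)
    with hB
  set δ := b.rOut with hδdef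
  have hδ0 : 0 < δ := b.rOut_pos
  set f := b.normed volume with hf
  have hfs : ContDiff ℝ ∞ f := b.contDiff_normed
  have hf0 : ∀ x, δ ≤ |x| → f x = 0 := fun x hx => by
    have : x ∉ Function.support f := by
      rw [hf, b.support_normed_eq]; simpa using hx
    simpa using this
  have hfle : ∀ x ≤ -δ, f x = 0 := fun x hx => hf0 x (by rw [abs_of_nonpos (by linarith)]; linarith)
  have hR0 : 0 < R := by linarith
  -- The cutoff equals `1` for `|x| ≤ R` and vanishes for `|x| ≥ 2 R`; `U` is `χ J`.
  set χ : ℝ → ℝ := fun x => c (R⁻¹ * x) with hχ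
  have hχs : ContDiff ℝ ∞ χ := hc.comp (contDiff_const.mul contDiff_id)
  have hχd : ∀ i, iteratedDeriv i χ = fun x => R⁻¹ ^ i * iteratedDeriv i c (R⁻¹ * x) := fun i =>
    iteratedDeriv_comp_const_mul (hc.of_le (by exact_mod_cast le_top)) R⁻¹
  set J := iterPrim f δ k with hJ
  have hJs : ContDiff ℝ ∞ J := contDiff_iterPrim hfs k
  have hJd : ∀ i ≤ k, iteratedDeriv i J = iterPrim f δ (k - i) := fun i hi => by
    have := iteratedDeriv_iterPrim (δ := δ) hfs i (k - i)
    rwa [Nat.add_sub_cancel' hi] at this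
  have hJle : ∀ j x, |iterPrim f δ (j + 1) x| ≤ (max (x + δ) 0) ^ j :=
    abs_iterPrim_succ_le hfle b.nonneg_normed b.integrable_normed b.integral_normed
  have hprod : ∀ a ≤ k, ∀ x, iteratedDeriv a (fun x => χ x * J x) x =
      ∑ i ∈ Finset.range (a + 1), a.choose i * iteratedDeriv i χ x * iterPrim f δ (k - (a - i)) x := by
    intro a ha x
    rw [iteratedDeriv_fun_mul (hχs.contDiffAt.of_le (by exact_mod_cast le_top))
      (hJs.contDiffAt.of_le (by exact_mod_cast le_top))]
    refine Finset.sum_congr rfl fun i hi => ?_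
    rw [hJd (a - i) (by omega)]
  -- Each derivative of the cutoff gains the factor `x + δ ≤ 3 R` that the primitive loses.
  have hkey : ∀ i ≤ k, ∀ x, |iteratedDeriv i χ x| * (max (x + δ) 0) ^ i ≤ D * 3 ^ i := by
    intro i hi x
    rw [hχd]
    rcases lt_or_ge 2 |R⁻¹ * x| with h | h
    · simp only [hczero i _ h, mul_zero, abs_zero, zero_mul]; positivity
    · have hx : x ≤ 2 * R := by
        have := (le_abs_self _).trans h
        rwa [inv_mul_le_iff₀ hR0, mul_comm] at this
      have hm : max (x + δ) 0 ≤ 3 * R := max_le (by linarith) (by positivity)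
      have : |R⁻¹ ^ i * iteratedDeriv i c (R⁻¹ * x)| ≤ R⁻¹ ^ i * D := by
        rw [abs_mul, abs_of_pos (by positivity)]
        exact mul_le_mul_of_nonneg_left (hD i hi _) (by positivity)
      calc |R⁻¹ ^ i * iteratedDeriv i c (R⁻¹ * x)| * (max (x + δ) 0) ^ i
          ≤ (R⁻¹ ^ i * D) * (3 * R) ^ i := by gcongr
        _ = D * 3 ^ i := by rw [mul_pow, inv_pow]; field_simp
  have hBa : ∀ a ≤ k, ∑ i ∈ Finset.range (a + 1), (a.choose i : ℝ) * (D * 3 ^ i) ≤ B := by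
    intro a ha
    exact Finset.single_le_sum
      (f := fun a => ∑ i ∈ Finset.range (a + 1), (a.choose i : ℝ) * (D * 3 ^ i))
      (fun _ _ => by positivity) (Finset.mem_range.2 (by omega))
  refine ⟨fun x => χ x * J x, ?_, ?_, ?_, ?_⟩
  · refine ⟨hχs.mul hJs, HasCompactSupport.mul_right ?_⟩
    exact c.hasCompactSupport.comp_homeomorph (Homeomorph.mulLeft₀ R⁻¹ (by positivity))
  · intro x hx
    simp only [hJ, iterPrim_eq_zero hfle k x hx, mul_zero]
  · intro a ha x
    rw [hprod a ha.le]
    refine (Finset.abs_sum_le_sum_abs _ _).trans ?_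
    refine le_trans (Finset.sum_le_sum fun i hi => ?_)
      ((Finset.sum_mul _ _ _).symm.trans_le
        (mul_le_mul_of_nonneg_right (hBa a ha.le) (by positivity)))
    have hi' : i ≤ a := by simpa [Nat.lt_succ_iff] using hi
    have e : k - (a - i) = (k - 1 - a + i) + 1 := by omega
    rw [abs_mul, abs_mul, Nat.abs_cast, mul_assoc, mul_assoc]
    refine mul_le_mul_of_nonneg_left ?_ (Nat.cast_nonneg _)
    calc |iteratedDeriv i χ x| * |iterPrim f δ (k - (a - i)) x|
        ≤ |iteratedDeriv i χ x| * (max (x + δ) 0) ^ (k - 1 - a + i) := by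
          rw [e]; gcongr; exact hJle _ x
      _ = (|iteratedDeriv i χ x| * (max (x + δ) 0) ^ i) * (max (x + δ) 0) ^ (k - 1 - a) := by
          rw [pow_add]; ring
      _ ≤ _ := mul_le_mul_of_nonneg_right (hkey i (by omega) x) (by positivity)
  · intro x
    rw [hprod k le_rfl, Finset.sum_range_succ']
    -- The undifferentiated cutoff is `1` on the support of `b`, because `b.rOut ≤ 1 ≤ R`.
    have e0 : ((k.choose 0 : ℕ) : ℝ) * iteratedDeriv 0 χ x * iterPrim f δ (k - (k - 0)) x = f x := by
      simp only [Nat.choose_zero_right, Nat.cast_one, one_mul, iteratedDeriv_zero, Nat.sub_zero,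
        Nat.sub_self, iterPrim]
      rcases lt_or_ge |x| δ with h | h
      · have : χ x = 1 := by
          refine c.one_of_mem_closedBall ?_
          simp only [Metric.mem_closedBall, dist_zero_right, Real.norm_eq_abs, abs_mul, c]
          rw [abs_of_pos (by positivity), inv_mul_le_iff₀ hR0]
          linarith
        rw [this, one_mul]
      · rw [hf0 x h, mul_zero]
    rw [e0, add_sub_cancel_right]
    refine (Finset.abs_sum_le_sum_abs _ _).trans ?_
    have hBk := hBa k le_rfl
    rw [Finset.sum_range_succ'] at hBk
    have hBk' : ∑ i ∈ Finset.range k, (k.choose (i + 1) : ℝ) * (D * 3 ^ (i + 1)) ≤ B := by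
      have : 0 ≤ ((k.choose 0 : ℕ) : ℝ) * (D * 3 ^ 0) := by positivity
      linarith
    rw [div_eq_mul_inv]
    refine le_trans (Finset.sum_le_sum fun i hi => ?_)
      ((Finset.sum_mul _ _ _).symm.trans_le (mul_le_mul_of_nonneg_right hBk' (by positivity)))
    have hi' : i < k := Finset.mem_range.1 hi
    have e : k - (k - (i + 1)) = i + 1 := by omega
    rw [e, abs_mul, abs_mul, Nat.abs_cast, mul_assoc, mul_assoc]
    refine mul_le_mul_of_nonneg_left ?_ (Nat.cast_nonneg _)
    rw [hχd]
    rcases lt_or_ge 2 |R⁻¹ * x| with h | h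
    · simp only [hczero _ _ h, mul_zero, abs_zero, zero_mul]; positivity
    · have hx : x ≤ 2 * R := by
        have := (le_abs_self _).trans h
        rwa [inv_mul_le_iff₀ hR0, mul_comm] at this
      have hm : max (x + δ) 0 ≤ 3 * R := max_le (by linarith) (by positivity)
      have : |R⁻¹ ^ (i + 1) * iteratedDeriv (i + 1) c (R⁻¹ * x)| ≤ R⁻¹ ^ (i + 1) * D := by
        rw [abs_mul, abs_of_pos (by positivity)]
        exact mul_le_mul_of_nonneg_left (hD _ (by omega) _) (by positivity)
      calc |R⁻¹ ^ (i + 1) * iteratedDeriv (i + 1) c (R⁻¹ * x)| * |iterPrim f δ (i + 1) x|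
          ≤ (R⁻¹ ^ (i + 1) * D) * (3 * R) ^ i :=
            mul_le_mul this ((hJle i x).trans (by gcongr)) (abs_nonneg _) (by positivity)
        _ = D * 3 ^ i * R⁻¹ := by rw [mul_pow, inv_pow, pow_succ]; field_simp
        _ ≤ D * 3 ^ (i + 1) * R⁻¹ := by gcongr <;> norm_num

end Primitive

/-! ### The estimate on a slice -/

section Slice

variable {d : ℕ} {φ ρ : (Fin d → ℝ) → ℝ} {U : ℝ → ℝ}

lemma abs_integral_le_of_abs_le {X : Type*} [MeasurableSpace X] {μ : Measure X} {f g : X → ℝ}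
    (hg : Integrable g μ) (h : ∀ x, |f x| ≤ g x) : |∫ x, f x ∂μ| ≤ ∫ x, g x ∂μ := by
  rw [← Real.norm_eq_abs]
  exact norm_integral_le_of_norm_le hg (Filter.Eventually.of_forall h)

lemma exists_abs_avg_le (hφ : IsTestFn φ) (hρ : IsTestFn ρ) :
    ∃ M, 0 ≤ M ∧ ∀ p, |avg φ ρ p| ≤ M := by
  obtain ⟨C, hC0, hC⟩ := hφ.bounded
  refine ⟨C * ∫ z, |ρ z|, by positivity, fun p => ?_⟩
  rw [← integral_const_mul]
  refine abs_integral_le_of_abs_le ((hρ.integrable volume).abs.const_mul C) fun z => ?_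
  rw [abs_mul]
  exact mul_le_mul_of_nonneg_right (hC _) (abs_nonneg _)

/-- For `lam` in a compact set, `avg φ ρ (lam, ·)` is supported in a fixed compact set. -/
lemma exists_isCompact_avg_eq_zero (hφ : IsTestFn φ) (hρ : IsTestFn ρ) {K : Set ℝ}
    (hK : IsCompact K) : ∃ K' : Set (Fin d → ℝ), IsCompact K' ∧
      ∀ lam ∈ K, ∀ y ∉ K', avg φ ρ (lam, y) = 0 := by
  refine ⟨(fun q : ℝ × (Fin d → ℝ) × (Fin d → ℝ) => q.2.2 + q.1 • q.2.1) ''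
    (K ×ˢ (tsupport ρ ×ˢ tsupport φ)), (hK.prod (hρ.2.prod hφ.2)).image (by fun_prop),
    fun lam hlam y hy => ?_⟩
  refine integral_eq_zero_of_ae (Filter.Eventually.of_forall fun z => ?_)
  by_contra hne
  have h1 : φ (y - lam • z) ≠ 0 := left_ne_zero_of_mul hne
  have h2 : ρ z ≠ 0 := right_ne_zero_of_mul hne
  exact hy ⟨(lam, z, y - lam • z), ⟨hlam, subset_tsupport _ h2, subset_tsupport _ h1⟩, by simp⟩

lemma isTestFn_sliceExt (hU : IsTestFn U) (hφ : IsTestFn φ) (hρ : IsTestFn ρ) (t ε : ℝ) :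
    IsTestFn (sliceExt ρ U φ t ε) := by
  refine ⟨contDiff_sliceExt hU.1 hφ hρ t ε, ?_⟩
  obtain ⟨K', hK', h0⟩ := exists_isCompact_avg_eq_zero hφ hρ
    (hU.2.image (f := fun τ : ℝ => ε + τ) (by fun_prop))
  refine HasCompactSupport.intro ((hU.2.image (f := fun τ : ℝ => τ + t) (by fun_prop)).prod hK')
    fun x hx => ?_
  by_contra hne
  have h1 : U (x.1 - t) ≠ 0 := left_ne_zero_of_mul hne
  have h2 : avg φ ρ (ε + (x.1 - t), x.2) ≠ 0 := right_ne_zero_of_mul hne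
  refine hx ⟨⟨x.1 - t, subset_tsupport _ h1, by simp⟩, ?_⟩
  by_contra h3
  exact h2 (h0 _ ⟨x.1 - t, subset_tsupport _ h1, rfl⟩ _ h3)

lemma integrable_mul_of_bounded {X : Type*} [MeasurableSpace X] {μ : Measure X}
    {g f : X → ℝ} (hg : Integrable g μ) (hf : AEStronglyMeasurable f μ) {C : ℝ}
    (hC : ∀ x, |f x| ≤ C) : Integrable (fun x => g x * f x) μ := by
  simpa [mul_comm] using hg.bdd_mul hf (Filter.Eventually.of_forall hC)

variable {ι : Type*} [Fintype ι]

/-- `∑ i, dirDs (V i)` applied to `g i` vanishes in the sense of distributions; this is the formal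
adjoint formulation, in which no sign is needed because all the lists have the same length. -/
def IsDivFree {X : Type*} [NormedAddCommGroup X] [NormedSpace ℝ X] [MeasureSpace X]
    (V : ι → List X) (g : ι → X → ℝ) : Prop :=
  ∀ ψ : X → ℝ, IsTestFn ψ → ∑ i, ∫ x, g i x * dirDs (V i) ψ x = 0

/-- The component of `g` in the direction normal to the slices `{t} × ℝᵈ`. -/
def normalPart (V : ι → List (ℝ × (Fin d → ℝ))) (g : ι → ℝ × (Fin d → ℝ) → ℝ)
    (x : ℝ × (Fin d → ℝ)) : ℝ :=
  ∑ i, ((V i).map Prod.fst).prod * g i x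

/-- The divergence condition tested with `sliceExt`: the mean of the normal part of `g` over a
thin layer `t - δ < s < t + δ`, tested with averages of `φ` at scale about `ε`. -/
lemma exists_abs_integral_layer_le (hd : 1 ≤ d) (hρ : IsTestFn ρ) {k : ℕ} (hk : k ≠ 0)
    (V : ι → List (ℝ × (Fin d → ℝ))) (hV : ∀ i, (V i).length = k) :
    ∃ C, 0 ≤ C ∧ ∀ g : ι → ℝ × (Fin d → ℝ) → ℝ, (∀ i, Integrable (g i)) → IsDivFree V g →
      ∀ φ, IsTestFn φ → ∀ t ε : ℝ, 0 < ε → ∀ b : ContDiffBump (0 : ℝ), b.rOut ≤ 1 →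
        b.rOut ≤ ε / 2 →
        |∫ x, normalPart V g x * (b.normed volume (x.1 - t) * avg φ ρ (ε + (x.1 - t), x.2))| ≤
          C * (∑ i, ∫ x, |g i x|) *
            (energy φ ^ (1 / ((d : ℝ) + 1)) * ε ^ (1 / ((d : ℝ) + 1) - 1)) := by
  obtain ⟨B, hB0, hB⟩ := exists_truncated_primitive k
  have hR : ∀ i, ∃ R, IsRemainder k R ∧ ∀ U φ, ContDiff ℝ ∞ U → IsTestFn φ → ∀ t ε x,
      0 < ε + (x.1 - t) → dirDs (V i) (sliceExt ρ U φ t ε) x =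
        ((V i).map Prod.fst).prod * iteratedDeriv k U (x.1 - t) *
          avg φ ρ (ε + (x.1 - t), x.2) + R U φ t ε x := fun i => by
    have h := exists_dirDs_sliceExt hρ (V i) (fun h => hk (by rw [← hV i, h]; rfl))
    rwa [hV i] at h
  choose R hR hReq using hR
  choose C hC0 hC using fun i => (hR i).exists_abs_le hd
  set D : ι → ℝ := fun i => |((V i).map Prod.fst).prod| with hD
  refine ⟨(∑ i, C i) * B, mul_nonneg (Finset.sum_nonneg fun i _ => hC0 i) hB0,
    fun g hg hdiv φ hφ t ε hε b hb1 hb2 => ?_⟩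
  obtain ⟨M, hM0, hM⟩ := exists_abs_avg_le hφ hρ
  set S := ∑ i, ∫ x, |g i x| with hS
  have hS0 : ∀ i, 0 ≤ ∫ x, |g i x| := fun i => by positivity
  set E := energy φ ^ (1 / ((d : ℝ) + 1)) * ε ^ (1 / ((d : ℝ) + 1) - 1) with hE
  have hE0 : 0 ≤ E := mul_nonneg (Real.rpow_nonneg (energy_nonneg φ) _) (Real.rpow_nonneg hε.le _)
  set β : ℝ × (Fin d → ℝ) → ℝ :=
    fun x => b.normed volume (x.1 - t) * avg φ ρ (ε + (x.1 - t), x.2) with hβ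
  have hδ0 : 0 < b.rOut := b.rOut_pos
  have hβtest : IsTestFn β :=
    isTestFn_sliceExt (U := b.normed volume) ⟨b.contDiff_normed, b.hasCompactSupport_normed⟩ hφ hρ t ε
  obtain ⟨Mβ, -, hMβ⟩ := hβtest.bounded
  -- The truncation radius `Rad` tends to infinity at the end.
  have main : ∀ Rad : ℝ, 1 ≤ Rad → |∫ x, normalPart V g x * β x| ≤
      (∑ i, C i) * B * S * E + (∑ i, D i) * B * M * S / Rad := by
    intro Rad hRad
    have hRad0 : 0 < Rad := by linarith
    obtain ⟨U, hU, hU0, hUa, hUk⟩ := hB b Rad hb1 hRad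
    set ψ := sliceExt ρ U φ t ε with hψ
    have hψt : IsTestFn ψ := isTestFn_sliceExt hU hφ hρ t ε
    -- `ψ` vanishes below the layer; there the scale `ε + (x.1 - t)` may be negative, and the
    -- derivative formula is not available.
    have hsupp : tsupport ψ ⊆ {x | -b.rOut ≤ x.1 - t} := by
      refine closure_minimal (fun x hx => ?_) (isClosed_le continuous_const (by fun_prop))
      by_contra h
      simp only [Set.mem_ofPred_eq, not_le] at h
      exact hx (by simp [hψ, sliceExt, hU0 _ h.le])
    -- The two terms come from the remainder and from the error of the truncated primitive.
    have hpt : ∀ i x, |((V i).map Prod.fst).prod * β x - dirDs (V i) ψ x| ≤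
        C i * B * E + D i * (B / Rad) * M := by
      intro i x
      rcases lt_or_ge (x.1 - t) (-b.rOut) with h | h
      · have e1 : dirDs (V i) ψ x = 0 := by
          refine image_eq_zero_of_notMem_tsupport fun hx => ?_
          exact absurd (hsupp (tsupport_dirDs_subset _ _ hx)) (not_le.2 h)
        have e2 : b.normed volume (x.1 - t) = 0 := by
          have : x.1 - t ∉ Function.support (b.normed volume) := by
            rw [b.support_normed_eq]
            simp only [Metric.mem_ball, dist_zero_right, Real.norm_eq_abs, not_lt]
            rw [abs_of_neg (by linarith)]; linarith
          simpa using this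
        simp only [hβ, e1, e2, zero_mul, mul_zero, sub_zero, abs_zero]
        have := hC0 i
        positivity
      · have hlam : 0 < ε + (x.1 - t) := by linarith
        rw [hψ, hReq i U φ hU.1 hφ t ε x hlam]
        have hrem := hC i U φ hφ t ε B x hε (by linarith) hB0 (fun a ha => by
          refine (hUa a ha _).trans (mul_le_mul_of_nonneg_left ?_ hB0)
          exact pow_le_pow_left₀ (le_max_right _ _) (max_le (by linarith) hlam.le) _)
        have e : ((V i).map Prod.fst).prod * β x -
            (((V i).map Prod.fst).prod * iteratedDeriv k U (x.1 - t) *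
              avg φ ρ (ε + (x.1 - t), x.2) + R i U φ t ε x) =
            -(R i U φ t ε x) + -(((V i).map Prod.fst).prod *
              (iteratedDeriv k U (x.1 - t) - b.normed volume (x.1 - t)) *
              avg φ ρ (ε + (x.1 - t), x.2)) := by simp only [hβ]; ring
        rw [e]
        refine (abs_add_le _ _).trans (add_le_add ?_ ?_)
        · rw [abs_neg]; exact hrem.trans_eq (by rw [hE]; ring)
        · rw [abs_neg, abs_mul, abs_mul]
          have := hUk (x.1 - t)
          have := hM (ε + (x.1 - t), x.2)
          gcongr
    have hmeas : ∀ i, Continuous fun x => ((V i).map Prod.fst).prod * β x - dirDs (V i) ψ x :=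
      fun i => (continuous_const.mul hβtest.1.continuous).sub (hψt.dirDs _).1.continuous
    have hdint : ∀ i, Integrable fun x => g i x * dirDs (V i) ψ x := fun i => by
      obtain ⟨c, -, hc⟩ := (hψt.dirDs (V i)).bounded
      exact integrable_mul_of_bounded (hg i) (hψt.dirDs _).1.continuous.aestronglyMeasurable hc
    have hβint : ∀ i, Integrable fun x => g i x * (((V i).map Prod.fst).prod * β x) := fun i => by
      obtain ⟨c, -, hc⟩ := (hβtest.const_mul ((V i).map Prod.fst).prod).bounded
      exact integrable_mul_of_bounded (hg i)
        (continuous_const.mul hβtest.1.continuous).aestronglyMeasurable hc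
    have e1 : ∫ x, normalPart V g x * β x =
        ∑ i, ∫ x, g i x * (((V i).map Prod.fst).prod * β x - dirDs (V i) ψ x) := by
      have h1 : ∀ i, ∫ x, g i x * (((V i).map Prod.fst).prod * β x - dirDs (V i) ψ x) =
          (∫ x, g i x * (((V i).map Prod.fst).prod * β x)) - ∫ x, g i x * dirDs (V i) ψ x := by
        intro i
        simp_rw [mul_sub]
        exact integral_sub (hβint i) (hdint i)
      simp_rw [h1]
      rw [Finset.sum_sub_distrib, hdiv ψ hψt, sub_zero, ← integral_finsetSum _ fun i _ => hβint i]
      congr 1; funext x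
      rw [normalPart, Finset.sum_mul]
      exact Finset.sum_congr rfl fun i _ => by ring
    rw [e1]
    refine (Finset.abs_sum_le_sum_abs _ _).trans ?_
    calc ∑ i, |∫ x, g i x * (((V i).map Prod.fst).prod * β x - dirDs (V i) ψ x)|
        ≤ ∑ i, (C i * B * E + D i * (B / Rad) * M) * S := by
          refine Finset.sum_le_sum fun i _ => ?_
          have h1 : |∫ x, g i x * (((V i).map Prod.fst).prod * β x - dirDs (V i) ψ x)| ≤
              ∫ x, (C i * B * E + D i * (B / Rad) * M) * |g i x| := by
            refine abs_integral_le_of_abs_le ((hg i).abs.const_mul _) fun x => ?_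
            rw [abs_mul, mul_comm]
            exact mul_le_mul_of_nonneg_right (hpt i x) (abs_nonneg _)
          refine h1.trans ?_
          rw [integral_const_mul]
          refine mul_le_mul_of_nonneg_left ?_ ?_
          · exact Finset.single_le_sum (f := fun i => ∫ x, |g i x|) (fun i _ => hS0 i)
              (Finset.mem_univ i)
          · have := hC0 i
            positivity
      _ = _ := by
          rw [← Finset.sum_mul, Finset.sum_add_distrib, ← Finset.sum_mul, ← Finset.sum_mul,
            ← Finset.sum_mul, ← Finset.sum_mul]
          ring
  have hlim : Filter.Tendsto (fun Rad : ℝ => (∑ i, C i) * B * S * E + (∑ i, D i) * B * M * S / Rad)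
      Filter.atTop (nhds ((∑ i, C i) * B * S * E + 0)) :=
    tendsto_const_nhds.add (tendsto_const_nhds.div_atTop Filter.tendsto_id)
  rw [add_zero] at hlim
  exact ge_of_tendsto hlim (Filter.eventually_atTop.2 ⟨1, main⟩)

lemma continuous_normalPart {V : ι → List (ℝ × (Fin d → ℝ))} {g : ι → ℝ × (Fin d → ℝ) → ℝ}
    (hg : ∀ i, Continuous (g i)) : Continuous (normalPart V g) :=
  continuous_finsetSum _ fun i _ => continuous_const.mul (hg i)

lemma integrable_normalPart {V : ι → List (ℝ × (Fin d → ℝ))} {g : ι → ℝ × (Fin d → ℝ) → ℝ}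
    (hg : ∀ i, Integrable (g i)) : Integrable (normalPart V g) :=
  integrable_finsetSum _ fun i _ => (hg i).const_mul _

/-- The layer estimate passes to the limit of a thin layer. -/
lemma abs_integral_slice_avg_le {C₀ : ℝ} {G : ℝ × (Fin d → ℝ) → ℝ} (hG : Continuous G)
    (hGi : Integrable G) (hφ : IsTestFn φ) (hρ : IsTestFn ρ) {t ε : ℝ} (hε : 0 < ε)
    (h : ∀ b : ContDiffBump (0 : ℝ), b.rOut ≤ 1 → b.rOut ≤ ε / 2 →
        |∫ x, G x * (b.normed volume (x.1 - t) * avg φ ρ (ε + (x.1 - t), x.2))| ≤ C₀) :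
    |∫ y, G (t, y) * avg φ ρ (ε, y)| ≤ C₀ := by
  have havg := (contDiff_avg hφ hρ).continuous
  -- The layer integral is the convolution of `m` with `b` at `t`.
  set m : ℝ → ℝ := fun s => ∫ y, G (s, y) * avg φ ρ (ε + (s - t), y) with hm
  have hmc : Continuous m := by
    rw [continuous_iff_continuousAt]
    intro s
    obtain ⟨K', hK', h0⟩ := exists_isCompact_avg_eq_zero hφ hρ
      ((isCompact_Icc (a := s - 1) (b := s + 1)).image (f := fun s : ℝ => ε + (s - t))
        (by fun_prop))
    have := continuousOn_integral_of_compact_support (μ := (volume : Measure (Fin d → ℝ)))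
      (f := fun s y => G (s, y) * avg φ ρ (ε + (s - t), y)) (s := Set.Icc (s - 1) (s + 1)) hK'
      (Continuous.continuousOn (by unfold Function.uncurry; fun_prop))
      (fun s' y hs' hy => by rw [h0 _ ⟨s', hs', rfl⟩ y hy, mul_zero])
    exact this.continuousAt (Icc_mem_nhds (by linarith) (by linarith))
  let b : ℕ → ContDiffBump (0 : ℝ) := fun i =>
    ⟨1 / ((i : ℝ) + 1) / 2, 1 / ((i : ℝ) + 1), by positivity, half_lt_self (by positivity)⟩
  have hb : Filter.Tendsto (fun i => (b i).rOut) Filter.atTop (nhds 0) :=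
    tendsto_one_div_add_atTop_nhds_zero_nat
  have hlim := ContDiffBump.convolution_tendsto_right_of_continuous (μ := volume) hb hmc t
  have hmt : m t = ∫ y, G (t, y) * avg φ ρ (ε, y) := by simp [hm]
  rw [← hmt]
  refine le_of_tendsto hlim.abs ?_
  filter_upwards [hb.eventually_le_const one_pos, hb.eventually_le_const (half_pos hε)] with i h1 h2
  refine le_trans (le_of_eq ?_) (h (b i) h1 h2)
  congr 1
  rw [convolution_lsmul_swap]
  obtain ⟨c, -, hc⟩ := (isTestFn_sliceExt (U := (b i).normed volume)
    ⟨(b i).contDiff_normed, (b i).hasCompactSupport_normed⟩ hφ hρ t ε).bounded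
  have hint : Integrable (fun x : ℝ × (Fin d → ℝ) =>
      G x * ((b i).normed volume (x.1 - t) * avg φ ρ (ε + (x.1 - t), x.2))) := by
    refine integrable_mul_of_bounded hGi ?_ hc
    exact (contDiff_sliceExt (b i).contDiff_normed hφ hρ t ε).continuous.aestronglyMeasurable
  rw [Measure.volume_eq_prod, integral_prod _ hint]
  congr 1; funext s
  rw [← (b i).normed_neg, neg_sub, hm, smul_eq_mul, ← integral_const_mul]
  congr 1; funext y; ring

/-- The estimate of the normal part of `g` on the slice `{t} × ℝᵈ`, at the optimal scale: the
slice contributes `M ^ (1 - 1 / (d + 1))`, where `M` is the mass of the normal part there. -/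
lemma exists_abs_integral_slice_le (hd : 1 ≤ d) {k : ℕ} (hk : k ≠ 0)
    (V : ι → List (ℝ × (Fin d → ℝ))) (hV : ∀ i, (V i).length = k) :
    ∃ C, 0 ≤ C ∧ ∀ g : ι → ℝ × (Fin d → ℝ) → ℝ, (∀ i, Continuous (g i)) →
      (∀ i, Integrable (g i)) → IsDivFree V g → ∀ S, 0 < S → ∑ i, ∫ x, |g i x| ≤ S →
      ∀ φ, IsTestFn φ → ∀ t : ℝ, Integrable (fun y => normalPart V g (t, y)) →
        |∫ y, normalPart V g (t, y) * φ y| ≤ C * S ^ (1 / ((d : ℝ) + 1)) *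
          (energy φ ^ (1 / ((d : ℝ) + 1)) *
            (∫ y, |normalPart V g (t, y)|) ^ ((d : ℝ) / ((d : ℝ) + 1))) := by
  let b₀ : ContDiffBump (0 : Fin d → ℝ) := ⟨1, 2, one_pos, one_lt_two⟩
  set ρ : (Fin d → ℝ) → ℝ := b₀.normed volume with hρdef
  have hρ : IsTestFn ρ := ⟨b₀.contDiff_normed, b₀.hasCompactSupport_normed⟩
  have hρ1 : ∫ z, ρ z = 1 := b₀.integral_normed
  obtain ⟨C, hC0, hC⟩ := exists_abs_integral_layer_le hd hρ hk V hV
  obtain ⟨K, hK0, hK⟩ := exists_abs_avg_sub_le hd hρ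
  refine ⟨K + C, by positivity, fun g hgc hgi hdiv S hS hgS φ hφ t ht => ?_⟩
  set M := ∫ y, |normalPart V g (t, y)| with hM
  have hM0 : 0 ≤ M := by positivity
  set E := energy φ ^ (1 / ((d : ℝ) + 1)) with hE
  have hE0 : 0 ≤ E := Real.rpow_nonneg (energy_nonneg φ) _
  have hd1 : (0 : ℝ) < (d : ℝ) + 1 := by positivity
  -- If the slice carries no mass there is no optimal scale, and both sides vanish.
  rcases hM0.eq_or_lt with hM' | hM'
  · have h0 : (fun y => |normalPart V g (t, y)|) =ᵐ[volume] 0 :=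
      (integral_eq_zero_iff_of_nonneg (fun y => abs_nonneg _) ht.abs).1 (by rw [← hM, ← hM'])
    have h1 : ∫ y, normalPart V g (t, y) * φ y = 0 := by
      refine integral_eq_zero_of_ae ?_
      filter_upwards [h0] with y hy
      rw [abs_eq_zero.1 hy, zero_mul]; rfl
    rw [h1, abs_zero]
    positivity
  -- This scale makes `ε ^ (1 / (d + 1)) * M` and `S * ε ^ (1 / (d + 1) - 1)` equal.
  set ε := S / M with hεdef
  have hε : 0 < ε := div_pos hS hM'
  have hGc := continuous_normalPart (V := V) hgc
  have h1 : |∫ y, normalPart V g (t, y) * avg φ ρ (ε, y)| ≤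
      C * S * (E * ε ^ (1 / ((d : ℝ) + 1) - 1)) := by
    refine abs_integral_slice_avg_le hGc (integrable_normalPart hgi) hφ hρ hε fun b hb1 hb2 => ?_
    refine (hC g hgi hdiv φ hφ t ε hε b hb1 hb2).trans ?_
    have : 0 ≤ ε ^ (1 / ((d : ℝ) + 1) - 1) := Real.rpow_nonneg hε.le _
    gcongr
  obtain ⟨c, -, hc⟩ := hφ.bounded
  obtain ⟨c', -, hc'⟩ := exists_abs_avg_le hφ hρ
  have havg : Continuous fun y => avg φ ρ (ε, y) :=
    (contDiff_avg hφ hρ).continuous.comp (by fun_prop)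
  have i1 : Integrable fun y => normalPart V g (t, y) * φ y :=
    integrable_mul_of_bounded ht hφ.1.continuous.aestronglyMeasurable hc
  have i2 : Integrable fun y => normalPart V g (t, y) * avg φ ρ (ε, y) :=
    integrable_mul_of_bounded ht havg.aestronglyMeasurable fun y => hc' _
  have h2 : |∫ y, normalPart V g (t, y) * (φ y - avg φ ρ (ε, y))| ≤
      K * E * ε ^ (1 / ((d : ℝ) + 1)) * M := by
    rw [hM, ← integral_const_mul]
    refine abs_integral_le_of_abs_le (ht.abs.const_mul _) fun y => ?_
    rw [abs_mul, mul_comm]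
    refine mul_le_mul_of_nonneg_right ?_ (abs_nonneg _)
    have := hK φ hφ ε hε y
    rwa [hρ1, mul_one, abs_sub_comm] at this
  have e : ∫ y, normalPart V g (t, y) * φ y =
      (∫ y, normalPart V g (t, y) * (φ y - avg φ ρ (ε, y))) +
        ∫ y, normalPart V g (t, y) * avg φ ρ (ε, y) := by
    simp_rw [mul_sub]
    rw [integral_sub i1 i2]; ring
  have e1 : ε ^ (1 / ((d : ℝ) + 1)) * M =
      S ^ (1 / ((d : ℝ) + 1)) * M ^ ((d : ℝ) / ((d : ℝ) + 1)) := by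
    have : (d : ℝ) / ((d : ℝ) + 1) = 1 - 1 / ((d : ℝ) + 1) := by field_simp; ring
    rw [hεdef, Real.div_rpow hS.le hM0, this, Real.rpow_sub hM', Real.rpow_one]
    field_simp
  have e2 : S * ε ^ (1 / ((d : ℝ) + 1) - 1) = ε ^ (1 / ((d : ℝ) + 1)) * M := by
    rw [Real.rpow_sub hε, Real.rpow_one]
    have : S = ε * M := by rw [hεdef]; field_simp
    rw [this]; field_simp
  rw [e]
  refine (abs_add_le _ _).trans ((add_le_add h2 h1).trans_eq ?_)
  calc K * E * ε ^ (1 / ((d : ℝ) + 1)) * M + C * S * (E * ε ^ (1 / ((d : ℝ) + 1) - 1))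
      = K * E * (ε ^ (1 / ((d : ℝ) + 1)) * M) + C * E * (S * ε ^ (1 / ((d : ℝ) + 1) - 1)) := by ring
    _ = _ := by rw [e2, e1]; ring

end Slice

/-! ### Integration over the slices -/

section Slicing

variable {d : ℕ} {ι : Type*} [Fintype ι]

lemma IsTestFn.slice {h : ℝ × (Fin d → ℝ) → ℝ} (hh : IsTestFn h) (t : ℝ) :
    IsTestFn fun y => h (t, y) := by
  refine ⟨hh.1.comp (contDiff_const.prodMk contDiff_id), ?_⟩
  refine HasCompactSupport.intro (hh.2.image (f := Prod.snd) continuous_snd) fun y hy => ?_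
  by_contra hne
  exact hy ⟨(t, y), subset_tsupport _ hne, rfl⟩

lemma IsTestFn.integrable_norm_fderiv_rpow {X : Type*} [NormedAddCommGroup X] [NormedSpace ℝ X]
    [MeasurableSpace X] [BorelSpace X] {μ : Measure X} [IsFiniteMeasureOnCompacts μ]
    {h : X → ℝ} (hh : IsTestFn h) {p : ℝ} (hp : 0 < p) :
    Integrable (fun x => ‖fderiv ℝ h x‖ ^ p) μ := by
  have hc : Continuous (fderiv ℝ h) := hh.1.continuous_fderiv (by simp)
  refine Continuous.integrable_of_hasCompactSupport
    (hc.norm.rpow_const fun x => Or.inr hp.le) ?_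
  exact (hh.2.fderiv ℝ).comp_left (g := fun T : X →L[ℝ] ℝ => ‖T‖ ^ p)
    (by simp [Real.zero_rpow hp.ne'])

lemma energy_slice_le {h : ℝ × (Fin d → ℝ) → ℝ} (hh : IsTestFn h) (t : ℝ)
    (hi : Integrable fun y => ‖fderiv ℝ h (t, y)‖ ^ ((d : ℝ) + 1)) :
    energy (fun y => h (t, y)) ≤ ∫ y, ‖fderiv ℝ h (t, y)‖ ^ ((d : ℝ) + 1) := by
  refine integral_mono ((hh.slice t).integrable_norm_fderiv_rpow (by positivity)) hi fun y => ?_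
  refine Real.rpow_le_rpow (norm_nonneg _) ?_ (by positivity)
  have h1 : HasFDerivAt (fun y : Fin d → ℝ => (t, y))
      (ContinuousLinearMap.inr ℝ ℝ (Fin d → ℝ)) y := hasFDerivAt_prodMk_right t y
  have h2 : HasFDerivAt (fun y => h (t, y))
      ((fderiv ℝ h (t, y)).comp (ContinuousLinearMap.inr ℝ ℝ (Fin d → ℝ))) y :=
    (hh.differentiable (t, y)).hasFDerivAt.comp y h1
  rw [h2.fderiv]
  refine (ContinuousLinearMap.opNorm_comp_le _ _).trans ?_
  exact mul_le_of_le_one_right (norm_nonneg _) (ContinuousLinearMap.norm_inr_le_one ℝ ℝ _)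

/-- The duality estimate for the normal part of a continuous field: Hölder's inequality in the
slicing variable turns the slice estimates into a global one. -/
lemma exists_abs_integral_normalPart_le_of_continuous (hd : 1 ≤ d) {k : ℕ} (hk : k ≠ 0)
    (V : ι → List (ℝ × (Fin d → ℝ))) (hV : ∀ i, (V i).length = k) :
    ∃ C, 0 ≤ C ∧ ∀ g : ι → ℝ × (Fin d → ℝ) → ℝ, (∀ i, Continuous (g i)) →
      (∀ i, Integrable (g i)) → IsDivFree V g → ∀ S, ∑ i, ∫ x, |g i x| ≤ S →
      ∀ h, IsTestFn h →
        |∫ x, normalPart V g x * h x| ≤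
          C * S * (∫ x, ‖fderiv ℝ h x‖ ^ ((d : ℝ) + 1)) ^ (1 / ((d : ℝ) + 1)) := by
  obtain ⟨C, hC0, hC⟩ := exists_abs_integral_slice_le hd hk V hV
  set D : ℝ := ∑ i, |((V i).map Prod.fst).prod| with hD
  have hD0 : 0 ≤ D := by positivity
  have hd1 : (0 : ℝ) < (d : ℝ) + 1 := by positivity
  have hd' : (0 : ℝ) < d := by exact_mod_cast hd
  refine ⟨C * D ^ ((d : ℝ) / ((d : ℝ) + 1)), by positivity,
    fun g hgc hgi hdiv S₀ hS₀ h hh => ?_⟩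
  set A := (∫ x, ‖fderiv ℝ h x‖ ^ ((d : ℝ) + 1)) with hA
  have hA0 : 0 ≤ A := by positivity
  set G := normalPart V g with hG
  have hGi : Integrable G := integrable_normalPart hgi
  obtain ⟨c, -, hc⟩ := hh.bounded
  have hGh : Integrable fun x => G x * h x :=
    integrable_mul_of_bounded hGi hh.1.continuous.aestronglyMeasurable hc
  have hAi : Integrable fun x => ‖fderiv ℝ h x‖ ^ ((d : ℝ) + 1) :=
    hh.integrable_norm_fderiv_rpow hd1
  set a : ℝ → ℝ := fun t => ∫ y, ‖fderiv ℝ h (t, y)‖ ^ ((d : ℝ) + 1) with ha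
  set M : ℝ → ℝ := fun t => ∫ y, |G (t, y)| with hM
  have ha0 : ∀ t, 0 ≤ a t := fun t => integral_nonneg fun y => by positivity
  have hM0 : ∀ t, 0 ≤ M t := fun t => integral_nonneg fun y => by positivity
  rw [Measure.volume_eq_prod] at hAi hGi hGh
  have hai : Integrable a := hAi.integral_prod_left
  have hMi : Integrable M := hGi.abs.integral_prod_left
  have haA : ∫ t, a t = A := by rw [hA, Measure.volume_eq_prod, integral_prod _ hAi]
  have hMD : ∫ t, M t ≤ D * S₀ := by
    have e : ∫ t, M t = ∫ x, |G x| := by rw [Measure.volume_eq_prod, integral_prod _ hGi.abs]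
    rw [e]
    have h1 : ∫ x, |G x| ≤ ∫ x, ∑ i, |((V i).map Prod.fst).prod| * |g i x| := by
      refine integral_mono (integrable_normalPart hgi).abs
        (integrable_finsetSum _ fun i _ => (hgi i).abs.const_mul _) fun x => ?_
      refine (Finset.abs_sum_le_sum_abs _ _).trans_eq (Finset.sum_congr rfl fun i _ => abs_mul _ _)
    refine h1.trans ?_
    rw [integral_finsetSum _ fun i _ => (hgi i).abs.const_mul _, hD, Finset.sum_mul]
    refine Finset.sum_le_sum fun i _ => ?_
    rw [integral_const_mul]
    refine mul_le_mul_of_nonneg_left (le_trans ?_ hS₀) (abs_nonneg _)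
    exact Finset.single_le_sum (f := fun i => ∫ x, |g i x|)
      (fun i _ => integral_nonneg fun x => abs_nonneg _) (Finset.mem_univ i)
  have hpq : ((d : ℝ) + 1).HolderConjugate (((d : ℝ) + 1) / d) := by
    rw [Real.holderConjugate_iff]
    exact ⟨by linarith, by field_simp; ring⟩
  -- The slice estimate bounds the integral over the slice at `t` by a multiple of `fa t * fM t`.
  set fa : ℝ → ℝ := fun t => a t ^ (1 / ((d : ℝ) + 1)) with hfa
  set fM : ℝ → ℝ := fun t => M t ^ ((d : ℝ) / ((d : ℝ) + 1)) with hfM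
  have ea : ∀ t, fa t ^ ((d : ℝ) + 1) = a t := fun t => by
    rw [hfa, ← Real.rpow_mul (ha0 t), one_div_mul_cancel hd1.ne', Real.rpow_one]
  have eM : ∀ t, fM t ^ (((d : ℝ) + 1) / d) = M t := fun t => by
    rw [hfM, ← Real.rpow_mul (hM0 t), div_mul_div_comm, mul_comm, div_self (by positivity),
      Real.rpow_one]
  have hfa0 : ∀ t, 0 ≤ fa t := fun t => Real.rpow_nonneg (ha0 t) _
  have hfM0 : ∀ t, 0 ≤ fM t := fun t => Real.rpow_nonneg (hM0 t) _
  have hfaL : MemLp fa (ENNReal.ofReal ((d : ℝ) + 1)) volume := by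
    have hm : AEStronglyMeasurable fa volume :=
      (hai.aestronglyMeasurable.aemeasurable.pow_const _).aestronglyMeasurable
    refine (integrable_norm_rpow_iff hm (by simp [hd1]) ENNReal.ofReal_ne_top).1 ?_
    rw [ENNReal.toReal_ofReal hd1.le]
    simpa [abs_of_nonneg (hfa0 _), ea] using hai
  have hfML : MemLp fM (ENNReal.ofReal (((d : ℝ) + 1) / d)) volume := by
    have hm : AEStronglyMeasurable fM volume :=
      (hMi.aestronglyMeasurable.aemeasurable.pow_const _).aestronglyMeasurable
    have hq : 0 < ((d : ℝ) + 1) / d := by positivity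
    refine (integrable_norm_rpow_iff hm (by simpa using hq) ENNReal.ofReal_ne_top).1 ?_
    rw [ENNReal.toReal_ofReal hq.le]
    simpa [abs_of_nonneg (hfM0 _), eM] using hMi
  have hprodi : Integrable fun t => fa t * fM t := by
    have : ENNReal.HolderConjugate (ENNReal.ofReal ((d : ℝ) + 1))
      (ENNReal.ofReal (((d : ℝ) + 1) / d)) := Real.HolderConjugate.ennrealOfReal hpq
    exact hfaL.integrable_mul hfML
  have hholder : ∫ t, fa t * fM t ≤
      A ^ (1 / ((d : ℝ) + 1)) * (D * S₀) ^ ((d : ℝ) / ((d : ℝ) + 1)) := by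
    refine (integral_mul_le_Lp_mul_Lq_of_nonneg hpq (Filter.Eventually.of_forall hfa0)
      (Filter.Eventually.of_forall hfM0) hfaL hfML).trans ?_
    simp_rw [ea, eM]
    rw [haA, one_div_div]
    refine mul_le_mul_of_nonneg_left ?_ (by positivity)
    exact Real.rpow_le_rpow (integral_nonneg hM0) hMD (by positivity)
  -- The slice estimate needs a positive upper bound for the mass.
  have main : ∀ S, 0 < S → S₀ ≤ S → |∫ x, G x * h x| ≤
      C * D ^ ((d : ℝ) / ((d : ℝ) + 1)) * S * A ^ (1 / ((d : ℝ) + 1)) := by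
    intro S hS hSS
    have h1 : |∫ x, G x * h x| ≤ ∫ t, C * S ^ (1 / ((d : ℝ) + 1)) * (fa t * fM t) := by
      rw [Measure.volume_eq_prod, integral_prod _ hGh, ← Real.norm_eq_abs]
      refine norm_integral_le_of_norm_le (hprodi.const_mul _) ?_
      filter_upwards [hGi.prod_right_ae, hAi.prod_right_ae] with t ht1 ht2
      refine (hC g hgc hgi hdiv S hS (hS₀.trans hSS) _ (hh.slice t) t ht1).trans ?_
      have h3 := energy_slice_le hh t ht2
      have h4 := energy_nonneg (fun y => h (t, y))
      have h5 := hfM0 t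
      refine mul_le_mul_of_nonneg_left ?_ (by positivity)
      exact mul_le_mul_of_nonneg_right (Real.rpow_le_rpow h4 h3 (by positivity)) h5
    refine h1.trans ?_
    rw [integral_const_mul]
    have e1 : (D * S) ^ ((d : ℝ) / ((d : ℝ) + 1)) =
        D ^ ((d : ℝ) / ((d : ℝ) + 1)) * S ^ ((d : ℝ) / ((d : ℝ) + 1)) :=
      Real.mul_rpow hD0 hS.le
    have e2 : S ^ (1 / ((d : ℝ) + 1)) * S ^ ((d : ℝ) / ((d : ℝ) + 1)) = S := by
      rw [← Real.rpow_add hS, ← add_div, add_comm, div_self hd1.ne', Real.rpow_one]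
    have hDS : (D * S₀) ^ ((d : ℝ) / ((d : ℝ) + 1)) ≤ (D * S) ^ ((d : ℝ) / ((d : ℝ) + 1)) :=
      Real.rpow_le_rpow ((integral_nonneg hM0).trans hMD) (by gcongr) (by positivity)
    calc C * S ^ (1 / ((d : ℝ) + 1)) * ∫ t, fa t * fM t
        ≤ C * S ^ (1 / ((d : ℝ) + 1)) *
          (A ^ (1 / ((d : ℝ) + 1)) * (D * S) ^ ((d : ℝ) / ((d : ℝ) + 1))) := by
          refine mul_le_mul_of_nonneg_left (hholder.trans ?_) (by positivity)
          exact mul_le_mul_of_nonneg_left hDS (by positivity)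
      _ = C * D ^ ((d : ℝ) / ((d : ℝ) + 1)) *
          (S ^ (1 / ((d : ℝ) + 1)) * S ^ ((d : ℝ) / ((d : ℝ) + 1))) *
            A ^ (1 / ((d : ℝ) + 1)) := by rw [e1]; ring
      _ = _ := by rw [e2]
  have hS₀0 : 0 ≤ S₀ := le_trans (by positivity) hS₀
  have hlim : Filter.Tendsto
      (fun S => C * D ^ ((d : ℝ) / ((d : ℝ) + 1)) * S * A ^ (1 / ((d : ℝ) + 1)))
      (nhdsWithin S₀ (Set.Ioi S₀))
      (nhds (C * D ^ ((d : ℝ) / ((d : ℝ) + 1)) * S₀ * A ^ (1 / ((d : ℝ) + 1)))) := by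
    refine Filter.Tendsto.mono_left (Continuous.tendsto ?_ S₀) nhdsWithin_le_nhds
    fun_prop
  refine ge_of_tendsto hlim ?_
  filter_upwards [self_mem_nhdsWithin] with S hS
  exact main S (hS₀0.trans_lt hS) (le_of_lt hS)

end Slicing

/-! ### Mollification -/

section Mollification

variable {X : Type*} [NormedAddCommGroup X] [NormedSpace ℝ X] [FiniteDimensional ℝ X]
  [MeasureSpace X]

/-- The mollification of `f` by the normalised bump function `b`. -/
def mollify (b : ContDiffBump (0 : X)) (f : X → ℝ) (x : X) : ℝ :=
  ∫ z, b.normed volume z * f (x - z)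

lemma mollify_eq_convolution (b : ContDiffBump (0 : X)) (f : X → ℝ) :
    mollify b f =
      convolution (b.normed volume) f (ContinuousLinearMap.lsmul ℝ ℝ) volume := rfl

variable [BorelSpace X] [(volume : Measure X).IsAddHaarMeasure]

variable {f g : X → ℝ} (b : ContDiffBump (0 : X))

lemma contDiff_mollify (hf : LocallyIntegrable f) : ContDiff ℝ ∞ (mollify b f) := by
  rw [mollify_eq_convolution]
  exact b.hasCompactSupport_normed.contDiff_convolution_left _ b.contDiff_normed hf

lemma integrable_mollify (hf : Integrable f) : Integrable (mollify b f) :=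
  b.integrable_normed.integrable_convolution (ContinuousLinearMap.lsmul ℝ ℝ) hf

lemma integral_abs_mollify_le (hf : Integrable f) : ∫ x, |mollify b f x| ≤ ∫ x, |f x| := by
  have h1 : ∫ x, mollify b (fun x => |f x|) x = ∫ x, |f x| := by
    rw [mollify_eq_convolution, integral_convolution _ b.integrable_normed hf.abs,
      b.integral_normed]
    simp
  rw [← h1]
  refine integral_mono_of_nonneg (Filter.Eventually.of_forall fun x => abs_nonneg _)
    (integrable_mollify b hf.abs) (Filter.Eventually.of_forall fun x => ?_)
  refine (abs_integral_le_integral_abs).trans_eq ?_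
  refine integral_congr_ae (Filter.Eventually.of_forall fun z => ?_)
  simp only [abs_mul, abs_of_nonneg (b.nonneg_normed z)]

/-- Pairing with a mollification averages the pairings with translates. -/
lemma integral_mollify_mul {ψ : X → ℝ} (hf : Integrable f) (hψ : IsTestFn ψ) :
    ∫ x, mollify b f x * ψ x = ∫ z, b.normed volume z * ∫ x, f x * ψ (x + z) := by
  obtain ⟨c, -, hc⟩ := hψ.bounded
  have hi : Integrable (fun p : X × X => (b.normed volume p.2 * f (p.1 - p.2)) * ψ p.1)
      (volume.prod volume) :=
    integrable_mul_of_bounded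
      (b.integrable_normed.convolution_integrand (ContinuousLinearMap.lsmul ℝ ℝ) hf)
      (hψ.1.continuous.comp continuous_fst).aestronglyMeasurable fun p => hc p.1
  calc ∫ x, mollify b f x * ψ x = ∫ x, ∫ z, (b.normed volume z * f (x - z)) * ψ x := by
        simp_rw [integral_mul_const]; rfl
    _ = ∫ z, ∫ x, (b.normed volume z * f (x - z)) * ψ x := integral_integral_swap hi
    _ = _ := by
        congr 1; funext z
        simp_rw [mul_assoc]
        rw [integral_const_mul,
          ← integral_add_right_eq_self (fun x => f (x - z) * ψ x) z]
        simp

lemma IsDivFree.mollify {ι : Type*} [Fintype ι] {V : ι → List X} {g : ι → X → ℝ}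
    (h : IsDivFree V g) (hg : ∀ i, Integrable (g i)) :
    IsDivFree V fun i => mollify b (g i) := by
  intro ψ hψ
  simp_rw [integral_mollify_mul b (hg _) (hψ.dirDs _)]
  have hc : ∀ i, Continuous fun z => ∫ x, g i x * dirDs (V i) ψ (x + z) := fun i => by
    obtain ⟨c, -, hc⟩ := (hψ.dirDs (V i)).bounded
    have hcont := (hψ.dirDs (V i)).1.continuous
    refine continuous_of_dominated (bound := fun x => |g i x| * c) (fun z =>
      (hg i).aestronglyMeasurable.mul (hcont.comp (by fun_prop)).aestronglyMeasurable)
      (fun z => Filter.Eventually.of_forall fun x => ?_) ((hg i).abs.mul_const c)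
      (Filter.Eventually.of_forall fun x => by fun_prop)
    rw [norm_mul]
    exact mul_le_mul_of_nonneg_left (hc _) (abs_nonneg _)
  have hi : ∀ i, Integrable fun z =>
      b.normed volume z * ∫ x, g i x * dirDs (V i) ψ (x + z) := fun i =>
    Continuous.integrable_of_hasCompactSupport (b.continuous_normed.mul (hc i))
      b.hasCompactSupport_normed.mul_right
  rw [← integral_finsetSum _ fun i _ => hi i]
  refine integral_eq_zero_of_ae (Filter.Eventually.of_forall fun z => ?_)
  have := h _ (hψ.comp_add z)
  simp_rw [dirDs_comp_add] at this
  simp only [← Finset.mul_sum, this, mul_zero, Pi.zero_apply]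

variable (X) in
/-- A sequence of bump functions that shrinks to the origin. -/
def bumpSeq (j : ℕ) : ContDiffBump (0 : X) :=
  ⟨1 / ((j : ℝ) + 1) / 2, 1 / ((j : ℝ) + 1), by positivity, half_lt_self (by positivity)⟩

lemma tendsto_integral_mollify_mul {ψ : X → ℝ} (hf : Integrable f) (hψ : IsTestFn ψ) :
    Filter.Tendsto (fun j => ∫ x, mollify (bumpSeq X j) f x * ψ x) Filter.atTop
      (nhds (∫ x, f x * ψ x)) := by
  have hc : Continuous fun z => ∫ x, f x * ψ (x - z) := by
    obtain ⟨c, -, hc⟩ := hψ.bounded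
    have hcont := hψ.1.continuous
    refine continuous_of_dominated (bound := fun x => |f x| * c) (fun z =>
      hf.aestronglyMeasurable.mul (hcont.comp (by fun_prop)).aestronglyMeasurable)
      (fun z => Filter.Eventually.of_forall fun x => ?_) (hf.abs.mul_const c)
      (Filter.Eventually.of_forall fun x => by fun_prop)
    rw [norm_mul]
    exact mul_le_mul_of_nonneg_left (hc _) (abs_nonneg _)
  have := ContDiffBump.convolution_tendsto_right_of_continuous (μ := volume)
    (φ := bumpSeq X) tendsto_one_div_add_atTop_nhds_zero_nat hc 0
  simp only [sub_zero] at this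
  refine this.congr fun j => ?_
  rw [integral_mollify_mul _ hf hψ]
  simp [convolution_def]

end Mollification

section Slicing

variable {d : ℕ} {ι : Type*} [Fintype ι]

instance : (volume : Measure (ℝ × (Fin d → ℝ))).IsAddHaarMeasure :=
  inferInstanceAs (Measure.IsAddHaarMeasure (volume.prod volume))

/-- The duality estimate for the normal part of an integrable field, tested with smooth
functions. -/
theorem exists_abs_integral_normalPart_le (hd : 1 ≤ d) {k : ℕ} (hk : k ≠ 0)
    (V : ι → List (ℝ × (Fin d → ℝ))) (hV : ∀ i, (V i).length = k) :
    ∃ C, 0 ≤ C ∧ ∀ g : ι → ℝ × (Fin d → ℝ) → ℝ, (∀ i, Integrable (g i)) → IsDivFree V g →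
      ∀ h, IsTestFn h →
        |∫ x, normalPart V g x * h x| ≤ C * (∑ i, ∫ x, |g i x|) *
          (∫ x, ‖fderiv ℝ h x‖ ^ ((d : ℝ) + 1)) ^ (1 / ((d : ℝ) + 1)) := by
  obtain ⟨C, hC0, hC⟩ := exists_abs_integral_normalPart_le_of_continuous hd hk V hV
  refine ⟨C, hC0, fun g hg hdiv h hh => ?_⟩
  have e : ∀ g : ι → ℝ × (Fin d → ℝ) → ℝ, (∀ i, Integrable (g i)) →
      ∫ x, normalPart V g x * h x = ∑ i, ((V i).map Prod.fst).prod * ∫ x, g i x * h x := by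
    intro g hg
    obtain ⟨c, -, hc⟩ := hh.bounded
    simp_rw [normalPart, Finset.sum_mul, mul_assoc]
    rw [integral_finsetSum _ fun i _ => (integrable_mul_of_bounded (hg i)
      hh.1.continuous.aestronglyMeasurable hc).const_mul _]
    simp_rw [integral_const_mul]
  have hlim : Filter.Tendsto (fun j => ∫ x,
      normalPart V (fun i => mollify (bumpSeq (ℝ × (Fin d → ℝ)) j) (g i)) x * h x) Filter.atTop
      (nhds (∫ x, normalPart V g x * h x)) := by
    simp_rw [e g hg, e _ fun i => integrable_mollify _ (hg i)]
    exact tendsto_finsetSum _ fun i _ =>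
      (tendsto_integral_mollify_mul (hg i) hh).const_mul _
  refine le_of_tendsto hlim.abs (Filter.Eventually.of_forall fun j => ?_)
  exact hC _ (fun i => (contDiff_mollify _ (hg i).locallyIntegrable).continuous)
    (fun i => integrable_mollify _ (hg i)) (hdiv.mollify _ hg) _
    (Finset.sum_le_sum fun i _ => integral_abs_mollify_le _ (hg i)) h hh

end Slicing

/-! ### Iterated partial derivatives as directional derivatives -/

section MultiIndices

variable {n : ℕ}

/-- The list of coordinate directions in which `multiD β` differentiates. -/
def directions (β : Fin n → ℕ) : List (E n) :=
  (List.finRange n).flatMap fun t => List.replicate (β t) (EuclideanSpace.single t 1)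

lemma multiD_eq_dirDs (β : Fin n → ℕ) (f : E n → ℝ) : multiD β f = dirDs (directions β) f := by
  have hrep : ∀ (m : ℕ) (t : Fin n) (g : E n → ℝ),
      dirDs (List.replicate m (EuclideanSpace.single t 1)) g = (partialD t)^[m] g := by
    intro m t g
    induction m with
    | zero => rfl
    | succ m ih =>
      rw [List.replicate_succ, dirDs_cons, ih, Function.iterate_succ_apply']
      rfl
  unfold multiD directions
  induction List.finRange n with
  | nil => rfl
  | cons t l ih => rw [List.foldr_cons, List.flatMap_cons, dirDs_append, ← ih, hrep]

lemma length_directions (β : Fin n → ℕ) : (directions β).length = ∑ t, β t := by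
  simp [directions, List.length_flatMap, Fin.sum_univ_def]

lemma prod_map_directions (β : Fin n → ℕ) (f : E n → ℝ) :
    ((directions β).map f).prod = ∏ t, f (EuclideanSpace.single t 1) ^ β t := by
  rw [directions, List.map_flatMap, Fin.prod_univ_def]
  induction List.finRange n with
  | nil => rfl
  | cons t l ih =>
    rw [List.flatMap_cons, List.prod_append, ih, List.map_replicate, List.prod_replicate,
      List.map_cons, List.prod_cons]

lemma directions_single (t : Fin n) :
    directions (Pi.single t 1) = [(EuclideanSpace.single t 1 : E n)] := by
  have h : ∀ l : List (Fin n), l.Nodup → l.flatMap (fun s => List.replicate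
      ((Pi.single t 1 : Fin n → ℕ) s) (EuclideanSpace.single s 1 : E n)) =
      if t ∈ l then [(EuclideanSpace.single t 1 : E n)] else [] := by
    intro l hl
    induction l with
    | nil => rfl
    | cons s l ih =>
      rw [List.nodup_cons] at hl
      rw [List.flatMap_cons, ih hl.2]
      by_cases hs : s = t
      · subst hs
        simp [hl.1]
      · simp [hs, Ne.symm hs]
  rw [directions, h _ (List.nodup_finRange n), if_pos (List.mem_finRange t)]

lemma isTestFn_multiD {φ : E n → ℝ} (hφ : IsTestFn φ) (β : Fin n → ℕ) :
    IsTestFn (multiD β φ) := by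
  rw [multiD_eq_dirDs]; exact hφ.dirDs _

end MultiIndices

/-! ### Slicing along the hyperplanes orthogonal to a given direction -/

section Shear

variable {d : ℕ}

/-- The linear coordinates `x ↦ (w · x, (x₂, …, xₙ))` on `ℝⁿ`, for `w` with first entry `1`. -/
def shear (w : Fin (d + 1) → ℝ) (hw : w 0 = 1) : E (d + 1) ≃L[ℝ] ℝ × (Fin d → ℝ) :=
  LinearEquiv.toContinuousLinearEquiv
    { toFun := fun x => (∑ j, w j * x j, fun i => x i.succ)
      map_add' := fun x y => by
        ext <;> simp [mul_add, Finset.sum_add_distrib]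
      map_smul' := fun c x => by
        ext
        · simp [Finset.mul_sum, mul_left_comm]
        · simp
      invFun := fun p => WithLp.toLp 2 (Fin.cons (p.1 - ∑ i, w i.succ * p.2 i) p.2)
      left_inv := fun x => by
        ext j
        refine Fin.cases ?_ (fun i => ?_) j
        · simp [Fin.sum_univ_succ, hw]
        · simp
      right_inv := fun p => by
        ext
        · simp [Fin.sum_univ_succ, hw]
        · simp }

lemma shear_apply_fst (w : Fin (d + 1) → ℝ) (hw : w 0 = 1) (x : E (d + 1)) :
    (shear w hw x).1 = ∑ j, w j * x j := rfl

/-- A linear change of variables scales integrals by a constant. -/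
lemma exists_integral_comp_continuousLinearEquiv {X X' : Type*} [NormedAddCommGroup X]
    [NormedSpace ℝ X] [FiniteDimensional ℝ X] [MeasureSpace X] [BorelSpace X]
    [(volume : Measure X).IsAddHaarMeasure] [NormedAddCommGroup X'] [NormedSpace ℝ X']
    [FiniteDimensional ℝ X'] [MeasureSpace X'] [BorelSpace X']
    [(volume : Measure X').IsAddHaarMeasure] (e : X ≃L[ℝ] X') :
    ∃ c : ℝ, 0 < c ∧ (∀ F : X' → ℝ, ∫ x, F (e x) = c * ∫ y, F y) ∧
      ∀ F : X → ℝ, Integrable F → Integrable fun y => F (e.symm y) := by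
  have hH : (Measure.map e (volume : Measure X)).IsAddHaarMeasure :=
    e.isAddHaarMeasure_map _
  have hc := Measure.isAddLeftInvariant_eq_smul
    (Measure.map e (volume : Measure X)) (volume : Measure X')
  set c := Measure.addHaarScalarFactor (Measure.map e (volume : Measure X))
    (volume : Measure X')
  have hc0 : 0 < c := Measure.addHaarScalarFactor_pos_of_isAddHaarMeasure _ _
  have hme : MeasurableEmbedding e := e.toHomeomorph.measurableEmbedding
  refine ⟨c, hc0, fun F => ?_, fun F hF => ?_⟩
  · rw [← hme.integral_map, hc, integral_smul_nnreal_measure]; rfl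
  · have h1 : Integrable (fun y => F (e.symm y)) (Measure.map e volume) := by
      rw [hme.integrable_map_iff]
      simpa [Function.comp_def] using hF
    rw [hc] at h1
    exact (integrable_smul_measure (by simpa using hc0.ne') ENNReal.coe_ne_top).1 h1

lemma IsTestFn.comp_equiv {X X' : Type*} [NormedAddCommGroup X] [NormedSpace ℝ X]
    [NormedAddCommGroup X'] [NormedSpace ℝ X'] {ψ : X' → ℝ} (hψ : IsTestFn ψ) (e : X ≃L[ℝ] X') :
    IsTestFn fun x => ψ (e x) :=
  ⟨hψ.1.comp e.contDiff, hψ.2.comp_homeomorph e.toHomeomorph⟩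

/-- The duality estimate for the component `∑_α w^α g_α` of the field normal to the hyperplanes
`w · x = t`. -/
lemma exists_abs_integral_monomial_le (hd : 1 ≤ d) {k : ℕ} (hk : k ≠ 0) (w : Fin (d + 1) → ℝ)
    (hw : w 0 = 1) :
    ∃ C, 0 ≤ C ∧ ∀ g : MultiIndex (d + 1) k → E (d + 1) → ℝ, (∀ α, Integrable (g α)) →
      (∀ φ, IsTestFn φ → ∑ α, ∫ x, g α x * multiD α.toFun φ x = 0) →
      ∀ h, IsTestFn h →
        |∑ α : MultiIndex (d + 1) k, (∏ t, w t ^ α.toFun t) * ∫ x, g α x * h x| ≤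
          C * ((∑ α, ∫ x, |g α x|) *
            (∫ x, ‖fderiv ℝ h x‖ ^ ((d : ℝ) + 1)) ^ (1 / ((d : ℝ) + 1))) := by
  set e := shear w hw with he
  obtain ⟨c, hc, hcF, hcI⟩ := exists_integral_comp_continuousLinearEquiv e
  -- The sheared coordinate directions; their first entries are the `w t`.
  set V : MultiIndex (d + 1) k → List (ℝ × (Fin d → ℝ)) := fun α =>
    (directions α.toFun).map e with hV
  have hVl : ∀ α, (V α).length = k := fun α => by
    rw [hV, List.length_map, length_directions]; exact α.2
  have hVp : ∀ α : MultiIndex (d + 1) k,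
      ((V α).map Prod.fst).prod = ∏ t, w t ^ α.toFun t := fun α => by
    rw [hV, List.map_map, prod_map_directions]
    refine Finset.prod_congr rfl fun t _ => ?_
    simp only [Function.comp_apply, he, shear_apply_fst]
    congr 1
    rw [Finset.sum_eq_single t] <;> simp +contextual
  obtain ⟨C, hC0, hC⟩ := exists_abs_integral_normalPart_le hd hk V hVl
  set N := ‖(e.symm : ℝ × (Fin d → ℝ) →L[ℝ] E (d + 1))‖ with hN
  have hd1 : (0 : ℝ) < (d : ℝ) + 1 := by positivity
  refine ⟨C * (N * c⁻¹ ^ (1 / ((d : ℝ) + 1))), by positivity, fun g hg hdiv h hh => ?_⟩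
  have hcF' : ∀ F : E (d + 1) → ℝ, ∫ y, F (e.symm y) = c⁻¹ * ∫ x, F x := fun F => by
    have := hcF fun y => F (e.symm y)
    simp only [ContinuousLinearEquiv.symm_apply_apply] at this
    rw [this, inv_mul_cancel_left₀ hc.ne']
  set g' : MultiIndex (d + 1) k → ℝ × (Fin d → ℝ) → ℝ := fun α y => g α (e.symm y) with hg'
  have hg'i : ∀ α, Integrable (g' α) := fun α => hcI _ (hg α)
  have hdiv' : IsDivFree V g' := by
    intro ψ hψ
    have h1 := hdiv _ (hψ.comp_equiv e)
    have h2 : ∀ α : MultiIndex (d + 1) k, ∫ x, g α x * multiD α.toFun (fun x => ψ (e x)) x =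
        c * ∫ y, g' α y * dirDs (V α) ψ y := by
      intro α
      rw [← hcF, multiD_eq_dirDs]
      have := dirDs_comp (e : E (d + 1) →L[ℝ] ℝ × (Fin d → ℝ)) (directions α.toFun) hψ.1
      simp only [ContinuousLinearEquiv.coe_coe] at this
      rw [this]
      simp only [hg', ContinuousLinearEquiv.symm_apply_apply]
      rfl
    simp_rw [h2] at h1
    rw [← Finset.mul_sum] at h1
    exact (mul_eq_zero.1 h1).resolve_left hc.ne'
  have key := hC g' hg'i hdiv' _ (hh.comp_equiv e.symm)
  obtain ⟨B, -, hB⟩ := hh.bounded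
  have e1 : ∫ y, normalPart V g' y * h (e.symm y) =
      c⁻¹ * ∑ α : MultiIndex (d + 1) k, (∏ t, w t ^ α.toFun t) * ∫ x, g α x * h x := by
    simp_rw [normalPart, hVp, Finset.sum_mul, mul_assoc]
    rw [hcF' fun x => ∑ α : MultiIndex (d + 1) k, (∏ t, w t ^ α.toFun t) * (g α x * h x),
      integral_finsetSum _ fun α _ => (integrable_mul_of_bounded (hg α)
        hh.1.continuous.aestronglyMeasurable hB).const_mul _]
    simp_rw [integral_const_mul]
  have e2 : ∑ α, ∫ y, |g' α y| = c⁻¹ * ∑ α, ∫ x, |g α x| := by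
    rw [Finset.mul_sum]
    exact Finset.sum_congr rfl fun α _ => hcF' fun x => |g α x|
  have e3 : ∫ y, ‖fderiv ℝ (fun y => h (e.symm y)) y‖ ^ ((d : ℝ) + 1) ≤
      N ^ ((d : ℝ) + 1) * (c⁻¹ * ∫ x, ‖fderiv ℝ h x‖ ^ ((d : ℝ) + 1)) := by
    rw [← hcF' fun x => ‖fderiv ℝ h x‖ ^ ((d : ℝ) + 1), ← integral_const_mul]
    refine integral_mono ((hh.comp_equiv e.symm).integrable_norm_fderiv_rpow hd1)
      ((hcI _ (hh.integrable_norm_fderiv_rpow hd1)).const_mul _) fun y => ?_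
    have h1 : HasFDerivAt (fun y => h (e.symm y)) ((fderiv ℝ h (e.symm y)).comp
        (e.symm : ℝ × (Fin d → ℝ) →L[ℝ] E (d + 1))) y :=
      (hh.differentiable (e.symm y)).hasFDerivAt.comp y e.symm.hasFDerivAt
    rw [h1.fderiv, ← Real.mul_rpow (norm_nonneg _) (norm_nonneg _), mul_comm N]
    exact Real.rpow_le_rpow (norm_nonneg _) (ContinuousLinearMap.opNorm_comp_le _ _) hd1.le
  rw [e1, e2, abs_mul, abs_of_pos (inv_pos.2 hc)] at key
  set A := ∫ x, ‖fderiv ℝ h x‖ ^ ((d : ℝ) + 1) with hA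
  have hA0 : 0 ≤ A := by positivity
  have e4 : (∫ y, ‖fderiv ℝ (fun y => h (e.symm y)) y‖ ^ ((d : ℝ) + 1)) ^ (1 / ((d : ℝ) + 1)) ≤
      N * (c⁻¹ ^ (1 / ((d : ℝ) + 1)) * A ^ (1 / ((d : ℝ) + 1))) := by
    refine (Real.rpow_le_rpow (integral_nonneg fun y => by positivity) e3 (by positivity)).trans_eq ?_
    rw [Real.mul_rpow (by positivity) (by positivity), Real.mul_rpow (by positivity) hA0,
      ← Real.rpow_mul (by positivity), mul_one_div_cancel hd1.ne', Real.rpow_one]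
  have key2 := key.trans (mul_le_mul_of_nonneg_left e4
    (mul_nonneg hC0 (mul_nonneg (inv_pos.2 hc).le
      (Finset.sum_nonneg fun α _ => integral_nonneg fun x => abs_nonneg _))))
  have key3 : c⁻¹ * |∑ α : MultiIndex (d + 1) k, (∏ t, w t ^ α.toFun t) * ∫ x, g α x * h x| ≤
      c⁻¹ * (C * (N * c⁻¹ ^ (1 / ((d : ℝ) + 1))) * ((∑ α, ∫ x, |g α x|) *
        A ^ (1 / ((d : ℝ) + 1)))) := key2.trans_eq (by ring)
  exact le_of_mul_le_mul_left key3 (inv_pos.2 hc)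

end Shear

/-! ### From monomials to components -/

section Span

lemma MultiIndex.toFun_injective {n k : ℕ} :
    Function.Injective (MultiIndex.toFun : MultiIndex n k → Fin n → ℕ) := fun α β h => by
  apply Subtype.ext
  funext t
  exact Fin.ext (congrFun h t)

/-- The vectors of all monomials of degree `k`, evaluated at points of the affine hyperplane
`w₀ = 1`, span: a homogeneous polynomial vanishing there is zero. -/
lemma span_monomials_eq_top (d k : ℕ) :
    Submodule.span ℝ {v : MultiIndex (d + 1) k → ℝ | ∃ w : Fin (d + 1) → ℝ, w 0 = 1 ∧
      v = fun α => ∏ t, w t ^ α.toFun t} = ⊤ := by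
  by_contra hne
  obtain ⟨f, hf0, hf⟩ := Submodule.exists_le_ker_of_lt_top _ (lt_top_iff_ne_top.2 hne)
  have hfsum : ∀ v, f v = ∑ α, v α * f (Pi.single α 1) := fun v => by
    conv_lhs => rw [pi_eq_sum_univ' v, map_sum]
    simp
  set p : MvPolynomial (Fin (d + 1)) ℝ := ∑ α : MultiIndex (d + 1) k,
    MvPolynomial.monomial (Finsupp.equivFunOnFinite.symm α.toFun) (f (Pi.single α 1)) with hp
  have hpe : ∀ x : Fin (d + 1) → ℝ, MvPolynomial.eval x p =
      ∑ α : MultiIndex (d + 1) k, (∏ t, x t ^ α.toFun t) * f (Pi.single α 1) := fun x => by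
    rw [hp, map_sum]
    refine Finset.sum_congr rfl fun α _ => ?_
    rw [MvPolynomial.eval_monomial, mul_comm, Finsupp.prod_fintype _ _ (by simp)]
    rfl
  -- Multiplying by `X 0` takes care of the points with `x 0 = 0`, which cannot be rescaled to
  -- `w 0 = 1`.
  have hpX : p * MvPolynomial.X 0 = 0 := by
    refine MvPolynomial.funext fun x => ?_
    rw [map_mul, MvPolynomial.eval_X, map_zero]
    by_cases hx : x 0 = 0
    · rw [hx, mul_zero]
    -- Homogeneity: `p x = x 0 ^ k * p (x / x 0)`.
    have h1 : f (fun α => ∏ t, (x t / x 0) ^ α.toFun t) = 0 :=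
      hf (Submodule.subset_span ⟨fun t => x t / x 0, div_self hx, rfl⟩)
    have h2 : MvPolynomial.eval x p = x 0 ^ k * f (fun α => ∏ t, (x t / x 0) ^ α.toFun t) := by
      rw [hpe, hfsum, Finset.mul_sum]
      refine Finset.sum_congr rfl fun α _ => ?_
      have hα : x 0 ^ k = ∏ t, x 0 ^ α.toFun t := by
        rw [Finset.prod_pow_eq_pow_sum]
        congr 1
        exact α.2.symm
      rw [← mul_assoc, hα, ← Finset.prod_mul_distrib]
      congr 1
      refine Finset.prod_congr rfl fun t _ => ?_
      rw [← mul_pow, mul_div_cancel₀ _ hx]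
    rw [h2, h1, mul_zero, zero_mul]
  have hp0 : p = 0 := (mul_eq_zero.1 hpX).resolve_right (MvPolynomial.X_ne_zero 0)
  refine hf0 (LinearMap.ext fun v => ?_)
  rw [hfsum, LinearMap.zero_apply]
  refine Finset.sum_eq_zero fun α _ => ?_
  have hcoef : p.coeff (Finsupp.equivFunOnFinite.symm α.toFun) = f (Pi.single α 1) := by
    rw [hp, MvPolynomial.coeff_sum, Finset.sum_eq_single α]
    · simp
    · intro β _ hβ
      rw [MvPolynomial.coeff_monomial, if_neg]
      intro h
      exact hβ (MultiIndex.toFun_injective (Finsupp.equivFunOnFinite.symm.injective h))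
    · simp
  rw [← hcoef, hp0, MvPolynomial.coeff_zero, mul_zero]

/-- The duality estimate for every component of the field, tested with smooth functions. -/
theorem exists_abs_integral_component_le {d : ℕ} (hd : 1 ≤ d) {k : ℕ} (hk : k ≠ 0) :
    ∃ C, 0 ≤ C ∧ ∀ g : MultiIndex (d + 1) k → E (d + 1) → ℝ, (∀ α, Integrable (g α)) →
      (∀ φ, IsTestFn φ → ∑ α, ∫ x, g α x * multiD α.toFun φ x = 0) →
      ∀ h, IsTestFn h → ∀ α, |∫ x, g α x * h x| ≤ C * ((∑ α, ∫ x, |g α x|) *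
        (∫ x, ‖fderiv ℝ h x‖ ^ ((d : ℝ) + 1)) ^ (1 / ((d : ℝ) + 1))) := by
  have key : ∀ v : MultiIndex (d + 1) k → ℝ,
      ∃ C, 0 ≤ C ∧ ∀ g : MultiIndex (d + 1) k → E (d + 1) → ℝ, (∀ α, Integrable (g α)) →
      (∀ φ, IsTestFn φ → ∑ α, ∫ x, g α x * multiD α.toFun φ x = 0) →
      ∀ h, IsTestFn h → |∑ α, v α * ∫ x, g α x * h x| ≤ C * ((∑ α, ∫ x, |g α x|) *
        (∫ x, ‖fderiv ℝ h x‖ ^ ((d : ℝ) + 1)) ^ (1 / ((d : ℝ) + 1))) := by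
    intro v
    have hv : v ∈ (⊤ : Submodule ℝ (MultiIndex (d + 1) k → ℝ)) := Submodule.mem_top
    rw [← span_monomials_eq_top] at hv
    induction hv using Submodule.span_induction with
    | mem v hv =>
      obtain ⟨w, hw, rfl⟩ := hv
      exact exists_abs_integral_monomial_le hd hk w hw
    | zero => exact ⟨0, le_rfl, fun g _ _ h _ => by simp⟩
    | add u v _ _ hu hv =>
      obtain ⟨C₁, h₁, H₁⟩ := hu
      obtain ⟨C₂, h₂, H₂⟩ := hv
      refine ⟨C₁ + C₂, by positivity, fun g hg hdiv h hh => ?_⟩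
      simp_rw [Pi.add_apply, add_mul, Finset.sum_add_distrib]
      exact (abs_add_le _ _).trans (add_le_add (H₁ g hg hdiv h hh) (H₂ g hg hdiv h hh))
    | smul c v _ hv =>
      obtain ⟨C, h₁, H⟩ := hv
      refine ⟨|c| * C, by positivity, fun g hg hdiv h hh => ?_⟩
      simp_rw [Pi.smul_apply, smul_eq_mul, mul_assoc, ← Finset.mul_sum, abs_mul]
      exact mul_le_mul_of_nonneg_left (H g hg hdiv h hh) (abs_nonneg _)
  choose C hC0 hC using fun α => key (Pi.single α 1)
  refine ⟨∑ α, C α, Finset.sum_nonneg fun α _ => hC0 α, fun g hg hdiv h hh α => ?_⟩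
  have h1 := hC α g hg hdiv h hh
  rw [Finset.sum_eq_single α (fun β _ hβ => by rw [Pi.single_eq_of_ne hβ, zero_mul]) (by simp),
    Pi.single_eq_same, one_mul] at h1
  refine h1.trans (mul_le_mul_of_nonneg_right
    (Finset.single_le_sum (fun α _ => hC0 α) (Finset.mem_univ α)) ?_)
  exact mul_nonneg (Finset.sum_nonneg fun α _ => integral_nonneg fun x => abs_nonneg _)
    (by positivity)

end Span

/-! ### Smooth approximation of bounded Sobolev functions -/

section Sobolev

variable {n : ℕ}

/-- Mollification does not increase Lᵖ norms: Jensen's inequality for the probability measure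
with the mollifier as density. -/
lemma eLpNorm_mollify_le (b : ContDiffBump (0 : E n)) {f : E n → ℝ}
    (hf : AEStronglyMeasurable f volume) {p : ℝ≥0∞} (hp1 : 1 ≤ p) (hp : p ≠ ⊤) :
    eLpNorm (mollify b f) p volume ≤ eLpNorm f p volume := by
  -- Passing to a measurable representative gives joint measurability of `f (x - z)`.
  wlog hm : StronglyMeasurable f generalizing f
  · have e1 : mollify b f = mollify b (hf.mk f) := by
      funext x
      refine integral_congr_ae ?_
      have hq := (quasiMeasurePreserving_sub_left_of_right_invariant
        (volume : Measure (E n)) x).ae_eq_comp hf.ae_eq_mk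
      filter_upwards [hq] with z hz
      simp only [Function.comp_apply] at hz
      rw [hz]
    rw [e1, eLpNorm_congr_ae hf.ae_eq_mk]
    exact this hf.stronglyMeasurable_mk.aestronglyMeasurable hf.stronglyMeasurable_mk
  have hp0 : p ≠ 0 := (zero_lt_one.trans_le hp1).ne'
  have hpr : 0 < p.toReal := ENNReal.toReal_pos hp0 hp
  set ρ := b.normed (volume : Measure (E n)) with hρ
  have hρm : Measurable fun z => ENNReal.ofReal (ρ z) :=
    ENNReal.measurable_ofReal.comp b.continuous_normed.measurable
  set ν := (volume : Measure (E n)).withDensity fun z => ENNReal.ofReal (ρ z) with hν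
  have hν1 : ν Set.univ = 1 := by
    rw [hν, withDensity_apply _ MeasurableSet.univ, Measure.restrict_univ,
      ← ofReal_integral_eq_lintegral_ofReal b.integrable_normed
        (Filter.Eventually.of_forall b.nonneg_normed), b.integral_normed, ENNReal.ofReal_one]
  have : IsProbabilityMeasure ν := ⟨hν1⟩
  have hpt : ∀ x, ‖mollify b f x‖ₑ ≤ eLpNorm (fun z => f (x - z)) p ν := by
    intro x
    have hfx : StronglyMeasurable fun z => f (x - z) :=
      hm.comp_measurable (measurable_const.sub measurable_id)
    refine le_trans ?_ (eLpNorm_le_eLpNorm_of_exponent_le hp1 hfx.aestronglyMeasurable)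
    rw [eLpNorm_one_eq_lintegral_enorm, hν,
      lintegral_withDensity_eq_lintegral_mul _ hρm hfx.enorm]
    refine (enorm_integral_le_lintegral_enorm _).trans_eq (lintegral_congr fun z => ?_)
    rw [enorm_mul, Pi.mul_apply, Real.enorm_of_nonneg (b.nonneg_normed z)]
  rw [eLpNorm_eq_lintegral_rpow_enorm_toReal hp0 hp, eLpNorm_eq_lintegral_rpow_enorm_toReal hp0 hp]
  refine ENNReal.rpow_le_rpow ?_ (by positivity)
  calc ∫⁻ x, ‖mollify b f x‖ₑ ^ p.toReal
      ≤ ∫⁻ x, ∫⁻ z, ‖f (x - z)‖ₑ ^ p.toReal ∂ν := by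
        refine lintegral_mono fun x => ?_
        refine (ENNReal.rpow_le_rpow (hpt x) hpr.le).trans_eq ?_
        rw [eLpNorm_eq_lintegral_rpow_enorm_toReal hp0 hp, ← ENNReal.rpow_mul,
          one_div_mul_cancel hpr.ne', ENNReal.rpow_one]
    _ = ∫⁻ z, (∫⁻ x, ‖f (x - z)‖ₑ ^ p.toReal) ∂ν := by
        refine lintegral_lintegral_swap (Measurable.aemeasurable ?_)
        exact (hm.comp_measurable (measurable_fst.sub measurable_snd)).enorm.pow_const _
    _ = ∫⁻ z, (∫⁻ x, ‖f x‖ₑ ^ p.toReal) ∂ν := by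
        refine lintegral_congr fun z => ?_
        exact lintegral_sub_right_eq_self (fun x => ‖f x‖ₑ ^ p.toReal) z
    _ = ∫⁻ x, ‖f x‖ₑ ^ p.toReal := by rw [lintegral_const, hν1, mul_one]

lemma abs_mollify_le (b : ContDiffBump (0 : E n)) {f : E n → ℝ} {M : ℝ}
    (hM : ∀ᵐ x, |f x| ≤ M) (x : E n) : |mollify b f x| ≤ M := by
  have h1 : ∀ᵐ z, ‖b.normed volume z * f (x - z)‖ ≤ b.normed volume z * M := by
    filter_upwards [(quasiMeasurePreserving_sub_left_of_right_invariant
      (volume : Measure (E n)) x).ae hM] with z hz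
    rw [norm_mul, Real.norm_of_nonneg (b.nonneg_normed z)]
    exact mul_le_mul_of_nonneg_left hz (b.nonneg_normed z)
  have h2 := norm_integral_le_of_norm_le (b.integrable_normed.mul_const M) h1
  rwa [integral_mul_const, b.integral_normed, one_mul] at h2

lemma multiD_single (t : Fin n) (φ : E n → ℝ) :
    multiD (Pi.single t 1) φ = dirD (EuclideanSpace.single t 1) φ := by
  rw [multiD_eq_dirDs, directions_single]; rfl

/-- The derivative of a mollification is the mollification of the weak derivative. -/
lemma dirD_mollify (b : ContDiffBump (0 : E n)) {f g : E n → ℝ} {t : Fin n}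
    (h : IsWeakDeriv (Pi.single t 1) f g) (x : E n) :
    dirD (EuclideanSpace.single t 1) (mollify b f) x = mollify b g x := by
  obtain ⟨hf, hg, hφ⟩ := h
  set v : E n := EuclideanSpace.single t 1 with hv
  set ρ := b.normed (volume : Measure (E n)) with hρ
  have hρt : IsTestFn ρ := ⟨b.contDiff_normed, b.hasCompactSupport_normed⟩
  have hder := HasCompactSupport.hasFDerivAt_convolution_left (μ := (volume : Measure (E n)))
    (f := ρ) (g := f) (ContinuousLinearMap.lsmul ℝ ℝ) hρt.2 (b.contDiff_normed (n := 1)) hf x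
  have hφt : IsTest fun z => ρ (x - z) := by
    refine ⟨hρt.1.comp (contDiff_const.sub contDiff_id), ?_⟩
    exact hρt.2.comp_homeomorph (Homeomorph.subLeft x)
  have hφd : ∀ z, multiD (Pi.single t 1) (fun z => ρ (x - z)) z = - fderiv ℝ ρ (x - z) v := by
    intro z
    rw [multiD_single]
    have h1 : HasFDerivAt (fun z => ρ (x - z))
        ((fderiv ℝ ρ (x - z)).comp (-ContinuousLinearMap.id ℝ (E n))) z :=
      (hρt.differentiable (x - z)).hasFDerivAt.comp z ((hasFDerivAt_id z).const_sub x)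
    simp [dirD, h1.fderiv, hv]
  have e1 := hφ _ hφt
  have hsum : ∑ s, (Pi.single t 1 : Fin n → ℕ) s = 1 := by simp
  rw [hsum] at e1
  have e2 : mollify b g x = ∫ z, g z * ρ (x - z) := by
    rw [mollify, ← integral_sub_left_eq_self (fun z => g z * ρ (x - z)) volume x]
    simp [mul_comm, hρ]
  rw [e2, e1, dirD, mollify_eq_convolution, hder.fderiv]
  have hex : ConvolutionExistsAt (fderiv ℝ ρ) f x
      ((ContinuousLinearMap.lsmul ℝ ℝ).precompL (E n)) volume :=
    (b.hasCompactSupport_normed.fderiv ℝ).convolutionExists_left _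
      (b.contDiff_normed.continuous_fderiv one_ne_zero) hf x
  rw [convolution_def, ContinuousLinearMap.integral_apply hex.integrable]
  simp_rw [hφd]
  rw [← integral_const_mul,
    ← integral_sub_left_eq_self (fun z => (-1) ^ 1 * (f z * -fderiv ℝ ρ (x - z) v)) volume x]
  refine integral_congr_ae (Filter.Eventually.of_forall fun z => ?_)
  simp [ContinuousLinearMap.precompL_apply, mul_comm, hρ]

lemma MemW.memLp_weakDeriv {p : ℝ≥0∞} {h : E n → ℝ} (hh : MemW 1 p h) (t : Fin n) :
    MemLp (weakDeriv (Pi.single t 1) h) p volume ∧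
      IsWeakDeriv (Pi.single t 1) h (weakDeriv (Pi.single t 1) h) := by
  obtain ⟨g, hgp, hg⟩ := hh.2 (Pi.single t 1) (by simp)
  have hex : ∃ g, IsWeakDeriv (Pi.single t 1) h g := ⟨g, hg⟩
  have hw : IsWeakDeriv (Pi.single t 1) h (weakDeriv (Pi.single t 1) h) := by
    rw [weakDeriv, dif_pos hex]; exact hex.choose_spec
  refine ⟨(memLp_congr_ae ?_).1 hgp, hw⟩
  refine ae_eq_of_integral_contDiff_smul_eq hg.2.1 hw.2.1 fun φ hφ hφc => ?_
  simp_rw [smul_eq_mul, mul_comm (φ _)]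
  rw [hg.2.2 φ ⟨hφ, hφc⟩, hw.2.2 φ ⟨hφ, hφc⟩]

lemma norm_fderiv_le_sum (h : E n → ℝ) (x : E n) :
    ‖fderiv ℝ h x‖ ≤ ∑ t, ‖dirD (EuclideanSpace.single t 1) h x‖ := by
  refine ContinuousLinearMap.opNorm_le_bound _ (by positivity) fun v => ?_
  have hv : v = ∑ t, v t • (EuclideanSpace.single t 1 : E n) := by
    ext s
    simp [Pi.single_apply]
  have h1 : fderiv ℝ h x v = ∑ t, v t * dirD (EuclideanSpace.single t 1) h x := by
    conv_lhs => rw [hv, map_sum]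
    simp [dirD]
  rw [h1, Finset.sum_mul]
  refine (norm_sum_le _ _).trans (Finset.sum_le_sum fun t _ => ?_)
  rw [norm_mul, mul_comm]
  exact mul_le_mul_of_nonneg_left (PiLp.norm_apply_le v t) (norm_nonneg _)

/-- The `L^(d+1)` norm of the gradient is bounded by those of the partial derivatives. -/
lemma gradNorm_le_sum {d : ℕ} {h : E n → ℝ} (hh : IsTestFn h) :
    (∫ x, ‖fderiv ℝ h x‖ ^ ((d : ℝ) + 1)) ^ (1 / ((d : ℝ) + 1)) ≤
      (∑ t, eLpNorm (dirD (EuclideanSpace.single t 1) h) ((d + 1 : ℕ) : ℝ≥0∞) volume).toReal := by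
  have hc : Continuous (fderiv ℝ h) := hh.1.continuous_fderiv (by simp)
  have hp0 : ((d + 1 : ℕ) : ℝ≥0∞) ≠ 0 := by simp
  have hpt : ((d + 1 : ℕ) : ℝ≥0∞) ≠ ⊤ := ENNReal.natCast_ne_top _
  have hm : MemLp (fderiv ℝ h) ((d + 1 : ℕ) : ℝ≥0∞) volume :=
    hc.memLp_of_hasCompactSupport (hh.2.fderiv ℝ)
  have hmt : ∀ t, MemLp (dirD (EuclideanSpace.single t 1) h) ((d + 1 : ℕ) : ℝ≥0∞) volume :=
    fun t => (hh.dirD _).1.continuous.memLp_of_hasCompactSupport (hh.dirD _).2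
  have e1 := hm.eLpNorm_eq_integral_rpow_norm hp0 hpt
  have e2 : (eLpNorm (fderiv ℝ h) ((d + 1 : ℕ) : ℝ≥0∞) volume).toReal =
      (∫ x, ‖fderiv ℝ h x‖ ^ ((d : ℝ) + 1)) ^ (1 / ((d : ℝ) + 1)) := by
    rw [e1, ENNReal.toReal_ofReal (by positivity), ENNReal.toReal_natCast, one_div]
    push_cast
    rfl
  rw [← e2]
  refine ENNReal.toReal_mono (ENNReal.sum_ne_top.2 fun t _ => (hmt t).2.ne) ?_
  calc eLpNorm (fderiv ℝ h) ((d + 1 : ℕ) : ℝ≥0∞) volume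
      ≤ eLpNorm (fun x => ∑ t, ‖dirD (EuclideanSpace.single t 1) h x‖)
          ((d + 1 : ℕ) : ℝ≥0∞) volume := by
        refine eLpNorm_mono fun x => (norm_fderiv_le_sum h x).trans (le_abs_self _)
    _ ≤ ∑ t, eLpNorm (fun x => ‖dirD (EuclideanSpace.single t 1) h x‖)
          ((d + 1 : ℕ) : ℝ≥0∞) volume := by
        have := eLpNorm_sum_le (μ := volume) (p := ((d + 1 : ℕ) : ℝ≥0∞)) (s := Finset.univ)
          (f := fun t x => ‖dirD (EuclideanSpace.single t 1) h x‖)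
          (fun t _ => (hmt t).1.norm) (by simp)
        refine le_trans (le_of_eq ?_) this
        congr 1; funext x; simp
    _ = _ := by simp_rw [eLpNorm_norm]

/-- A bounded Sobolev function is an almost everywhere limit of uniformly bounded test functions
whose gradients are asymptotically no larger than its own. -/
lemma exists_isTestFn_approx {p : ℝ≥0∞} (hp1 : 1 ≤ p) (hp : p ≠ ⊤) {h : E n → ℝ}
    (hb : MemLp h ∞ volume) (hh : MemW 1 p h) :
    ∃ (H : ℕ → E n → ℝ) (M K : ℝ), (∀ j, IsTestFn (H j)) ∧ (∀ j x, |H j x| ≤ M) ∧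
      (∀ᵐ x, Filter.Tendsto (fun j => H j x) Filter.atTop (nhds (h x))) ∧
      ∀ j t, (eLpNorm (dirD (EuclideanSpace.single t 1) (H j)) p volume).toReal ≤
        (eLpNorm (weakDeriv (Pi.single t 1) h) p volume).toReal + K / ((j : ℝ) + 1) := by
  set M := (eLpNorm h ∞ volume).toReal with hM
  have hM0 : 0 ≤ M := ENNReal.toReal_nonneg
  have hMae : ∀ᵐ x, |h x| ≤ M := by
    have h1 : eLpNorm h ∞ volume ≠ ⊤ := hb.2.ne
    rw [eLpNorm_exponent_top] at h1
    filter_upwards [ae_le_eLpNormEssSup (f := h) (μ := volume)] with x hx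
    rw [hM, eLpNorm_exponent_top]
    have := ENNReal.toReal_mono h1 hx
    simpa using this
  have hloc : LocallyIntegrable h := hh.1.locallyIntegrable hp1
  let c : ContDiffBump (0 : E n) := ⟨1, 2, one_pos, one_lt_two⟩
  have hc : IsTestFn c := ⟨c.contDiff, c.hasCompactSupport⟩
  set a : ℕ → ℝ := fun j => ((j : ℝ) + 1)⁻¹ with ha
  have ha0 : ∀ j, 0 < a j := fun j => by positivity
  -- The cutoffs `χ j` have gradients of size `1 / (j + 1)`.
  set χ : ℕ → E n → ℝ := fun j x => c (a j • x) with hχ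
  have hχt : ∀ j, IsTestFn (χ j) := fun j =>
    ⟨hc.1.comp (contDiff_const_smul (a j)),
      hc.2.comp_homeomorph (Homeomorph.smulOfNeZero (a j) (ha0 j).ne')⟩
  have hχ1 : ∀ j x, |χ j x| ≤ 1 := fun j x => by
    rw [abs_of_nonneg c.nonneg]; exact c.le_one
  obtain ⟨D, hD0, hD⟩ := hc.bounded_fderiv
  have hχd : ∀ j t x, |dirD (EuclideanSpace.single t 1) (χ j) x| ≤ a j * D := by
    intro j t x
    have h1 : HasFDerivAt (χ j) ((fderiv ℝ c (a j • x)).comp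
        (a j • ContinuousLinearMap.id ℝ (E n))) x :=
      (hc.differentiable _).hasFDerivAt.comp x ((hasFDerivAt_id x).const_smul (a j))
    rw [dirD, h1.fderiv]
    simp only [ContinuousLinearMap.comp_apply, smul_apply, ContinuousLinearMap.id_apply, map_smul,
      smul_eq_mul, abs_mul, abs_of_pos (ha0 j)]
    refine mul_le_mul_of_nonneg_left ?_ (ha0 j).le
    refine ((fderiv ℝ c (a j • x)).le_opNorm _).trans ?_
    simpa using hD (a j • x)
  set b : ℕ → ContDiffBump (0 : E n) := bumpSeq (E n) with hbs
  have hms : ∀ j, ContDiff ℝ ∞ (mollify (b j) h) := fun j => contDiff_mollify _ hloc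
  have hH : ∀ j, IsTestFn fun x => χ j x * mollify (b j) h x := fun j => (hχt j).mul_right (hms j)
  refine ⟨fun j x => χ j x * mollify (b j) h x, M, D * (eLpNorm h p volume).toReal, hH,
    fun j x => ?_, ?_, fun j t => ?_⟩
  · rw [abs_mul]
    calc |χ j x| * |mollify (b j) h x| ≤ 1 * M := by
          gcongr
          · exact hχ1 j x
          · exact abs_mollify_le _ hMae x
      _ = M := one_mul M
  · filter_upwards [ContDiffBump.ae_convolution_tendsto_right_of_locallyIntegrable (K := 2)
      (φ := b) (l := Filter.atTop) tendsto_one_div_add_atTop_nhds_zero_nat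
      (Filter.Eventually.of_forall fun j => by simp only [hbs, bumpSeq]; linarith) hloc] with x hx
    have h1 : Filter.Tendsto (fun j => χ j x) Filter.atTop (nhds 1) := by
      have h2 : Filter.Tendsto (fun j => a j • x) Filter.atTop (nhds ((0 : ℝ) • x)) := by
        refine Filter.Tendsto.smul_const ?_ x
        simpa [ha] using tendsto_one_div_add_atTop_nhds_zero_nat (𝕜 := ℝ)
      have h3 := (hc.1.continuous.tendsto _).comp h2
      rw [zero_smul] at h3
      have h4 : c (0 : E n) = 1 := c.one_of_mem_closedBall (by simp [c])
      rwa [h4] at h3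
    have h5 := h1.mul hx
    rwa [one_mul] at h5
  · obtain ⟨hwp, hw⟩ := hh.memLp_weakDeriv t
    set v : E n := EuclideanSpace.single t 1 with hv
    -- The second term, in which the cutoff is differentiated, accounts for `K / (j + 1)`.
    have e1 : dirD v (fun x => χ j x * mollify (b j) h x) = (fun x =>
        χ j x * mollify (b j) (weakDeriv (Pi.single t 1) h) x) +
          fun x => dirD v (χ j) x * mollify (b j) h x := by
      funext x
      have h1 := ((hχt j).differentiable x).hasFDerivAt.mul
        ((hms j).differentiable (by simp) x).hasFDerivAt
      have h2 : fderiv ℝ (fun x => χ j x * mollify (b j) h x) x = _ := h1.fderiv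
      have h3 := dirD_mollify (b j) hw x
      rw [dirD] at h3
      rw [dirD, h2, Pi.add_apply, ← h3]
      simp only [add_apply, smul_apply, smul_eq_mul, dirD, hv]
      ring
    have hmw : ContDiff ℝ ∞ (mollify (b j) (weakDeriv (Pi.single t 1) h)) :=
      contDiff_mollify _ hw.2.1
    have n1 : eLpNorm (fun x => χ j x * mollify (b j) (weakDeriv (Pi.single t 1) h) x) p volume ≤
        eLpNorm (weakDeriv (Pi.single t 1) h) p volume := by
      refine le_trans (eLpNorm_mono fun x => ?_) (eLpNorm_mollify_le (b j) hwp.1 hp1 hp)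
      rw [norm_mul]
      exact mul_le_of_le_one_left (norm_nonneg _) (hχ1 j x)
    have n2 : eLpNorm (fun x => dirD v (χ j) x * mollify (b j) h x) p volume ≤
        ENNReal.ofReal (a j * D) * eLpNorm h p volume := by
      refine le_trans (eLpNorm_le_mul_eLpNorm_of_ae_le_mul
        (Filter.Eventually.of_forall fun x => ?_) p)
        (mul_le_mul_right (eLpNorm_mollify_le (b j) hh.1.1 hp1 hp) _)
      rw [norm_mul]
      exact mul_le_mul_of_nonneg_right (hχd j t x) (norm_nonneg _)
    have n3 := (eLpNorm_add_le (p := p) (μ := volume)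
      (((hχt j).1.mul hmw).continuous.aestronglyMeasurable)
      ((((hχt j).dirD v).1.mul (hms j)).continuous.aestronglyMeasurable) hp1).trans
        (add_le_add n1 n2)
    rw [e1]
    have hfin2 : ENNReal.ofReal (a j * D) * eLpNorm h p volume ≠ ⊤ :=
      ENNReal.mul_ne_top ENNReal.ofReal_ne_top hh.1.2.ne
    refine (ENNReal.toReal_mono (ENNReal.add_ne_top.2 ⟨hwp.2.ne, hfin2⟩) n3).trans_eq ?_
    rw [ENNReal.toReal_add hwp.2.ne hfin2, ENNReal.toReal_mul,
      ENNReal.toReal_ofReal (mul_nonneg (ha0 j).le hD0)]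
    simp only [ha]
    ring

end Sobolev

/-! ### The divergence duality theorem -/

section Duality

variable {n : ℕ}

lemma memLp_sqrt_sum_sq {ι : Type*} [Fintype ι] {p : ℝ≥0∞} {f : ι → E n → ℝ}
    (hf : ∀ j, MemLp (f j) p volume) : MemLp (fun x => √(∑ j, f j x ^ 2)) p volume := by
  have h1 : MemLp (fun x => ∑ j, ‖f j x‖) p volume :=
    memLp_finsetSum _ fun j _ => (hf j).norm
  refine h1.mono ?_ (Filter.Eventually.of_forall fun x => ?_)
  · refine Continuous.comp_aestronglyMeasurable Real.continuous_sqrt ?_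
    have := Finset.aestronglyMeasurable_fun_sum (μ := (volume : Measure (E n))) Finset.univ
      (f := fun j x => f j x ^ 2) fun j _ => (hf j).1.pow 2
    exact this
  · rw [Real.norm_of_nonneg (Real.sqrt_nonneg _), Real.norm_of_nonneg (by positivity)]
    refine Real.sqrt_le_iff.2 ⟨by positivity, ?_⟩
    calc ∑ j, f j x ^ 2 = ∑ j, ‖f j x‖ ^ 2 := by simp
      _ ≤ (∑ j, ‖f j x‖) ^ 2 := Finset.sum_sq_le_sq_sum_of_nonneg fun j _ => norm_nonneg _

lemma toReal_eLpNorm_le_vecNorm {ι : Type*} [Fintype ι] {p : ℝ≥0∞} {f : ι → E n → ℝ}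
    (hf : ∀ j, MemLp (f j) p volume) (j : ι) :
    (eLpNorm (f j) p volume).toReal ≤ vecNorm p f := by
  refine ENNReal.toReal_mono (memLp_sqrt_sum_sq hf).2.ne (eLpNorm_mono fun x => ?_)
  rw [Real.norm_of_nonneg (Real.sqrt_nonneg _)]
  refine Real.le_sqrt_of_sq_le ?_
  rw [Real.norm_eq_abs, sq_abs]
  exact Finset.single_le_sum (f := fun j => f j x ^ 2) (fun j _ => sq_nonneg _) (Finset.mem_univ j)

lemma vecNorm_nonneg {ι : Type*} [Fintype ι] (p : ℝ≥0∞) (f : ι → E n → ℝ) : 0 ≤ vecNorm p f :=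
  ENNReal.toReal_nonneg

lemma integral_abs_eq_toReal_eLpNorm {f : E n → ℝ} (hf : MemLp f 1 volume) :
    ∫ x, |f x| = (eLpNorm f 1 volume).toReal := by
  rw [eLpNorm_one_eq_lintegral_enorm]
  exact integral_norm_eq_lintegral_enorm hf.1

/-- **Van Schaftingen's theorem**: the `k`-th order divergence `L¹`-duality estimate. -/
theorem exists_divergenceDuality {n k : ℕ} (hn : 2 ≤ n) (hk : 1 ≤ k) :
    ∃ C, 0 ≤ C ∧ DivergenceDuality n k C := by
  obtain ⟨d, rfl⟩ : ∃ d, n = d + 1 := ⟨n - 1, by omega⟩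
  obtain ⟨C, hC0, hC⟩ := exists_abs_integral_component_le (d := d) (by omega) (k := k) (by omega)
  set m : ℝ := ((Fintype.card (MultiIndex (d + 1) k) : ℕ) : ℝ) with hm
  refine ⟨C * (m * (d + 1 : ℕ)), by positivity, fun g hg hdiv h hb hh α => ?_⟩
  have hgi : ∀ α, Integrable (g α) := fun α => memLp_one_iff_integrable.1 (hg α)
  have hdiv' : ∀ φ, IsTestFn φ → ∑ α, ∫ x, g α x * multiD α.toFun φ x = 0 := by
    intro φ hφ
    have := hdiv φ hφ
    rw [← Finset.mul_sum] at this
    exact (mul_eq_zero.1 this).resolve_left (by positivity)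
  set S := ∑ α, ∫ x, |g α x| with hS
  have hS0 : 0 ≤ S := Finset.sum_nonneg fun α _ => integral_nonneg fun x => abs_nonneg _
  have hSg : S ≤ m * vecNorm 1 g := by
    rw [hS, hm, ← nsmul_eq_mul]
    refine Finset.sum_le_card_nsmul _ _ _ fun β _ => ?_
    rw [integral_abs_eq_toReal_eLpNorm (hg β)]
    exact toReal_eLpNorm_le_vecNorm hg β
  have hp1 : (1 : ℝ≥0∞) ≤ ((d + 1 : ℕ) : ℝ≥0∞) := by simp
  obtain ⟨H, M, K, hHt, hHM, hHl, hHd⟩ := exists_isTestFn_approx hp1 (ENNReal.natCast_ne_top _)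
    (hb α) (hh α)
  have hgrad : ∀ t, (eLpNorm (weakDeriv (Pi.single t 1) (h α)) ((d + 1 : ℕ) : ℝ≥0∞)
      volume).toReal ≤ vecGradNorm ((d + 1 : ℕ) : ℝ≥0∞) h := fun t =>
    toReal_eLpNorm_le_vecNorm (f := fun (jt : MultiIndex (d + 1) k × Fin (d + 1)) =>
      weakDeriv (Pi.single jt.2 1) (h jt.1)) (fun jt => ((hh jt.1).memLp_weakDeriv jt.2).1) (α, t)
  set Γ := vecGradNorm ((d + 1 : ℕ) : ℝ≥0∞) h with hΓ
  have hΓ0 : 0 ≤ Γ := vecNorm_nonneg _ _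
  have hj : ∀ j : ℕ, |∫ x, g α x * H j x| ≤
      C * (S * ((d + 1 : ℕ) * (Γ + K / ((j : ℝ) + 1)))) := by
    intro j
    refine (hC g hgi hdiv' (H j) (hHt j) α).trans ?_
    refine mul_le_mul_of_nonneg_left (mul_le_mul_of_nonneg_left ?_ hS0) hC0
    refine (gradNorm_le_sum (hHt j)).trans ?_
    have hfin : ∀ t, eLpNorm (dirD (EuclideanSpace.single t 1) (H j))
        ((d + 1 : ℕ) : ℝ≥0∞) volume ≠ ⊤ := fun t =>
      (((hHt j).dirD _).1.continuous.memLp_of_hasCompactSupport ((hHt j).dirD _).2).2.ne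
    rw [ENNReal.toReal_sum fun t _ => hfin t]
    refine (Finset.sum_le_card_nsmul _ _ (Γ + K / ((j : ℝ) + 1)) fun t _ => ?_).trans_eq ?_
    · exact (hHd j t).trans (add_le_add_left (hgrad t) _)
    · simp only [Finset.card_univ, Fintype.card_fin, nsmul_eq_mul]
  have hlim1 : Filter.Tendsto (fun j => ∫ x, g α x * H j x) Filter.atTop
      (nhds (∫ x, g α x * h α x)) := by
    refine tendsto_integral_of_dominated_convergence (fun x => |g α x| * M)
      (fun j => (hg α).1.mul (hHt j).1.continuous.aestronglyMeasurable)
      ((hgi α).abs.mul_const M) (fun j => Filter.Eventually.of_forall fun x => ?_) ?_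
    · rw [norm_mul]
      exact mul_le_mul_of_nonneg_left (hHM j x) (abs_nonneg _)
    · filter_upwards [hHl] with x hx
      exact hx.const_mul _
  have hlim2 : Filter.Tendsto (fun j : ℕ => C * (S * ((d + 1 : ℕ) * (Γ + K / ((j : ℝ) + 1)))))
      Filter.atTop (nhds (C * (S * ((d + 1 : ℕ) * (Γ + 0))))) := by
    refine Filter.Tendsto.const_mul _ (Filter.Tendsto.const_mul _ (Filter.Tendsto.const_mul _
      (tendsto_const_nhds.add ?_)))
    have := (tendsto_one_div_add_atTop_nhds_zero_nat (𝕜 := ℝ)).const_mul K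
    simpa [div_eq_mul_inv] using this
  refine (le_of_tendsto_of_tendsto' hlim1.abs hlim2 hj).trans ?_
  rw [add_zero]
  calc C * (S * ((d + 1 : ℕ) * Γ)) ≤ C * ((m * vecNorm 1 g) * ((d + 1 : ℕ) * Γ)) := by gcongr
    _ = _ := by ring

end Duality

/-! ### Signs, complementary labels and the Hodge star -/

section Signs

variable {N a c q ℓ : ℕ}

lemma exists_perm_of_eps_ne_zero {A : Fin a → Fin N} {C : Fin c → Fin N} (h : eps A C ≠ 0) :
    ∃ hca : c = a, ∃ σ : Equiv.Perm (Fin c), (fun j => A (Fin.cast hca (σ j))) = C := by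
  unfold eps at h
  split_ifs at h with hca
  · refine ⟨hca, ?_⟩
    by_contra hne
    push Not at hne
    exact h (Finset.sum_eq_zero fun σ _ => if_neg (hne σ))
  · exact absurd rfl h

/-- If `C` has no repetitions, the sum that defines `ε^A_C` has a single nonzero term. -/
lemma eps_eq_sign {A : Fin a → Fin N} {C : Fin c → Fin N} (hC : Function.Injective C)
    (hca : c = a) (σ : Equiv.Perm (Fin c)) (hσ : (fun j => A (Fin.cast hca (σ j))) = C) :
    eps A C = Equiv.Perm.sign σ := by
  subst hca
  unfold eps
  rw [dif_pos rfl, Finset.sum_eq_single σ]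
  · rw [if_pos hσ]
  · intro τ _ hτ
    rw [if_neg]
    intro h
    refine hτ (Equiv.ext fun j => ?_)
    -- `A` is injective because `C = A ∘ σ` is
    have hA : Function.Injective A := by
      intro x y hxy
      have := @hC (σ.symm x) (σ.symm y) (by rw [← hσ]; simpa using hxy)
      simpa using this
    exact hA (by simpa using congrFun (h.trans hσ.symm) j)
  · simp

lemma eps_eq_one_or_neg_one {A : Fin a → Fin N} {C : Fin c → Fin N}
    (hC : Function.Injective C) (h : eps A C ≠ 0) : eps A C = 1 ∨ eps A C = -1 := by
  obtain ⟨hca, σ, hσ⟩ := exists_perm_of_eps_ne_zero h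
  rw [eps_eq_sign hC hca σ hσ]
  rcases Int.units_eq_one_or (Equiv.Perm.sign σ) with h | h <;> simp [h]

lemma injective_of_eps_ne_zero {A : Fin a → Fin N} {C : Fin c → Fin N}
    (hC : Function.Injective C) (h : eps A C ≠ 0) :
    Function.Injective A ∧ Set.range A = Set.range C := by
  obtain ⟨rfl, σ, rfl⟩ := exists_perm_of_eps_ne_zero h
  refine ⟨fun x y hxy => ?_, ?_⟩
  · have := @hC (σ.symm x) (σ.symm y) (by simpa using hxy)
    simpa using this
  · exact (σ.surjective.range_comp A).symm

lemma eps_ne_zero {A : Fin a → Fin N} {C : Fin c → Fin N} (hca : c = a)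
    (hA : Function.Injective A) (hC : Function.Injective C) (h : Set.range A = Set.range C) :
    eps A C ≠ 0 := by
  subst hca
  have hex : ∀ j, ∃ i, A i = C j := fun j => by
    have : C j ∈ Set.range A := h ▸ Set.mem_range_self j
    exact this
  choose f hf using hex
  have hinj : Function.Injective f := fun x y hxy => hC (by rw [← hf, ← hf, hxy])
  rw [eps_eq_sign hC rfl (Equiv.ofBijective f (Finite.injective_iff_bijective.1 hinj))
    (funext hf)]
  simp

lemma range_append (J : Fin a → Fin N) (I : Fin c → Fin N) :
    Set.range (Fin.append J I) = Set.range J ∪ Set.range I := by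
  ext x
  constructor
  · rintro ⟨i, rfl⟩
    refine Fin.addCases (fun i => ?_) (fun i => ?_) i
    · exact Or.inl ⟨i, (Fin.append_left J I i).symm⟩
    · exact Or.inr ⟨i, (Fin.append_right J I i).symm⟩
  · rintro (⟨i, rfl⟩ | ⟨i, rfl⟩)
    · exact ⟨_, Fin.append_left J I i⟩
    · exact ⟨_, Fin.append_right J I i⟩

lemma disjoint_of_injective_append {J : Fin a → Fin N} {I : Fin c → Fin N}
    (h : Function.Injective (Fin.append J I)) : Disjoint (Set.range J) (Set.range I) := by
  rw [Set.disjoint_left]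
  rintro _ ⟨i, rfl⟩ ⟨j, hj⟩
  have := @h (Fin.natAdd a j) (Fin.castAdd c i) (by simpa using hj)
  have h2 := congrArg Fin.val this
  simp at h2
  omega

lemma injective_append {J : Fin a → Fin N} {I : Fin c → Fin N} (hJ : Function.Injective J)
    (hI : Function.Injective I) (h : Disjoint (Set.range J) (Set.range I)) :
    Function.Injective (Fin.append J I) := by
  rw [Fin.append_injective_iff]
  refine ⟨hJ, hI, fun i j hij => ?_⟩
  exact Set.disjoint_left.1 h (Set.mem_range_self i) ⟨j, hij.symm⟩

/-- In `ε^{JI}_L` the label `I` is determined by `J` and `L`. -/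
lemma eps_append_right_unique {J : Label N a} {I I' : Label N q} {L : Fin c → Fin N}
    (hL : Function.Injective L) (h : eps (Fin.append J I) L ≠ 0)
    (h' : eps (Fin.append J I') L ≠ 0) : I = I' := by
  obtain ⟨h1, h2⟩ := injective_of_eps_ne_zero hL h
  obtain ⟨h1', h2'⟩ := injective_of_eps_ne_zero hL h'
  rw [range_append] at h2 h2'
  have e : ∀ {K : Label N q}, Disjoint (Set.range J) (Set.range K) →
      Set.range J ∪ Set.range K = Set.range L → Set.range K = Set.range L \ Set.range J := by
    intro K hd hu
    rw [← hu, Set.union_sdiff_left, hd.symm.sdiff_eq_left]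
  rw [← OrderEmbedding.range_inj, e (disjoint_of_injective_append h1) h2,
    e (disjoint_of_injective_append h1') h2']

/-- In `ε^{IJ}_L` the label `I` is determined by `J` and `L`. -/
lemma eps_append_left_unique {J : Label N a} {I I' : Label N q} {L : Fin c → Fin N}
    (hL : Function.Injective L) (h : eps (Fin.append I J) L ≠ 0)
    (h' : eps (Fin.append I' J) L ≠ 0) : I = I' := by
  obtain ⟨h1, h2⟩ := injective_of_eps_ne_zero hL h
  obtain ⟨h1', h2'⟩ := injective_of_eps_ne_zero hL h'
  rw [range_append] at h2 h2'
  have e : ∀ {K : Label N q}, Disjoint (Set.range K) (Set.range J) →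
      Set.range K ∪ Set.range J = Set.range L → Set.range K = Set.range L \ Set.range J := by
    intro K hd hu
    rw [← hu, Set.union_sdiff_right, hd.sdiff_eq_left]
  rw [← OrderEmbedding.range_inj, e (disjoint_of_injective_append h1) h2,
    e (disjoint_of_injective_append h1') h2']

lemma Label.le (I : Label N q) : q ≤ N := by
  simpa using Fintype.card_le_of_injective I I.injective

/-- There is a label of every length not exceeding `N - q` that is disjoint from `I`. -/
lemma exists_label_disjoint (I : Label N q) (h : q + ℓ ≤ N) :
    ∃ J : Label N ℓ, Disjoint (Set.range J) (Set.range I) := by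
  classical
  have hc : ((Finset.univ.image I)ᶜ : Finset (Fin N)).card = N - q := by
    rw [Finset.card_compl, Finset.card_image_of_injective _ I.injective]
    simp
  obtain ⟨s, hs, hs'⟩ := Finset.exists_subset_card_eq
    (s := (Finset.univ.image I)ᶜ) (n := ℓ) (by omega)
  refine ⟨s.orderEmbOfFin hs', ?_⟩
  rw [Finset.range_orderEmbOfFin, Set.disjoint_left]
  rintro x hx ⟨i, rfl⟩
  simpa using hs hx

/-- Every `I` occurs in some sign `ε^{JI}_L`, where `L` is the sorted union of `J` and `I`. -/
lemma exists_label_eps_ne_zero (I : Label N q) (h : q + ℓ ≤ N) :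
    ∃ (J : Label N ℓ) (L : Label N (ℓ + q)), eps (Fin.append J I) L ≠ 0 := by
  classical
  obtain ⟨J, hJ⟩ := exists_label_disjoint I h
  have hinj := injective_append J.injective I.injective hJ
  have hc : (Finset.univ.image (Fin.append J I)).card = ℓ + q := by
    rw [Finset.card_image_of_injective _ hinj]; simp
  refine ⟨J, (Finset.univ.image (Fin.append J I)).orderEmbOfFin hc,
    eps_ne_zero rfl hinj (RelEmbedding.injective _) ?_⟩
  rw [Finset.range_orderEmbOfFin]
  simp

lemma eps_append_id_ne_zero {I : Label N q} {J : Label N (N - q)}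
    (h : Disjoint (Set.range I) (Set.range J)) :
    eps (Fin.append I J) (id : Fin N → Fin N) ≠ 0 := by
  have hq := I.le
  have hinj := injective_append I.injective J.injective h
  refine eps_ne_zero (by omega) hinj Function.injective_id ?_
  rw [Set.range_id]
  refine Function.Surjective.range_eq ?_
  exact ((Fintype.bijective_iff_injective_and_card _).2 ⟨hinj, by simp; omega⟩).2

lemma exists_star_coeff (I : Label N q) :
    ∃ J : Label N (N - q), eps (Fin.append I J) (id : Fin N → Fin N) ≠ 0 := by
  have hq := I.le
  obtain ⟨J, hJ⟩ := exists_label_disjoint (ℓ := N - q) I (by omega)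
  exact ⟨J, eps_append_id_ne_zero hJ.symm⟩

lemma exists_star_coeff_left (hq : q ≤ N) (J : Label N (N - q)) :
    ∃ I : Label N q, eps (Fin.append I J) (id : Fin N → Fin N) ≠ 0 := by
  obtain ⟨I, hI⟩ := exists_label_disjoint (ℓ := q) J (by omega)
  exact ⟨I, eps_append_id_ne_zero hI⟩

lemma star_eq_of_eps_ne_zero {V : Type*} [AddCommGroup V] (F : Form N q V) {I : Label N q}
    {J : Label N (N - q)} (h : eps (Fin.append I J) (id : Fin N → Fin N) ≠ 0) :
    star F J = eps (Fin.append I J) (id : Fin N → Fin N) • F I := by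
  unfold star
  refine Finset.sum_eq_single I (fun I' _ hI' => ?_) (by simp)
  by_contra hne
  refine hI' (eps_append_left_unique Function.injective_id (fun h0 => hne ?_) h)
  rw [h0, zero_smul]

/-- The Hodge star is a signed permutation of the coefficients, described here by the
complement map `c` and the signs `s`. -/
lemma exists_star_eq (hq : q ≤ N) :
    ∃ (c : Label N (N - q) → Label N q) (s : Label N (N - q) → ℤ), Function.Surjective c ∧
      (∀ J, s J = 1 ∨ s J = -1) ∧
      ∀ {V : Type} [AddCommGroup V] (F : Form N q V) (J), star F J = s J • F (c J) := by
  choose c hc using fun J : Label N (N - q) => exists_star_coeff_left hq J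
  refine ⟨c, fun J => eps (Fin.append (c J) J) (id : Fin N → Fin N), fun I => ?_, fun J => ?_,
    fun F J => star_eq_of_eps_ne_zero F (hc J)⟩
  · obtain ⟨J, hJ⟩ := exists_star_coeff I
    exact ⟨J, eps_append_left_unique Function.injective_id (hc J) hJ⟩
  · exact eps_eq_one_or_neg_one Function.injective_id (hc J)

/-! ### The number of labels -/

/-- The binomial coefficients `binom N ℓ` with `0 < ℓ < N` are at least `N`. -/
lemma le_choose (h1 : 1 ≤ ℓ) (h2 : ℓ + 1 ≤ N) : N ≤ N.choose ℓ := by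
  induction N generalizing ℓ with
  | zero => omega
  | succ N ih =>
    obtain ⟨ℓ, rfl⟩ : ∃ j, ℓ = j + 1 := ⟨ℓ - 1, by omega⟩
    rw [Nat.choose_succ_succ']
    rcases Nat.lt_or_ge (ℓ + 1) N with h | h
    · have := ih (ℓ := ℓ + 1) (by omega) (by omega)
      have : 0 < N.choose ℓ := Nat.choose_pos (by omega)
      omega
    · obtain rfl : N = ℓ + 1 := by omega
      simp

lemma card_label_le {M : ℕ} (hq : q ≤ N) (hN : N ≤ M) (hM : 1 ≤ M) :
    Fintype.card (Label N q) ≤ M ^ M := by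
  calc Fintype.card (Label N q) ≤ Fintype.card (Fin q → Fin N) :=
        Fintype.card_le_of_injective _ DFunLike.coe_injective
    _ = N ^ q := by simp
    _ ≤ M ^ q := Nat.pow_le_pow_left hN q
    _ ≤ M ^ M := Nat.pow_le_pow_right hM (hq.trans hN)

end Signs

/-! ### Hybrid functions as functions on `ℝⁿ` -/

section Hybrid

variable {n N : ℕ}

lemma proj_incl (hN : n ≤ N) (x : E n) : proj n N (incl n N x) = x := by
  ext t
  simp [proj, incl, t.2.trans_le hN]

/-- `proj n N` as a continuous linear map. -/
def projL (n N : ℕ) : E N →L[ℝ] E n :=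
  LinearMap.toContinuousLinearMap
    { toFun := proj n N
      map_add' := fun z z' => by
        ext t
        by_cases h : (t : ℕ) < N <;> simp [proj, h]
      map_smul' := fun c z => by
        ext t
        by_cases h : (t : ℕ) < N <;> simp [proj, h] }

lemma projL_apply (z : E N) : projL n N z = proj n N z := rfl

lemma projL_single_castLE (hN : n ≤ N) (t : Fin n) :
    projL n N (EuclideanSpace.single (Fin.castLE hN t) 1) = EuclideanSpace.single t 1 := by
  ext s
  rw [projL_apply]
  simp [proj, s.2.trans_le hN, Fin.ext_iff]

lemma padIndex_castLE (hN : n ≤ N) (β : Fin n → ℕ) (t : Fin n) :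
    padIndex N β (Fin.castLE hN t) = β t := by
  simp [padIndex]

lemma padIndex_single (hN : n ≤ N) (t : Fin n) :
    padIndex N (Pi.single t 1) = Pi.single (Fin.castLE hN t) 1 := by
  funext s
  by_cases h : (s : ℕ) < n
  · simp [padIndex, h, Pi.single_apply, Fin.ext_iff]
  · have : s ≠ Fin.castLE hN t := fun e => h (by rw [e]; exact t.2)
    simp [padIndex, h, this]

lemma map_directions_padIndex (hN : n ≤ N) (β : Fin n → ℕ) :
    (directions (padIndex N β)).map (projL n N) = directions β := by
  obtain ⟨m, rfl⟩ := Nat.exists_eq_add_of_le hN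
  have hsplit : List.finRange (n + m) = (List.finRange n).map (Fin.castAdd m) ++
      (List.finRange m).map (Fin.natAdd n) := by
    simp only [← List.ofFn_id, List.map_ofFn]
    rw [List.ofFn_add]
    rfl
  -- The last `m` directions do not occur, and `projL` maps the first `n` to those of `ℝⁿ`.
  have h1 : ∀ t, padIndex (n + m) β (Fin.natAdd n t) = 0 := fun t => by simp [padIndex]
  unfold directions
  rw [hsplit, List.flatMap_append, List.map_append, List.flatMap_map, List.flatMap_map]
  simp only [h1, List.replicate_zero, List.map_flatMap, List.map_nil, List.map_replicate]
  have h2 : ∀ t : Fin n, padIndex (n + m) β (Fin.castAdd m t) = β t := padIndex_castLE hN β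
  have h3 : ∀ t : Fin n, projL n (n + m) (EuclideanSpace.single (Fin.castAdd m t) 1) =
    EuclideanSpace.single t 1 := projL_single_castLE hN
  simp [h2, h3]

lemma sum_padIndex (hN : n ≤ N) (β : Fin n → ℕ) : ∑ t, padIndex N β t = ∑ t, β t := by
  rw [← length_directions, ← length_directions, ← map_directions_padIndex hN β, List.length_map]

/-- The derivative `∂^{iβ}` of the hybrid extension of `φ` is the hybrid extension of `∂^β φ`. -/
lemma multiD_comp_proj (hN : n ≤ N) (β : Fin n → ℕ) {φ : E n → ℝ} (hφ : IsTest φ) :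
    multiD (padIndex N β) (φ ∘ proj n N) = multiD β φ ∘ proj n N := by
  rw [multiD_eq_dirDs, multiD_eq_dirDs, ← map_directions_padIndex hN β]
  exact dirDs_comp (projL n N) _ hφ.1

lemma comp_proj_comp_incl (hN : n ≤ N) (φ : E n → ℝ) : (φ ∘ proj n N) ∘ incl n N = φ := by
  funext x
  simp [proj_incl hN]

lemma isTestTilde_comp_proj (hN : n ≤ N) {φ : E n → ℝ} (hφ : IsTest φ) :
    IsTestTilde n (φ ∘ proj n N) := by
  refine ⟨?_, by rwa [comp_proj_comp_incl hN]⟩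
  funext z
  simp [proj_incl hN]

lemma pair₀_comp_proj (hN : n ≤ N) (F : E N → ℝ) (φ : E n → ℝ) :
    pair₀ n F (φ ∘ proj n N) = ∫ x, (F ∘ incl n N) x * φ x := by
  simp [pair₀, proj_incl hN]

lemma IsWeakDerivTilde.isWeakDeriv (hN : n ≤ N) {β : Fin n → ℕ} {F G : E N → ℝ}
    (h : IsWeakDerivTilde n (padIndex N β) F G) :
    IsWeakDeriv β (F ∘ incl n N) (G ∘ incl n N) := by
  obtain ⟨-, -, hF, hG, h⟩ := h
  refine ⟨hF, hG, fun φ hφ => ?_⟩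
  have := h _ (isTestTilde_comp_proj hN hφ)
  rwa [multiD_comp_proj hN β hφ, pair₀_comp_proj hN, pair₀_comp_proj hN, sum_padIndex hN] at this

lemma MemWtilde.memW (hN : n ≤ N) {a : ℕ} {p : ℝ≥0∞} {F : E N → ℝ} (h : MemWtilde n a p F) :
    MemW a p (F ∘ incl n N) := by
  refine ⟨h.1.2, fun β hβ => ?_⟩
  obtain ⟨G, hG, hw⟩ := h.2 (padIndex N β) (by rwa [sum_padIndex hN])
  exact ⟨_, hG.2, hw.isWeakDeriv hN⟩

/-- Distributional derivatives of hybrid functions are unique up to null sets of `ℝⁿ`; here the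
multi-index may involve any of the `N` variables. -/
lemma IsWeakDerivTilde.ae_eq (hN : n ≤ N) {β : Fin N → ℕ} {F G G' : E N → ℝ}
    (h : IsWeakDerivTilde n β F G) (h' : IsWeakDerivTilde n β F G') :
    G ∘ incl n N =ᵐ[volume] G' ∘ incl n N := by
  refine ae_eq_of_integral_contDiff_smul_eq h.2.2.2.1 h'.2.2.2.1 fun φ hφ hφc => ?_
  have hφt := isTestTilde_comp_proj hN ⟨hφ, hφc⟩
  simp_rw [smul_eq_mul, mul_comm (φ _)]
  rw [← pair₀_comp_proj hN, ← pair₀_comp_proj hN, h.2.2.2.2 _ hφt, h'.2.2.2.2 _ hφt]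

lemma MemWtilde.memLp_weakDerivTilde (hN : n ≤ N) {p : ℝ≥0∞} {F : E N → ℝ}
    (h : MemWtilde n 1 p F) (t : Fin N) :
    MemLp (weakDerivTilde n (Pi.single t 1) F ∘ incl n N) p volume ∧
      IsWeakDerivTilde n (Pi.single t 1) F (weakDerivTilde n (Pi.single t 1) F) := by
  obtain ⟨G, hG, hw⟩ := h.2 (Pi.single t 1) (by simp)
  have hex : ∃ G, IsWeakDerivTilde n (Pi.single t 1) F G := ⟨G, hw⟩
  have hw' : IsWeakDerivTilde n (Pi.single t 1) F (weakDerivTilde n (Pi.single t 1) F) := by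
    rw [weakDerivTilde, dif_pos hex]; exact hex.choose_spec
  exact ⟨(memLp_congr_ae (hw.ae_eq hN hw')).1 hG.2, hw'⟩

/-- The weak partial derivatives on `ℝⁿ` of the coefficients of a form are among the
entries of its gradient. -/
lemma toReal_eLpNorm_weakDeriv_le_gradNormTilde (hN : n ≤ N) {q : ℕ} {p : ℝ≥0∞}
    {H : Form N q (E N → ℝ)} (hH : ∀ I, MemWtilde n 1 p (H I)) (I : Label N q) (t : Fin n) :
    (eLpNorm (weakDeriv (Pi.single t 1) (H I ∘ incl n N)) p volume).toReal ≤
      gradNormTilde n p H := by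
  have hw := ((hH I).memLp_weakDerivTilde hN (Fin.castLE hN t)).2
  rw [← padIndex_single hN] at hw
  have hw1 := hw.isWeakDeriv hN
  have hw2 := (((hH I).memW hN).memLp_weakDeriv t).2
  have hae : weakDeriv (Pi.single t 1) (H I ∘ incl n N) =ᵐ[volume]
      weakDerivTilde n (padIndex N (Pi.single t 1)) (H I) ∘ incl n N := by
    refine ae_eq_of_integral_contDiff_smul_eq hw2.2.1 hw1.2.1 fun φ hφ hφc => ?_
    simp_rw [smul_eq_mul, mul_comm (φ _)]
    rw [hw1.2.2 φ ⟨hφ, hφc⟩, hw2.2.2 φ ⟨hφ, hφc⟩]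
  rw [eLpNorm_congr_ae hae, padIndex_single hN]
  exact toReal_eLpNorm_le_vecNorm (f := fun (It : Label N q × Fin N) =>
    weakDerivTilde n (Pi.single It.2 1) (H It.1) ∘ incl n N)
    (fun It => ((hH It.1).memLp_weakDerivTilde hN It.2).1) (I, Fin.castLE hN t)

end Hybrid

/-! ### The duality estimates for forms -/

section Forms

variable {n k ℓ N q : ℕ}

lemma vecNorm_le_sum {ι : Type*} [Fintype ι] {p : ℝ≥0∞} (hp : 1 ≤ p) {f : ι → E n → ℝ}
    (hf : ∀ j, MemLp (f j) p volume) :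
    vecNorm p f ≤ ∑ j, (eLpNorm (f j) p volume).toReal := by
  rw [← ENNReal.toReal_sum fun j _ => (hf j).2.ne]
  refine ENNReal.toReal_mono (ENNReal.sum_ne_top.2 fun j _ => (hf j).2.ne) ?_
  calc eLpNorm (fun x => √(∑ j, f j x ^ 2)) p volume
      ≤ eLpNorm (∑ j, fun x => ‖f j x‖) p volume := by
        refine eLpNorm_mono fun x => ?_
        rw [Finset.sum_apply, Real.norm_of_nonneg (Real.sqrt_nonneg _),
          Real.norm_of_nonneg (by positivity)]
        refine Real.sqrt_le_iff.2 ⟨by positivity, ?_⟩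
        calc ∑ j, f j x ^ 2 = ∑ j, ‖f j x‖ ^ 2 := by simp
          _ ≤ (∑ j, ‖f j x‖) ^ 2 := Finset.sum_sq_le_sq_sum_of_nonneg fun j _ => norm_nonneg _
    _ ≤ ∑ j, eLpNorm (fun x => ‖f j x‖) p volume :=
        eLpNorm_sum_le (fun j _ => (hf j).1.norm) hp
    _ = ∑ j, eLpNorm (f j) p volume := by simp_rw [eLpNorm_norm]

lemma toReal_eLpNorm_sum_le {ι : Type*} [Fintype ι] {p : ℝ≥0∞} (hp : 1 ≤ p) {f : ι → E n → ℝ}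
    (hf : ∀ j, MemLp (f j) p volume) {c : ι → ℝ} (hc : ∀ j, |c j| ≤ 1) :
    (eLpNorm (fun x => ∑ j, c j * f j x) p volume).toReal ≤
      ∑ j, (eLpNorm (f j) p volume).toReal := by
  rw [← ENNReal.toReal_sum fun j _ => (hf j).2.ne]
  refine ENNReal.toReal_mono (ENNReal.sum_ne_top.2 fun j _ => (hf j).2.ne) ?_
  have hsum : (fun x => ∑ j, c j * f j x) = ∑ j, fun x => c j * f j x := by
    funext x; rw [Finset.sum_apply]
  rw [hsum]
  refine (eLpNorm_sum_le (fun j _ => ((hf j).const_mul (c j)).1) hp).trans ?_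
  refine Finset.sum_le_sum fun j _ => eLpNorm_mono fun x => ?_
  rw [norm_mul]
  exact mul_le_of_le_one_left (norm_nonneg _) (hc j)

lemma abs_eps_le_one {a c : ℕ} {A : Fin a → Fin N} {C : Fin c → Fin N}
    (hC : Function.Injective C) : |(eps A C : ℝ)| ≤ 1 := by
  by_cases h : eps A C = 0
  · simp [h]
  · rcases eps_eq_one_or_neg_one hC h with h | h <;> simp [h]

/-- Evaluating the coefficient of `dz^L` of `T̃ F` on a test function gives the `k`-th order
divergence of the family `α ↦ ∑_I ε_L^{ℵ(iα) I} F_I`. -/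
lemma sum_integral_eq_zero_of_vanishesDist (hN : n ≤ N) (al : iS n k N ≃ Label N ℓ)
    {F : Form N q (E N → ℝ)} (hF : ∀ I, MemLtilde n 1 (F I))
    (hV : VanishesDist n (opT distD al fun I => toFunctional n (F I))) (L : Label N (ℓ + q))
    {φ : E n → ℝ} (hφ : IsTest φ) :
    ∑ α : MultiIndex n k, (-1 : ℝ) ^ k * ∫ x, (∑ I : Label N q, (eps (Fin.append (al (emb N α)) I) L : ℝ) *
      (F I ∘ incl n N) x) * multiD α.toFun φ x = 0 := by
  have hint : ∀ (α : MultiIndex n k) (I : Label N q),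
      Integrable (fun x => (F I ∘ incl n N) x * multiD α.toFun φ x) := by
    intro α I
    have ht : IsTestFn (multiD α.toFun φ) := isTestFn_multiD hφ _
    obtain ⟨M, -, hM⟩ := ht.bounded
    exact integrable_mul_of_bounded (memLp_one_iff_integrable.1 (hF I).2)
      ht.1.continuous.aestronglyMeasurable hM
  have h := hV L _ (isTestTilde_comp_proj hN hφ)
  simp only [opT, Finset.sum_apply, Pi.smul_apply] at h
  rw [Finset.sum_comm] at h
  refine Eq.trans (Finset.sum_congr rfl fun α _ => ?_) h
  simp_rw [Finset.sum_mul]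
  rw [integral_finsetSum _ fun I _ => by simpa only [mul_assoc] using (hint α I).const_mul _,
    Finset.mul_sum]
  refine Finset.sum_congr rfl fun I _ => ?_
  have hk : ∑ t, α.toFun t = k := α.2
  change _ = _ • ((-1 : ℝ) ^ (∑ t, padIndex N α.toFun t) *
    pair₀ n (F I) (multiD (padIndex N α.toFun) (φ ∘ proj n N)))
  rw [multiD_comp_proj hN _ hφ, pair₀_comp_proj hN, sum_padIndex hN, hk, zsmul_eq_mul]
  simp_rw [mul_assoc]
  rw [integral_const_mul]
  ring

/-- The duality estimate for a single coefficient. The form `F` is turned into a divergence-free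
family by contracting with the signs `ε_L^{ℵ(iα) I}`; the labels `L` and `J = ℵ(iα)` are chosen
so that the entry with index `α` is `± F_I`. -/
lemma abs_integral_coeff_le (hn : 1 ≤ n) (hN : n ≤ N) {C₀ : ℝ} (hC₀ : 0 ≤ C₀)
    (hD : DivergenceDuality n k C₀) (al : iS n k N ≃ Label N ℓ) (hq : q + ℓ ≤ N)
    {F : Form N q (E N → ℝ)} (hF : ∀ I, MemLtilde n 1 (F I))
    (hV : VanishesDist n (opT distD al fun I => toFunctional n (F I)))
    {S : ℝ} (hS : ∀ I, (eLpNorm (F I ∘ incl n N) 1 volume).toReal ≤ S)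
    {h : E n → ℝ} (hb : MemLp h ⊤ volume) (hh : MemW 1 n h) {Γ : ℝ}
    (hΓ : ∀ t, (eLpNorm (weakDeriv (Pi.single t 1) h) n volume).toReal ≤ Γ) (I : Label N q) :
    |∫ x, F I (incl n N x) * h x| ≤
      C₀ * (Fintype.card (MultiIndex n k) * (Fintype.card (Label N q) * S)) *
        (Fintype.card (MultiIndex n k) * (n * Γ)) := by
  obtain ⟨J, L, hJL⟩ := exists_label_eps_ne_zero I hq
  have hLi : Function.Injective L := L.injective
  obtain ⟨α₀, hα₀⟩ : ∃ α₀ : MultiIndex n k, al (emb N α₀) = J := by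
    obtain ⟨α₀, h₀⟩ := (al.symm J).2
    refine ⟨α₀, ?_⟩
    rw [← al.apply_symm_apply J]
    exact congrArg al (Subtype.ext h₀)
  set g : MultiIndex n k → E n → ℝ := fun α x =>
    ∑ I : Label N q, (eps (Fin.append (al (emb N α)) I) L : ℝ) * (F I ∘ incl n N) x with hg
  have hgL : ∀ α, MemLp (g α) 1 volume := fun α =>
    memLp_finsetSum _ fun I _ => (hF I).2.const_mul _
  have key := hD g hgL (fun φ hφ => sum_integral_eq_zero_of_vanishesDist hN al hF hV L hφ)
    (fun _ => h) (fun _ => hb) (fun _ => hh) α₀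
  -- `J` and `L` determine `I`, so only one term survives.
  have hgα₀ : g α₀ = fun x => (eps (Fin.append J I) L : ℝ) * F I (incl n N x) := by
    funext x
    simp only [hg, hα₀]
    refine Finset.sum_eq_single I (fun I' _ hI' => ?_) (by simp)
    by_contra hne
    refine hI' (eps_append_right_unique hLi (fun h0 => hne ?_) hJL)
    rw [h0, Int.cast_zero, zero_mul]
  have habs : |(eps (Fin.append J I) L : ℝ)| = 1 := by
    rcases eps_eq_one_or_neg_one hLi hJL with h | h <;> simp [h]
  have hleft : |∫ x, g α₀ x * h x| = |∫ x, F I (incl n N x) * h x| := by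
    rw [hgα₀]
    simp_rw [mul_assoc]
    rw [integral_const_mul, abs_mul, habs, one_mul]
  rw [hleft] at key
  refine key.trans ?_
  have h1 : vecNorm 1 g ≤ Fintype.card (MultiIndex n k) * (Fintype.card (Label N q) * S) := by
    refine (vecNorm_le_sum le_rfl hgL).trans ?_
    rw [← nsmul_eq_mul]
    refine Finset.sum_le_card_nsmul _ _ _ fun α _ => ?_
    refine (toReal_eLpNorm_sum_le le_rfl (fun I => (hF I).2) fun I => abs_eps_le_one hLi).trans ?_
    rw [← nsmul_eq_mul]
    exact Finset.sum_le_card_nsmul _ _ _ fun I _ => hS I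
  have h2 : vecGradNorm n (fun _ : MultiIndex n k => h) ≤
      Fintype.card (MultiIndex n k) * (n * Γ) := by
    have hn1 : (1 : ℝ≥0∞) ≤ (n : ℝ≥0∞) := by exact_mod_cast hn
    refine (vecNorm_le_sum (f := fun jt : MultiIndex n k × Fin n =>
      weakDeriv (Pi.single jt.2 1) h) hn1 fun jt => (hh.memLp_weakDeriv jt.2).1).trans ?_
    refine (Finset.sum_le_card_nsmul _ _ Γ fun jt _ => hΓ jt.2).trans_eq ?_
    rw [Finset.card_univ, Fintype.card_prod, Fintype.card_fin, nsmul_eq_mul]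
    push_cast
    ring
  have h3 : 0 ≤ vecGradNorm n (fun _ : MultiIndex n k => h) := vecNorm_nonneg _ _
  have h4 := (vecNorm_nonneg 1 g).trans h1
  gcongr

lemma abs_pairing_le {F H : Form N q (E N → ℝ)} (hF : ∀ I, MemLtilde n 1 (F I))
    (hH : ∀ I, MemLtilde n ⊤ (H I)) {B : ℝ}
    (hB : ∀ I, |∫ x, F I (incl n N x) * H I (incl n N x)| ≤ B) :
    |pairing n F H| ≤ Fintype.card (Label N q) * B := by
  have hint : ∀ I, Integrable (fun x => F I (incl n N x) * H I (incl n N x)) := fun I =>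
    (hF I).2.integrable_mul (hH I).2
  rw [pairing, integral_finsetSum _ fun I _ => hint I, ← nsmul_eq_mul]
  exact (Finset.abs_sum_le_sum_abs _ _).trans (Finset.sum_le_card_nsmul _ _ _ fun I _ => hB I)

/-- The Hodge star acts on distributional forms as a signed permutation of the coefficients, so
the vanishing of `*_N U` is the vanishing of `U`. -/
lemma vanishesDist_of_star (hq : q ≤ N) {U : Form N q (Functional N)}
    (h : VanishesDist n (star U)) : VanishesDist n U := by
  obtain ⟨c, s, hc, hs, hstar⟩ := exists_star_eq hq
  intro L φ hφ
  obtain ⟨J, rfl⟩ := hc L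
  have := h J φ hφ
  rw [hstar U J] at this
  rcases hs J with h1 | h1
  · simpa [h1] using this
  · simpa [h1] using this

/-- The `k`-th order divergence duality estimate implies the estimates for forms; `K` bounds the
number of labels of each length. -/
theorem hybridDuality_of_divergenceDuality (hn : 1 ≤ n) (hN : n ≤ N) {C₀ K : ℝ} (hC₀ : 0 ≤ C₀)
    (hD : DivergenceDuality n k C₀) (al : iS n k N ≃ Label N ℓ)
    (hK : ∀ q ≤ N, (Fintype.card (Label N q) : ℝ) ≤ K) :
    HybridDuality n k ℓ N al (C₀ * Fintype.card (MultiIndex n k) ^ 2 * n * K ^ 2) := by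
  have hK0 : 0 ≤ K := (Nat.cast_nonneg _).trans (hK 0 (Nat.zero_le N))
  set m : ℝ := ((Fintype.card (MultiIndex n k) : ℕ) : ℝ) with hm
  refine ⟨fun q hq F hF hV H hb hH => ?_, fun p hℓ hp G hG hV H hb hH => ?_⟩
  · set S := normTilde n 1 F
    set Γ := gradNormTilde n n H
    have hS0 : 0 ≤ S := vecNorm_nonneg _ _
    have hΓ0 : 0 ≤ Γ := vecNorm_nonneg _ _
    have hS : ∀ I, (eLpNorm (F I ∘ incl n N) 1 volume).toReal ≤ S :=
      toReal_eLpNorm_le_vecNorm (f := fun I => F I ∘ incl n N) fun I => (hF I).2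
    have hcard := hK q (by omega)
    refine (abs_pairing_le hF hb fun I => abs_integral_coeff_le hn hN hC₀ hD al hq hF hV hS
      (hb I).2 ((hH I).memW hN)
      (toReal_eLpNorm_weakDeriv_le_gradNormTilde hN hH I) I).trans ?_
    calc _ ≤ K * (C₀ * (m * (K * S)) * (m * (n * Γ))) := by gcongr
      _ = _ := by ring
  · set S := normTilde n 1 G
    set Γ := gradNormTilde n n H
    have hS0 : 0 ≤ S := vecNorm_nonneg _ _
    have hΓ0 : 0 ≤ Γ := vecNorm_nonneg _ _
    have hS : ∀ I, (eLpNorm (G I ∘ incl n N) 1 volume).toReal ≤ S :=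
      toReal_eLpNorm_le_vecNorm (f := fun I => G I ∘ incl n N) fun I => (hG I).2
    obtain ⟨c, s, hc, hs, hstar⟩ := exists_star_eq hp
    -- `F` represents `*_N G`
    set F : Form N (N - p) (E N → ℝ) := fun J z => s J * G (c J) z with hFdef
    have hsabs : ∀ J, |(s J : ℝ)| = 1 := fun J => by rcases hs J with h | h <;> simp [h]
    have hF : ∀ J, MemLtilde n 1 (F J) := by
      intro J
      refine ⟨?_, (hG (c J)).2.const_mul _⟩
      funext z
      have := congrFun (hG (c J)).1 z
      simp only [Function.comp_apply] at this
      simp [hFdef, this]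
    have hFstar : (star fun I => toFunctional n (G I)) = fun J => toFunctional n (F J) := by
      funext J φ
      rw [hstar]
      simp only [Pi.smul_apply, toFunctional, pair₀, hFdef, zsmul_eq_mul, mul_assoc]
      rw [integral_const_mul]
    have hFV : VanishesDist n (opT distD al fun J => toFunctional n (F J)) := by
      rw [← hFstar]
      refine vanishesDist_of_star (by omega) fun J φ hφ => ?_
      have := hV J φ hφ
      simp only [opTstar, Pi.smul_apply, zsmul_eq_mul] at this
      exact (mul_eq_zero.1 this).resolve_left (by simp)
    have hFS : ∀ J, (eLpNorm (F J ∘ incl n N) 1 volume).toReal ≤ S := by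
      intro J
      refine le_trans (le_of_eq ?_) (hS (c J))
      congr 1
      refine eLpNorm_congr_norm_ae (Filter.Eventually.of_forall fun x => ?_)
      simp [hFdef, hsabs]
    have hcard := hK p hp
    have hcard' := hK (N - p) (by omega)
    refine (abs_pairing_le hG hb (B := C₀ * (m * (K * S)) * (m * (n * Γ))) fun I => ?_).trans ?_
    · obtain ⟨J, rfl⟩ := hc I
      have key := abs_integral_coeff_le hn hN hC₀ hD al (by omega) hF hFV hFS
        (hb (c J)).2 ((hH (c J)).memW hN)
        (toReal_eLpNorm_weakDeriv_le_gradNormTilde hN hH (c J)) J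
      have heq : |∫ x, F J (incl n N x) * (H (c J) ∘ incl n N) x| =
          |∫ x, G (c J) (incl n N x) * H (c J) (incl n N x)| := by
        simp only [hFdef, Function.comp_apply, mul_assoc]
        rw [integral_const_mul, abs_mul, hsabs, one_mul]
      rw [heq] at key
      refine key.trans ?_
      gcongr
    · calc _ ≤ K * (C₀ * (m * (K * S)) * (m * (n * Γ))) := by gcongr
        _ = _ := by ring

/-- The constant in the duality estimates for forms depends on `n` and `k` only, because
`N ≤ binom N ℓ = binom (n-1+k) k`. -/
theorem exists_hybridDuality (hn : 2 ≤ n) (hk : 1 ≤ k) :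
    ∃ C : ℝ, ∀ ℓ : ℕ, IsAdmissible n k ℓ → ∀ N : ℕ, IsInflatedDim n k ℓ N →
      ∀ al : iS n k N ≃ Label N ℓ, HybridDuality n k ℓ N al C := by
  obtain ⟨C₀, hC₀, hD⟩ := exists_divergenceDuality hn hk
  set M := (n - 1 + k).choose k with hM
  refine ⟨C₀ * Fintype.card (MultiIndex n k) ^ 2 * n * ((M ^ M : ℕ) : ℝ) ^ 2,
    fun ℓ hℓ N hN al => ?_⟩
  have hℓ1 := hℓ.1
  obtain ⟨hN0, hchoose, hNn⟩ := hN
  have hNM : N ≤ M := by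
    rw [hM, ← hchoose]
    exact le_choose hℓ1 (by omega)
  exact hybridDuality_of_divergenceDuality (by omega) (by omega) hC₀ hD al
    fun q hq => by exact_mod_cast card_label_le hq hNM (by omega)

end Forms

end HybridForms

end

theorem theorem2p3 (n k : ℕ) (hn : 2 ≤ n) (hk : 1 ≤ k) :
    (∃ C : ℝ, ∀ ℓ : ℕ, HybridForms.IsAdmissible n k ℓ →
      ∀ N : ℕ, HybridForms.IsInflatedDim n k ℓ N →
      ∀ al : HybridForms.iS n k N ≃ HybridForms.Label N ℓ,
        HybridForms.HybridDuality n k ℓ N al C) ∧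
    (∀ ℓ : ℕ, HybridForms.IsAdmissible n k ℓ →
      ∀ N : ℕ, HybridForms.IsInflatedDim n k ℓ N →
      ∀ al : HybridForms.iS n k N ≃ HybridForms.Label N ℓ,
        ((∃ C : ℝ, HybridForms.HybridDuality n k ℓ N al C) ↔
          ∃ C : ℝ, HybridForms.DivergenceDuality n k C)) := by
  obtain ⟨C, hC⟩ := HybridForms.exists_hybridDuality hn hk
  obtain ⟨C₀, -, hC₀⟩ := HybridForms.exists_divergenceDuality hn hk
  exact ⟨⟨C, hC⟩, fun ℓ hℓ N hN al => iff_of_true ⟨C, hC ℓ hℓ N hN al⟩ ⟨C₀, hC₀⟩⟩
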